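/- Let $n\ge 1$ and let $\mathbf C\subseteq\{+1,-1\}^n$ be an inner code. Let $\vec X$ be uniformly distributed on $\mathbf C$, with equiprobable bits ($P(X_k=1)=\tfrac12$ for every $k$), and let $Z$ be the channel observation (any random variable on the same probability space). The a priori information comes from a Gaussian channel of signal to noise ratio $\gamma_{ap}\in[0,\infty)$: it is $\vec Y=\sqrt{\gamma_{ap}}\,\vec X+\vec N$, where $\vec N$ has independent standard Gaussian entries and is independent of $(\vec X,Z)$. The extrinsic log likelihood ratio of bit $k$ is $$L_{ext}(X_k)=\log\frac{P(X_k=1\mid Z,(Y_j)_{j\ne k})}{P(X_k=-1\mid Z,(Y_j)_{j\ne k})}\in[-\infty,\infty].$$ Suppose that the extrinsic information, too, can be represented as information from a Gaussian channel: for every $\gamma_{ap}\in[0,\infty)$ there is $\gamma_{ext}=\gamma_{ext}(\gamma_{ap})\in[0,\infty]$ such that for $x=\pm1$ the conditional law of $L_{ext}(X_k)$ given $X_k=x$, averaged over $k=1,\dots,n$ (for instance, for each $k$), is that of the log likelihood ratio at the output of a Gaussian channel of signal to noise ratio $\gamma_{ext}$, namely $\mathcal N(2\gamma_{ext}x,4\gamma_{ext})$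 (and the point mass at $x\cdot\infty$ if $\gamma_{ext}=\infty$). Complete the graph of $\gamma_{ap}\mapsto\gamma_{ext}(\gamma_{ap})$ by vertical segments at its jumps, including $\gamma_{ap}=0$ and $\gamma_{ap}=\infty$, to the transfer curve from $(0,0)$ to $(\infty,\infty)$, that is, the set of all $(a,e)\in[0,\infty]^2$ with $\gamma_{ext}(a')\le e$ for all $a'<a$ and $e\le\gamma_{ext}(a')$ for all $a'>a$ (with $a'$ finite). Let $\phi(\gamma)$ be the minimum mean squared error in estimating an equiprobable $X\in\{+1,-1\}$ from $\sqrt\gamma X+N$ with $N\sim\mathcal N(0,1)$ independent of $X$, and $\phi(\infty)=0$. Let $$R_{outer}^{max}=1-\frac1n H(\vec X\mid Z)$$ be the maximum supported outer code rate, where $H$ is the conditional entropy in bits. Then along the transfer curve $\gamma_{ap}$ can be expressed as a function of $\gamma_{ext}\in[0,\infty)$, with values in $[0,\infty]$, and for every such choice the function $\gamma_{ext}\mapsto\phi(\gamma_{ap}+\gamma_{ext})$ is integrable on $(0,\infty)$ and $$R_{outer}^{max}=\frac1{\ln 4}\int_0^\infty\phi(\gamma_{ap}+\gamma_{ext})\,d\gamma_{ext}.$$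 -/

import Mathlib

open MeasureTheory ProbabilityTheory
open scoped ENNReal NNReal

noncomputable section

/-- Minimum mean squared error in estimating the real random variable `X` from `Y`:
`E[(X - E[X | Y])²]`. -/
def mmse {Ω β : Type*} [MeasurableSpace Ω] [MeasurableSpace β] (μ : Measure Ω)
    (X : Ω → ℝ) (Y : Ω → β) : ℝ :=
  ∫ ω, (X ω - (μ[X | MeasurableSpace.comap Y inferInstance]) ω) ^ 2 ∂μ

/-- Law of an equiprobable `±1` bit. -/
def bitLaw : Measure ℝ :=
  (2⁻¹ : ℝ≥0∞) • Measure.dirac 1 + (2⁻¹ : ℝ≥0∞) • Measure.dirac (-1)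

/-- `φ(γ)`: the minimum mean squared error in estimating an equiprobable `±1` bit `X` from
`√γ X + N`, where `N` is standard Gaussian and independent of `X`; `φ(∞) = 0`. -/
def phi (γ : ℝ≥0∞) : ℝ :=
  if γ = ⊤ then 0
  else mmse (bitLaw.prod (gaussianReal 0 1)) (fun p : ℝ × ℝ => p.1)
    (fun p : ℝ × ℝ => √γ.toReal * p.1 + p.2)

/-- Output of the Gaussian channel with signal to noise ratio `γ`, input `X`, noise `N`. -/
def awgn {Ω : Type*} {n : ℕ} (X N : Ω → Fin n → ℝ) (γ : ℝ≥0) : Ω → Fin n → ℝ :=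
  fun ω i => √(γ : ℝ) * X ω i + N ω i

/-- Conditional entropy `H(X | Z)` in bits of a random variable `X` with values in the finite
set `C`. -/
def condEntropyBits {Ω α β : Type*} [MeasurableSpace Ω] [MeasurableSpace β] (μ : Measure Ω)
    (C : Finset α) (X : Ω → α) (Z : Ω → β) : ℝ :=
  (∫ ω, ∑ c ∈ C,
    Real.negMulLog ((μ⟦X ⁻¹' {c} | MeasurableSpace.comap Z inferInstance⟧) ω) ∂μ) / Real.log 2

/-- `R_outer^max = 1 - H(X | X ∈ C, Z) / n` for an inner code `C` of length `n` whose codeword `X`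
is observed through `Z`. -/
def maxOuterRate {Ω β : Type*} [MeasurableSpace Ω] [MeasurableSpace β] {n : ℕ} (μ : Measure Ω)
    (C : Finset (Fin n → ℝ)) (X : Ω → Fin n → ℝ) (Z : Ω → β) : ℝ :=
  1 - condEntropyBits μ C X Z / n

/-- Log likelihood ratio `log (P(B = 1 | V) / P(B = -1 | V))` of the bit `B` given `V`, with
values in `[-∞, ∞]`. -/
def llr {Ω β : Type*} [MeasurableSpace Ω] [MeasurableSpace β] (μ : Measure Ω)
    (B : Ω → ℝ) (V : Ω → β) (ω : Ω) : EReal :=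
  ENNReal.log
    (ENNReal.ofReal ((μ⟦B ⁻¹' {1} | MeasurableSpace.comap V inferInstance⟧) ω) /
      ENNReal.ofReal ((μ⟦B ⁻¹' {-1} | MeasurableSpace.comap V inferInstance⟧) ω))

/-- Extrinsic log likelihood ratio of bit `k`: the log likelihood ratio of `X k` given the
channel observation `Z` and the a priori observations `Y j` of all the other bits `j ≠ k`. -/
def extrinsicLLR {Ω β : Type*} [MeasurableSpace Ω] [MeasurableSpace β] {n : ℕ} (μ : Measure Ω)
    (X Y : Ω → Fin n → ℝ) (Z : Ω → β) (k : Fin n) : Ω → EReal :=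
  llr μ (fun ω => X ω k) (fun ω => (Z ω, fun j : {j : Fin n // j ≠ k} => Y ω j))

/-- Law of the extrinsic log likelihood ratio given that the bit equals `x`, averaged over the
bit positions. -/
def extrinsicLLRLaw {Ω β : Type*} [MeasurableSpace Ω] [MeasurableSpace β] {n : ℕ} (μ : Measure Ω)
    (X Y : Ω → Fin n → ℝ) (Z : Ω → β) (x : ℝ) : Measure EReal :=
  (n : ℝ≥0∞)⁻¹ • ∑ k : Fin n,
    (ProbabilityTheory.cond μ {ω | X ω k = x}).map (extrinsicLLR μ X Y Z k)

/-- Law of the log likelihood ratio of an equiprobable bit at the output of the Gaussian channel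
with signal to noise ratio `γ`, given that the bit is `x = ±1`: this is the law of
`2√γ (√γ x + N)`, i.e. `𝒩(m x, 2m)` with `m = 2γ`; for `γ = ∞` the bit is known. -/
def awgnLLRLaw (γ : ℝ≥0∞) (x : ℝ) : Measure EReal :=
  if γ = ⊤ then Measure.dirac (if x = 1 then ⊤ else ⊥)
  else (gaussianReal (2 * γ.toReal * x) (4 * γ.toNNReal)).map Real.toEReal

/-- The extrinsic information can be represented as information from Gaussian channels: when the
a priori observations come from a Gaussian channel with signal to noise ratio `γ`, the extrinsic
log likelihood ratios are distributed like those of a Gaussian channel with signal to noise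
ratio `γext γ`. -/
def GaussianExtrinsic {Ω β : Type*} [MeasurableSpace Ω] [MeasurableSpace β] {n : ℕ}
    (μ : Measure Ω) (X N : Ω → Fin n → ℝ) (Z : Ω → β) (γext : ℝ≥0 → ℝ≥0∞) : Prop :=
  ∀ γ : ℝ≥0, ∀ x : ℝ, x = 1 ∨ x = -1 →
    extrinsicLLRLaw μ X (awgn X N γ) Z x = awgnLLRLaw (γext γ) x

/-- The point `(a, e)` lies on the transfer curve, i.e. on the graph of `γext` completed by
vertical segments at its jumps to a curve from `(0, 0)` to `(∞, ∞)`: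
`γext(a-) ≤ e ≤ γext(a+)`, where `γext(0-) = 0` and `γext(∞+) = ∞`. -/
def OnTransferCurve (γext : ℝ≥0 → ℝ≥0∞) (a e : ℝ≥0∞) : Prop :=
  (∀ a' : ℝ≥0, (a' : ℝ≥0∞) < a → γext a' ≤ e) ∧ (∀ a' : ℝ≥0, a < (a' : ℝ≥0∞) → e ≤ γext a')

/-- `γap` expresses the a priori signal to noise ratio as a function of the extrinsic one, `t`,
along the transfer curve. -/
def IsAprioriSNR (γext : ℝ≥0 → ℝ≥0∞) (γap : ℝ → ℝ≥0∞) : Prop :=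
  ∀ t : ℝ, 0 ≤ t → OnTransferCurve γext (γap t) (ENNReal.ofReal t)

end

/-! Two area computations give the result.

The first area is an entropy. Fix `Z = z`, let `X` have the conditional law of the codeword, and
send it through the Gaussian channel at signal to noise ratio `γ`. The derivative of the conditional
entropy (in nats) in `γ` is minus half the sum of the bitwise mean squared errors. The entropy falls
from its prior value at `γ = 0` to zero at `γ = ∞`, so the area under the error curve is twice the
prior entropy (`lintegral_totalMMSE`). Averaging over `z` gives twice `H(X | Z)`.

The Gaussian hypothesis evaluates the same error differently. The log likelihood ratio of bit `k` is
its extrinsic value plus the contribution of its own observation `Y k`. Given the bit, the noises of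
the two are independent, so if the extrinsic part comes from a Gaussian channel, the two signal to
noise ratios add. The average error per bit is therefore `φ(γ + γext γ)`
(`IsCodeModel.lintegral_totalMMSE_eq`), and `n ∫ φ(a + γext a) da = 2 H(X | Z)` in nats.

The second area is purely geometric. The function `γext` is increasing, so each line `a + e = u`
meets the completed curve in a single point `(x, u - x)`. Up to endpoints, `{a | a + γext a < u}` is
an interval of length `x`, and `{t | γap t + t < u}` one of length `u - x`. Hence the distributions
of `a + γext a` and `γap t + t` add up to Lebesgue measure, and `∫ φ(a + γext a) da + ∫ φ(γap t + t)
dt = ∫ φ(u) du` (`IsAprioriSNR.lintegral_add`). The last integral is `log 4`, by the first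
computation applied to one free bit. Subtracting gives the rate formula.

Monotonicity of `γext` is not assumed. A noisier a priori observation is obtained from a better one
by adding noise, so by Cauchy-Schwarz the Bhattacharyya coefficient of each extrinsic channel
decreases in `γ`; for a Gaussian channel this coefficient determines the signal to noise ratio
(`IsCodeModel.monotone_of_gaussianExtrinsic`). -/

noncomputable section

open Set Filter Topology Matrix

/-- The standard Gaussian measure on `ι → ℝ`, with independent entries. -/
def stdGauss (ι : Type*) [Fintype ι] : Measure (ι → ℝ) :=
  Measure.pi (fun _ => gaussianReal 0 1)

instance (ι : Type*) [Fintype ι] : IsProbabilityMeasure (stdGauss ι) := by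
  unfold stdGauss; infer_instance

/-- Density, with respect to the standard Gaussian measure, of its translate by `a`. -/
def shiftDensity {ι : Type*} [Fintype ι] (a w : ι → ℝ) : ℝ :=
  Real.exp (a ⬝ᵥ w - a ⬝ᵥ a / 2)

/-! ### Translations and rotations of the standard Gaussian measure -/

section Shift

variable {ι : Type*} [Fintype ι]

lemma measurable_dotProduct_left (a : ι → ℝ) : Measurable (fun w : ι → ℝ => a ⬝ᵥ w) := by
  unfold dotProduct; fun_prop

lemma shiftDensity_pos (a w : ι → ℝ) : 0 < shiftDensity a w := Real.exp_pos _

lemma measurable_shiftDensity (a : ι → ℝ) : Measurable (shiftDensity a) := by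
  unfold shiftDensity
  have := measurable_dotProduct_left a
  fun_prop

lemma gaussianReal_eq_withDensity_std (a : ℝ) :
    gaussianReal a 1 = (gaussianReal 0 1).withDensity
      (fun x => ENNReal.ofReal (Real.exp (a * x - a * a / 2))) := by
  rw [gaussianReal_of_var_ne_zero _ one_ne_zero, gaussianReal_of_var_ne_zero _ one_ne_zero,
    ← withDensity_mul _ (measurable_gaussianPDF _ _) (by fun_prop)]
  congr 1
  ext x
  simp only [Pi.mul_apply, gaussianPDF]
  rw [← ENNReal.ofReal_mul (gaussianPDFReal_nonneg _ _ _)]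
  congr 1
  simp only [gaussianPDFReal]
  rw [mul_assoc (√_)⁻¹, ← Real.exp_add]
  congr 2
  simp
  ring

/-- The density is a product over the coordinates, so it suffices to compare both measures on boxes,
where the claim reduces to dimension one. This is what turns an integral over the noise into one
over the observation. -/
lemma stdGauss_map_add (a : ι → ℝ) :
    (stdGauss ι).map (fun w => a + w) =
      (stdGauss ι).withDensity (fun w => ENNReal.ofReal (shiftDensity a w)) := by
  have h1 : (stdGauss ι).map (fun w => a + w) = Measure.pi (fun i => gaussianReal (a i) 1) := by
    have := Measure.pi_map_pi (μ := fun _ : ι => gaussianReal 0 1)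
      (f := fun i x => a i + x) (hμ := fun i => by
        rw [gaussianReal_map_const_add]; infer_instance) (fun i => by fun_prop)
    simp only [gaussianReal_map_const_add, zero_add] at this
    exact this
  rw [h1]
  refine Measure.pi_eq fun s hs => ?_
  rw [withDensity_apply _ (MeasurableSet.univ_pi hs), ← lintegral_indicator (MeasurableSet.univ_pi hs)]
  have h2 : ∀ w : ι → ℝ, (univ.pi s).indicator (fun w => ENNReal.ofReal (shiftDensity a w)) w =
      ∏ i, (s i).indicator (fun x => ENNReal.ofReal (Real.exp (a i * x - a i * a i / 2))) (w i) := by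
    intro w
    by_cases hw : w ∈ univ.pi s
    · rw [indicator_of_mem hw]
      have : ∀ i, w i ∈ s i := fun i => hw i (mem_univ i)
      simp_rw [indicator_of_mem (this _)]
      rw [← ENNReal.ofReal_prod_of_nonneg (fun _ _ => (Real.exp_pos _).le), ← Real.exp_sum]
      simp [shiftDensity, dotProduct, Finset.sum_sub_distrib, Finset.sum_div]
    · rw [indicator_of_notMem hw]
      simp only [mem_univ_pi, not_forall] at hw
      obtain ⟨i, hi⟩ := hw
      exact (Finset.prod_eq_zero (Finset.mem_univ i) (indicator_of_notMem hi _)).symm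
  simp_rw [h2]
  have hm : ∀ i, Measurable ((s i).indicator
      (fun x : ℝ => ENNReal.ofReal (Real.exp (a i * x - a i * a i / 2)))) := fun i =>
    Measurable.indicator (by fun_prop) (hs i)
  have hind := iIndepFun_pi (μ := fun _ : ι => gaussianReal 0 1) (fun i => (hm i).aemeasurable)
  unfold stdGauss
  rw [lintegral_prod_eq_prod_lintegral_of_indepFun Finset.univ _ hind
    (fun i => (hm i).comp (measurable_pi_apply i))]
  refine Finset.prod_congr rfl fun i _ => ?_
  rw [gaussianReal_eq_withDensity_std (a i), withDensity_apply _ (hs i),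
    ← lintegral_indicator (hs i)]
  have := (measurePreserving_eval (fun _ : ι => gaussianReal 0 1) i).lintegral_comp (hm i)
  exact this

lemma lintegral_stdGauss_add (a : ι → ℝ) {F : (ι → ℝ) → ℝ≥0∞} (hF : Measurable F) :
    ∫⁻ w, F (a + w) ∂stdGauss ι =
      ∫⁻ w, ENNReal.ofReal (shiftDensity a w) * F w ∂stdGauss ι := by
  have h := lintegral_map (μ := stdGauss ι) hF (measurable_const_add a)
  rw [← h, stdGauss_map_add,
    lintegral_withDensity_eq_lintegral_mul _ (measurable_shiftDensity a).ennreal_ofReal hF]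
  rfl

lemma integral_stdGauss_add (a : ι → ℝ) (F : (ι → ℝ) → ℝ) :
    ∫ w, F (a + w) ∂stdGauss ι = ∫ w, shiftDensity a w * F w ∂stdGauss ι := by
  have h := integral_map_equiv (μ := stdGauss ι) (MeasurableEquiv.addLeft a) F
  simp only [MeasurableEquiv.coe_addLeft] at h
  rw [← h, stdGauss_map_add, integral_withDensity_eq_integral_toReal_smul
    (measurable_shiftDensity a).ennreal_ofReal (by simp)]
  simp [ENNReal.toReal_ofReal (shiftDensity_pos _ _).le]

lemma integrable_stdGauss_add_iff (a : ι → ℝ) (F : (ι → ℝ) → ℝ) :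
    Integrable (fun w => F (a + w)) (stdGauss ι) ↔
      Integrable (fun w => shiftDensity a w * F w) (stdGauss ι) := by
  have h := integrable_map_equiv (μ := stdGauss ι) (MeasurableEquiv.addLeft a) F
  simp only [MeasurableEquiv.coe_addLeft] at h
  have h' : (F ∘ fun w => a + w) = fun w => F (a + w) := rfl
  rw [← h', ← h, stdGauss_map_add, integrable_withDensity_iff_integrable_smul'
    (measurable_shiftDensity a).ennreal_ofReal (by simp)]
  simp [ENNReal.toReal_ofReal (shiftDensity_pos _ _).le]

lemma lintegral_shiftDensity (a : ι → ℝ) :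
    ∫⁻ w, ENNReal.ofReal (shiftDensity a w) ∂stdGauss ι = 1 := by
  have := lintegral_stdGauss_add a (F := fun _ => 1) measurable_const
  simpa using this.symm

-- A sum of independent centered Gaussians is Gaussian, and its variance here is `r ^ 2 + t ^ 2`.
omit [Fintype ι] in
lemma gaussianReal_map_rotate {r t : ℝ} (hrt : r ^ 2 + t ^ 2 = 1) :
    ((gaussianReal 0 1).prod (gaussianReal 0 1)).map (fun p : ℝ × ℝ => r * p.1 + t * p.2) =
      gaussianReal 0 1 := by
  have hi : IndepFun (fun p : ℝ × ℝ => r * p.1) (fun p : ℝ × ℝ => t * p.2)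
      ((gaussianReal 0 1).prod (gaussianReal 0 1)) :=
    indepFun_prod (X := fun x => r * x) (Y := fun x => t * x) (by fun_prop) (by fun_prop)
  have ha : ((gaussianReal 0 1).prod (gaussianReal 0 1)).map (fun p : ℝ × ℝ => r * p.1) =
      gaussianReal (r * 0) (.mk (r ^ 2) (sq_nonneg _) * 1) := by
    have h := (measurePreserving_fst (μ := gaussianReal 0 1) (ν := gaussianReal 0 1)).map_eq
    rw [← gaussianReal_map_const_mul]
    conv_rhs => rw [← h]
    rw [Measure.map_map (measurable_const_mul r) measurable_fst]
    rfl
  have hb : ((gaussianReal 0 1).prod (gaussianReal 0 1)).map (fun p : ℝ × ℝ => t * p.2) =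
      gaussianReal (t * 0) (.mk (t ^ 2) (sq_nonneg _) * 1) := by
    have h := (measurePreserving_snd (μ := gaussianReal 0 1) (ν := gaussianReal 0 1)).map_eq
    rw [← gaussianReal_map_const_mul]
    conv_rhs => rw [← h]
    rw [Measure.map_map (measurable_const_mul t) measurable_snd]
    rfl
  have := gaussianReal_add_gaussianReal_of_indepFun hi ha hb
  have hv : (NNReal.mk (r ^ 2) (sq_nonneg _) * 1 + NNReal.mk (t ^ 2) (sq_nonneg _) * 1 : ℝ≥0) = 1 := by
    ext; simp [hrt]
  rw [hv] at this
  simp only [mul_zero, add_zero] at this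
  exact this

/-- Invariance of the standard Gaussian measure under rotations of pairs of vectors. -/
lemma lintegral_stdGauss_rotate {r t : ℝ} (hrt : r ^ 2 + t ^ 2 = 1) {F : (ι → ℝ) → ℝ≥0∞}
    (hF : Measurable F) :
    ∫⁻ w, ∫⁻ v, F (r • w + t • v) ∂stdGauss ι ∂stdGauss ι = ∫⁻ w, F w ∂stdGauss ι := by
  have h1 := gaussianReal_map_rotate hrt
  have h2 : ((stdGauss ι).prod (stdGauss ι)).map (fun p => r • p.1 + t • p.2) = stdGauss ι := by
    -- A pair of vectors is regrouped as a vector of independent pairs, and each pair is rotated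
    -- separately.
    have hA := measurePreserving_arrowProdEquivProdArrow ℝ ℝ ι (fun _ => gaussianReal 0 1)
      (fun _ => gaussianReal 0 1)
    unfold stdGauss
    rw [← hA.map_eq, Measure.map_map (by fun_prop) hA.measurable]
    have := Measure.pi_map_pi (μ := fun _ : ι => (gaussianReal 0 1).prod (gaussianReal 0 1))
      (f := fun _ p => r * p.1 + t * p.2) (hμ := fun i => by
        rw [h1]; infer_instance) (fun i => by fun_prop)
    rw [h1] at this
    exact this
  rw [← lintegral_prod (f := fun p : (ι → ℝ) × (ι → ℝ) => F (r • p.1 + t • p.2))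
    (hf := by fun_prop), ← lintegral_map hF (by fun_prop), h2]

lemma integrable_eval_stdGauss (i : ι) : Integrable (fun w : ι → ℝ => w i) (stdGauss ι) :=
  (measurePreserving_eval (fun _ : ι => gaussianReal 0 1) i).integrable_comp_of_integrable
    ((memLp_id_gaussianReal' 1 (by simp)).integrable le_rfl)

lemma integrable_sq_eval_stdGauss (i : ι) :
    Integrable (fun w : ι → ℝ => w i * w i) (stdGauss ι) := by
  have := (measurePreserving_eval (fun _ : ι => gaussianReal 0 1) i).integrable_comp_of_integrable
    (g := fun x => id x ^ 2) ((memLp_id_gaussianReal' 2 (by simp)).integrable_sq)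
  simpa [Function.comp_def, sq, stdGauss] using this

lemma integral_eval_stdGauss (i : ι) : ∫ w, w i ∂stdGauss ι = 0 := by
  have h := integral_map (μ := stdGauss ι) (φ := fun w : ι → ℝ => w i) (f := fun x => x)
    (measurable_pi_apply i).aemeasurable (by fun_prop)
  rw [← h]
  have h2 := (measurePreserving_eval (fun _ : ι => gaussianReal 0 1) i).map_eq
  have h3 : (stdGauss ι).map (fun w : ι → ℝ => w i) = gaussianReal 0 1 := h2
  rw [h3, integral_id_gaussianReal]

end Shift

/-! ### Posterior means and the pointwise derivative of the information loss -/

section InfoMMSE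

variable {ι : Type*} [Fintype ι]

/-- Partition function of the posterior on `C` with prior weights `p`, at the observation `y` of
the Gaussian channel of amplitude `s`. -/
def partFn (C : Finset (ι → ℝ)) (p : (ι → ℝ) → ℝ) (s : ℝ) (y : ι → ℝ) : ℝ :=
  ∑ c ∈ C, p c * Real.exp (s * (c ⬝ᵥ y))

/-- Posterior mean of the `i`-th coordinate. -/
def postMean (C : Finset (ι → ℝ)) (p : (ι → ℝ) → ℝ) (s : ℝ) (y : ι → ℝ) (i : ι) : ℝ :=
  (∑ c ∈ C, p c * Real.exp (s * (c ⬝ᵥ y)) * c i) / partFn C p s y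

/-- Total weight zero is allowed, because the quotient is then `0`. This bounds posterior means by
one and supplies the dominating function for differentiation under the integral. -/
lemma abs_weighted_avg_le {α : Type*} (C : Finset α) (w f : α → ℝ) (hw : ∀ c ∈ C, 0 ≤ w c)
    {B : ℝ} (hf : ∀ c ∈ C, |f c| ≤ B) (hB : 0 ≤ B) :
    |(∑ c ∈ C, w c * f c) / ∑ c ∈ C, w c| ≤ B := by
  rw [abs_div, abs_of_nonneg (Finset.sum_nonneg hw)]
  refine div_le_of_le_mul₀ (Finset.sum_nonneg hw) hB ?_
  rw [Finset.mul_sum]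
  refine (Finset.abs_sum_le_sum_abs _ _).trans (Finset.sum_le_sum fun c hc => ?_)
  rw [abs_mul, abs_of_nonneg (hw c hc), mul_comm]
  exact mul_le_mul_of_nonneg_right (hf c hc) (hw c hc)

lemma exists_pos_of_sum_eq_one {α : Type*} {C : Finset α} {p : α → ℝ}
    (h1 : ∑ c ∈ C, p c = 1) : ∃ c ∈ C, 0 < p c := by
  by_contra! h
  have := Finset.sum_nonpos h
  linarith

lemma sum_mul_exp_pos {α : Type*} {C : Finset α} {p : α → ℝ} (h0 : ∀ c ∈ C, 0 ≤ p c)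
    (h1 : ∑ c ∈ C, p c = 1) (E : α → ℝ) : 0 < ∑ c ∈ C, p c * Real.exp (E c) := by
  obtain ⟨c, hc, hp⟩ := exists_pos_of_sum_eq_one h1
  exact Finset.sum_pos' (fun d hd => mul_nonneg (h0 d hd) (Real.exp_pos _).le)
    ⟨c, hc, mul_pos hp (Real.exp_pos _)⟩

lemma hasDerivAt_log_sum_exp {α : Type*} {C : Finset α} {p : α → ℝ} (h0 : ∀ c ∈ C, 0 ≤ p c)
    (h1 : ∑ c ∈ C, p c = 1) {E : α → ℝ → ℝ} {E' : α → ℝ} {s : ℝ}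
    (hE : ∀ c ∈ C, HasDerivAt (E c) (E' c) s) :
    HasDerivAt (fun s => Real.log (∑ c ∈ C, p c * Real.exp (E c s)))
      ((∑ c ∈ C, p c * Real.exp (E c s) * E' c) / ∑ c ∈ C, p c * Real.exp (E c s)) s := by
  refine HasDerivAt.log ?_ (sum_mul_exp_pos h0 h1 _).ne'
  refine HasDerivAt.fun_sum fun c hc => ?_
  simpa [mul_assoc] using ((hE c hc).exp.const_mul (p c))

lemma measurable_partFn (C : Finset (ι → ℝ)) (p : (ι → ℝ) → ℝ) (s : ℝ) :
    Measurable (partFn C p s) := by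
  unfold partFn
  have := fun c : ι → ℝ => measurable_dotProduct_left c
  fun_prop

lemma measurable_postMean (C : Finset (ι → ℝ)) (p : (ι → ℝ) → ℝ) (s : ℝ) (i : ι) :
    Measurable (fun y => postMean C p s y i) := by
  unfold postMean
  have := fun c : ι → ℝ => measurable_dotProduct_left c
  have := measurable_partFn C p s
  fun_prop

variable {C : Finset (ι → ℝ)} {p : (ι → ℝ) → ℝ}

omit [Fintype ι] in
lemma abs_eq_one_of_mem (hC : ∀ c ∈ C, ∀ i, c i = 1 ∨ c i = -1) {c : ι → ℝ} (hc : c ∈ C) (i : ι) :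
    |c i| = 1 := by
  rcases hC c hc i with h | h <;> simp [h]

lemma dotProduct_self_of_mem (hC : ∀ c ∈ C, ∀ i, c i = 1 ∨ c i = -1) {c : ι → ℝ} (hc : c ∈ C) :
    c ⬝ᵥ c = Fintype.card ι := by
  have : ∀ i, c i * c i = 1 := fun i => by rcases hC c hc i with h | h <;> simp [h]
  simp [dotProduct, this]

lemma abs_postMean_le (hC : ∀ c ∈ C, ∀ i, c i = 1 ∨ c i = -1) (h0 : ∀ c ∈ C, 0 ≤ p c)
    (s : ℝ) (y : ι → ℝ) (i : ι) : |postMean C p s y i| ≤ 1 :=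
  abs_weighted_avg_le C _ _ (fun _ hc => mul_nonneg (h0 _ hc) (Real.exp_pos _).le)
    (fun _ hc => (abs_eq_one_of_mem hC hc i).le) zero_le_one

lemma postMean_sq_le (hC : ∀ c ∈ C, ∀ i, c i = 1 ∨ c i = -1) (h0 : ∀ c ∈ C, 0 ≤ p c)
    (s : ℝ) (y : ι → ℝ) (i : ι) : postMean C p s y i ^ 2 ≤ 1 := by
  have := abs_postMean_le hC h0 s y i
  exact (sq_le_one_iff_abs_le_one _).2 this

lemma partFn_mul_postMean (h0 : ∀ c ∈ C, 0 ≤ p c) (h1 : ∑ c ∈ C, p c = 1) (s : ℝ) (y : ι → ℝ)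
    (i : ι) : partFn C p s y * postMean C p s y i =
      ∑ c ∈ C, p c * Real.exp (s * (c ⬝ᵥ y)) * c i :=
  mul_div_cancel₀ _ (sum_mul_exp_pos h0 h1 _).ne'

/-- All sign vectors have the same norm, so the quadratic factor is common to all codewords and
cancels in posteriors. This is why `partFn` carries only the linear exponent. -/
lemma shiftDensity_smul_of_mem (hC : ∀ c ∈ C, ∀ i, c i = 1 ∨ c i = -1) {c : ι → ℝ} (hc : c ∈ C)
    (s : ℝ) (w : ι → ℝ) : shiftDensity (s • c) w =
      Real.exp (-(s ^ 2 * Fintype.card ι / 2)) * Real.exp (s * (c ⬝ᵥ w)) := by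
  rw [shiftDensity, ← Real.exp_add]
  simp only [smul_dotProduct, dotProduct_smul, dotProduct_self_of_mem hC hc, smul_eq_mul]
  ring_nf

/-- The tower property: the posterior mean has the same correlations with functions of the
observation as the codeword itself. -/
lemma sum_integral_postMean_mul (hC : ∀ c ∈ C, ∀ i, c i = 1 ∨ c i = -1) (h0 : ∀ c ∈ C, 0 ≤ p c)
    (h1 : ∑ c ∈ C, p c = 1) (s : ℝ) (i : ι) {g : (ι → ℝ) → ℝ}
    (hg : ∀ c ∈ C, Integrable (fun w => g (s • c + w)) (stdGauss ι)) :
    ∑ c ∈ C, p c * ∫ w, postMean C p s (s • c + w) i * g (s • c + w) ∂stdGauss ι =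
      ∑ c ∈ C, p c * ∫ w, c i * g (s • c + w) ∂stdGauss ι := by
  have hg' : ∀ c ∈ C, Integrable (fun w => shiftDensity (s • c) w * g w) (stdGauss ι) :=
    fun c hc => (integrable_stdGauss_add_iff _ _).1 (hg c hc)
  have hpm : ∀ c ∈ C, Integrable (fun w => shiftDensity (s • c) w * (postMean C p s w i * g w))
      (stdGauss ι) := by
    intro c hc
    have := (hg' c hc).bdd_mul (c := 1) (f := fun w => postMean C p s w i)
      (measurable_postMean C p s i).aestronglyMeasurable
      (ae_of_all _ fun w => by simpa using abs_postMean_le hC h0 s w i)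
    refine this.congr (ae_of_all _ fun w => ?_)
    simp only []
    ring
  -- With the observation as variable, all codewords share the same integration measure. The
  -- identity then holds pointwise: it is `partFn_mul_postMean` times a common factor.
  have e1 : ∀ c ∈ C, p c * ∫ w, postMean C p s (s • c + w) i * g (s • c + w) ∂stdGauss ι =
      ∫ w, p c * (shiftDensity (s • c) w * (postMean C p s w i * g w)) ∂stdGauss ι := by
    intro c hc
    rw [integral_stdGauss_add (s • c) (fun w => postMean C p s w i * g w), integral_const_mul]
  have e2 : ∀ c ∈ C, p c * ∫ w, c i * g (s • c + w) ∂stdGauss ι =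
      ∫ w, p c * (c i * (shiftDensity (s • c) w * g w)) ∂stdGauss ι := by
    intro c hc
    rw [integral_const_mul, integral_stdGauss_add (s • c) g, integral_const_mul, integral_const_mul]
  rw [Finset.sum_congr rfl e1, Finset.sum_congr rfl e2,
    ← integral_finsetSum _ (fun c hc => (hpm c hc).const_mul _),
    ← integral_finsetSum _ (fun c hc => ((hg' c hc).const_mul _).const_mul _)]
  refine integral_congr_ae (ae_of_all _ fun w => ?_)
  have h := partFn_mul_postMean h0 h1 s w i
  have l : ∀ c ∈ C, p c * (shiftDensity (s • c) w * (postMean C p s w i * g w)) =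
      (Real.exp (-(s ^ 2 * Fintype.card ι / 2)) * g w * postMean C p s w i) *
        (p c * Real.exp (s * (c ⬝ᵥ w))) := fun c hc => by
    rw [shiftDensity_smul_of_mem hC hc]; ring
  have r : ∀ c ∈ C, p c * (c i * (shiftDensity (s • c) w * g w)) =
      (Real.exp (-(s ^ 2 * Fintype.card ι / 2)) * g w) *
        (p c * Real.exp (s * (c ⬝ᵥ w)) * c i) := fun c hc => by
    rw [shiftDensity_smul_of_mem hC hc]; ring
  simp only []
  rw [Finset.sum_congr rfl l, Finset.sum_congr rfl r, ← Finset.mul_sum, ← Finset.mul_sum, ← h,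
    partFn]
  ring

/-- Exponent of the posterior weight of `d` relative to that of the transmitted word `c`. -/
def relExponent (c w : ι → ℝ) (d : ι → ℝ) (s : ℝ) : ℝ :=
  s ^ 2 * (c ⬝ᵥ d - c ⬝ᵥ c) + s * ((d - c) ⬝ᵥ w)

/-- Log of the prior weight over the posterior weight of the transmitted word `c`. -/
def infoLoss (C : Finset (ι → ℝ)) (p : (ι → ℝ) → ℝ) (c : ι → ℝ) (s : ℝ) (w : ι → ℝ) : ℝ :=
  Real.log (∑ d ∈ C, p d * Real.exp (relExponent c w d s))

lemma measurable_infoLoss (C : Finset (ι → ℝ)) (p : (ι → ℝ) → ℝ) (c : ι → ℝ) (s : ℝ) :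
    Measurable (infoLoss C p c s) := by
  unfold infoLoss relExponent
  have := fun c : ι → ℝ => measurable_dotProduct_left c
  fun_prop

/-- Complete the square: expand `‖s (d - c) - w‖² ≥ 0` and use that `c` and `d` have equal norms.
The bound is free of `s`, which permits dominated convergence as `s → ∞`. -/
lemma relExponent_le (hC : ∀ c ∈ C, ∀ i, c i = 1 ∨ c i = -1) {c d : ι → ℝ} (hc : c ∈ C)
    (hd : d ∈ C) (s : ℝ) (w : ι → ℝ) : relExponent c w d s ≤ w ⬝ᵥ w / 2 := by
  have h : 0 ≤ (s • (d - c) - w) ⬝ᵥ (s • (d - c) - w) :=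
    Finset.sum_nonneg fun i _ => mul_self_nonneg _
  have hcc := dotProduct_self_of_mem hC hc
  have hdd := dotProduct_self_of_mem hC hd
  simp only [sub_dotProduct, dotProduct_sub, smul_dotProduct, dotProduct_smul, smul_eq_mul,
    dotProduct_comm d c, dotProduct_comm w c, dotProduct_comm w d] at h
  simp only [relExponent, sub_dotProduct]
  rw [hcc, hdd] at h
  rw [hcc]
  nlinarith

lemma infoLoss_le (hC : ∀ c ∈ C, ∀ i, c i = 1 ∨ c i = -1) (h0 : ∀ c ∈ C, 0 ≤ p c)
    (h1 : ∑ c ∈ C, p c = 1) {c : ι → ℝ} (hc : c ∈ C) (s : ℝ) (w : ι → ℝ) :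
    infoLoss C p c s w ≤ w ⬝ᵥ w / 2 := by
  rw [infoLoss, Real.log_le_iff_le_exp (sum_mul_exp_pos h0 h1 _)]
  calc _ ≤ ∑ d ∈ C, p d * Real.exp (w ⬝ᵥ w / 2) := Finset.sum_le_sum fun d hd =>
        mul_le_mul_of_nonneg_left (Real.exp_le_exp.2 (relExponent_le hC hc hd s w)) (h0 d hd)
    _ = _ := by rw [← Finset.sum_mul, h1, one_mul]

lemma relExponent_self (c w : ι → ℝ) (s : ℝ) : relExponent c w c s = 0 := by
  simp [relExponent]

/-- The transmitted word contributes exactly `p c` to the sum, since its relative exponent is zero.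
-/
lemma log_le_infoLoss (h0 : ∀ c ∈ C, 0 ≤ p c) {c : ι → ℝ} (hc : c ∈ C) (hpc : 0 < p c)
    (s : ℝ) (w : ι → ℝ) : Real.log (p c) ≤ infoLoss C p c s w := by
  refine Real.log_le_log hpc ?_
  have := Finset.single_le_sum (f := fun d => p d * Real.exp (relExponent c w d s))
    (fun d hd => mul_nonneg (h0 d hd) (Real.exp_pos _).le) hc
  simpa [relExponent_self] using this

lemma integrable_dotProduct_self : Integrable (fun w : ι → ℝ => w ⬝ᵥ w) (stdGauss ι) :=
  integrable_finsetSum _ fun i _ => integrable_sq_eval_stdGauss i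

/-- A bound for `infoLoss` that does not depend on the amplitude. -/
def infoBound (p : (ι → ℝ) → ℝ) (c w : ι → ℝ) : ℝ := w ⬝ᵥ w / 2 + |Real.log (p c)|

lemma integrable_infoBound (p : (ι → ℝ) → ℝ) (c : ι → ℝ) :
    Integrable (infoBound p c) (stdGauss ι) :=
  (integrable_dotProduct_self.div_const 2).add (integrable_const _)

lemma abs_infoLoss_le (hC : ∀ c ∈ C, ∀ i, c i = 1 ∨ c i = -1) (h0 : ∀ c ∈ C, 0 ≤ p c)
    (h1 : ∑ c ∈ C, p c = 1) {c : ι → ℝ} (hc : c ∈ C) (hpc : 0 < p c) (s : ℝ) (w : ι → ℝ) :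
    ‖infoLoss C p c s w‖ ≤ infoBound p c w := by
  have a := infoLoss_le hC h0 h1 hc s w
  have b := log_le_infoLoss h0 hc hpc s w
  have hw : 0 ≤ w ⬝ᵥ w := Finset.sum_nonneg fun i _ => mul_self_nonneg _
  rw [Real.norm_eq_abs, abs_le, infoBound]
  constructor
  · linarith [neg_abs_le (Real.log (p c))]
  · linarith [abs_nonneg (Real.log (p c))]

lemma integrable_infoLoss (hC : ∀ c ∈ C, ∀ i, c i = 1 ∨ c i = -1) (h0 : ∀ c ∈ C, 0 ≤ p c)
    (h1 : ∑ c ∈ C, p c = 1) {c : ι → ℝ} (hc : c ∈ C) (hpc : 0 < p c) (s : ℝ) :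
    Integrable (infoLoss C p c s) (stdGauss ι) :=
  (integrable_infoBound p c).mono' (measurable_infoLoss C p c s).aestronglyMeasurable
    (ae_of_all _ fun w => abs_infoLoss_le hC h0 h1 hc hpc s w)

lemma hasDerivAt_relExponent (c w d : ι → ℝ) (s : ℝ) :
    HasDerivAt (relExponent c w d) (2 * s * (c ⬝ᵥ d - c ⬝ᵥ c) + (d - c) ⬝ᵥ w) s := by
  unfold relExponent
  have := ((hasDerivAt_pow 2 s).mul_const (c ⬝ᵥ d - c ⬝ᵥ c)).fun_add
    ((hasDerivAt_id' s).mul_const ((d - c) ⬝ᵥ w))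
  simpa using this

/-- Derivative of `infoLoss` with respect to the amplitude. -/
def infoLossDeriv (C : Finset (ι → ℝ)) (p : (ι → ℝ) → ℝ) (c : ι → ℝ) (s : ℝ) (w : ι → ℝ) : ℝ :=
  (∑ d ∈ C, p d * Real.exp (relExponent c w d s) *
    (2 * s * (c ⬝ᵥ d - c ⬝ᵥ c) + (d - c) ⬝ᵥ w)) /
  ∑ d ∈ C, p d * Real.exp (relExponent c w d s)

lemma hasDerivAt_infoLoss (h0 : ∀ c ∈ C, 0 ≤ p c) (h1 : ∑ c ∈ C, p c = 1) (c : ι → ℝ) (s : ℝ)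
    (w : ι → ℝ) :
    HasDerivAt (fun s => infoLoss C p c s w) (infoLossDeriv C p c s w) s :=
  hasDerivAt_log_sum_exp h0 h1 fun d _ => hasDerivAt_relExponent c w d s

lemma abs_dotProduct_le_of_mem (hC : ∀ c ∈ C, ∀ i, c i = 1 ∨ c i = -1) {c : ι → ℝ} (hc : c ∈ C)
    (w : ι → ℝ) : |c ⬝ᵥ w| ≤ ∑ i, |w i| := by
  refine (Finset.abs_sum_le_sum_abs _ _).trans (Finset.sum_le_sum fun i _ => ?_)
  rw [abs_mul, abs_eq_one_of_mem hC hc, one_mul]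

lemma abs_infoLossDeriv_le (hC : ∀ c ∈ C, ∀ i, c i = 1 ∨ c i = -1) (h0 : ∀ c ∈ C, 0 ≤ p c)
    {c : ι → ℝ} (hc : c ∈ C) {s R : ℝ} (hs : |s| ≤ R) (w : ι → ℝ) :
    ‖infoLossDeriv C p c s w‖ ≤ 4 * R * Fintype.card ι + 2 * ∑ i, |w i| := by
  have hR : 0 ≤ R := (abs_nonneg s).trans hs
  refine abs_weighted_avg_le C _ _ (fun d hd => mul_nonneg (h0 d hd) (Real.exp_pos _).le)
    (fun d hd => ?_) (by positivity)
  have a := abs_dotProduct_le_of_mem hC hc w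
  have b := abs_dotProduct_le_of_mem hC hd w
  have e := abs_dotProduct_le_of_mem hC hc d
  simp only [abs_eq_one_of_mem hC hd, Finset.sum_const, Finset.card_univ, nsmul_eq_mul,
    mul_one] at e
  rw [dotProduct_self_of_mem hC hc, sub_dotProduct]
  have f : |2 * s * (c ⬝ᵥ d - Fintype.card ι)| ≤ 4 * R * Fintype.card ι := by
    rw [abs_mul, abs_mul, abs_two]
    have : |c ⬝ᵥ d - (Fintype.card ι : ℝ)| ≤ 2 * Fintype.card ι := by
      rw [abs_le] at e ⊢
      constructor <;> linarith [e.1, e.2]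
    calc 2 * |s| * |c ⬝ᵥ d - (Fintype.card ι : ℝ)| ≤ 2 * R * (2 * Fintype.card ι) := by gcongr
      _ = _ := by ring
  calc _ ≤ _ := abs_add_le _ _
    _ ≤ _ := add_le_add f ((abs_sub _ _).trans (by linarith))

/-- With `y = s c + w`, the derivative of the exponent of `d` is the sum over `i` of `(s c i + y i)
d i - (2 s + c i w i)`. It is affine in `d`, so averaging over the posterior replaces `d i` by the
posterior mean. -/
lemma infoLossDeriv_eq (hC : ∀ c ∈ C, ∀ i, c i = 1 ∨ c i = -1) (h0 : ∀ c ∈ C, 0 ≤ p c)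
    (h1 : ∑ c ∈ C, p c = 1) {c : ι → ℝ} (hc : c ∈ C) (s : ℝ) (w : ι → ℝ) :
    infoLossDeriv C p c s w = ∑ i, (s * (c i * postMean C p s (s • c + w) i) +
      postMean C p s (s • c + w) i * (s • c + w) i - 2 * s - c i * w i) := by
  set y := s • c + w with hy
  -- This is `exp (-s (c ⬝ᵥ y))`, the factor common to all `d` that separates the relative weights
  -- from those in `partFn`.
  set k := Real.exp (-(s ^ 2 * Fintype.card ι) - s * (c ⬝ᵥ w)) with hk
  have hkpos : 0 < k := Real.exp_pos _
  have e : ∀ d, Real.exp (relExponent c w d s) = k * Real.exp (s * (d ⬝ᵥ y)) := by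
    intro d
    rw [hk, ← Real.exp_add, relExponent, hy, dotProduct_self_of_mem hC hc, sub_dotProduct,
      dotProduct_add, dotProduct_smul, dotProduct_comm d c, smul_eq_mul]
    ring_nf
  have hS : partFn C p s y ≠ 0 := (sum_mul_exp_pos h0 h1 _).ne'
  have hden : ∑ d ∈ C, p d * Real.exp (relExponent c w d s) = k * partFn C p s y := by
    rw [partFn, Finset.mul_sum]
    exact Finset.sum_congr rfl fun d _ => by rw [e]; ring
  rw [infoLossDeriv, hden, div_eq_iff (mul_ne_zero hkpos.ne' hS)]
  have h2 : ∀ d ∈ C, p d * Real.exp (relExponent c w d s) *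
      (2 * s * (c ⬝ᵥ d - c ⬝ᵥ c) + (d - c) ⬝ᵥ w) =
      k * ∑ i, ((s * c i + y i) * (p d * Real.exp (s * (d ⬝ᵥ y)) * d i) -
        (2 * s + c i * w i) * (p d * Real.exp (s * (d ⬝ᵥ y)))) := by
    intro d _
    have h3 : 2 * s * (c ⬝ᵥ d - c ⬝ᵥ c) + (d - c) ⬝ᵥ w =
        ∑ i, ((s * c i + y i) * d i - (2 * s + c i * w i)) := by
      rw [dotProduct_self_of_mem hC hc]
      simp only [dotProduct, hy, Finset.sum_sub_distrib, Finset.sum_add_distrib, Pi.add_apply,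
        Pi.smul_apply, smul_eq_mul, Pi.sub_apply, mul_sub, sub_mul, add_mul, Finset.mul_sum,
        Finset.sum_const, Finset.card_univ, nsmul_eq_mul]
      simp only [← mul_assoc, mul_comm (c _) (d _)]
      have : ∑ x, d x * w x = ∑ x, w x * d x := Finset.sum_congr rfl fun _ _ => mul_comm _ _
      simp only [mul_assoc, ← Finset.mul_sum, mul_comm (c _) (d _), this]
      ring
    rw [h3, e, Finset.mul_sum, Finset.mul_sum]
    exact Finset.sum_congr rfl fun i _ => by ring
  rw [Finset.sum_congr rfl h2, ← Finset.mul_sum, Finset.sum_comm, mul_left_comm, Finset.sum_mul]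
  congr 1
  refine Finset.sum_congr rfl fun i _ => ?_
  rw [Finset.sum_sub_distrib, ← Finset.mul_sum, ← Finset.mul_sum, ← partFn_mul_postMean h0 h1,
    ← partFn]
  ring

end InfoMMSE

/-! ### The relation between entropy and mean squared error -/

section InfoMMSEIntegral

variable {ι : Type*} [Fintype ι] {C : Finset (ι → ℝ)} {p : (ι → ℝ) → ℝ}

/-- Sum over the coordinates of the minimum mean squared errors of the codeword with prior `p` at
the output of the Gaussian channel of amplitude `s`. -/
def totalMMSE (C : Finset (ι → ℝ)) (p : (ι → ℝ) → ℝ) (s : ℝ) : ℝ :=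
  ∑ c ∈ C, p c * ∫ w, ∑ i, (1 - postMean C p s (s • c + w) i ^ 2) ∂stdGauss ι

lemma measurable_infoLossDeriv (C : Finset (ι → ℝ)) (p : (ι → ℝ) → ℝ) (c : ι → ℝ) (s : ℝ) :
    Measurable (infoLossDeriv C p c s) := by
  unfold infoLossDeriv relExponent
  have := fun c : ι → ℝ => measurable_dotProduct_left c
  fun_prop

/-- Differentiation under the integral: on the unit ball around `s` the derivative is dominated by
an integrable function, affine in the `|w i|`. -/
lemma hasDerivAt_integral_infoLoss (hC : ∀ c ∈ C, ∀ i, c i = 1 ∨ c i = -1) (h0 : ∀ c ∈ C, 0 ≤ p c)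
    (h1 : ∑ c ∈ C, p c = 1) {c : ι → ℝ} (hc : c ∈ C) (hpc : 0 < p c) (s : ℝ) :
    HasDerivAt (fun s => ∫ w, infoLoss C p c s w ∂stdGauss ι)
      (∫ w, infoLossDeriv C p c s w ∂stdGauss ι) s := by
  refine (hasDerivAt_integral_of_dominated_loc_of_deriv_le (s := Metric.ball s 1)
    (bound := fun w => 4 * (|s| + 1) * Fintype.card ι + 2 * ∑ i, |w i|)
    (Metric.ball_mem_nhds s one_pos)
    (Eventually.of_forall fun x => (measurable_infoLoss C p c x).aestronglyMeasurable)
    (integrable_infoLoss hC h0 h1 hc hpc s) (measurable_infoLossDeriv C p c s).aestronglyMeasurable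
    (ae_of_all _ fun w x hx => abs_infoLossDeriv_le hC h0 hc ?_ w) ?_
    (ae_of_all _ fun w x _ => hasDerivAt_infoLoss h0 h1 c x w)).2
  · have : |x - s| < 1 := by simpa [Real.dist_eq] using hx
    have := abs_sub_abs_le_abs_sub x s
    linarith
  · exact (integrable_const _).add
      ((integrable_finsetSum _ fun i _ => (integrable_eval_stdGauss i).abs).const_mul 2)

lemma integrable_postMean_mul (hC : ∀ c ∈ C, ∀ i, c i = 1 ∨ c i = -1) (h0 : ∀ c ∈ C, 0 ≤ p c)
    (s : ℝ) (c : ι → ℝ) (i : ι) {f : (ι → ℝ) → ℝ} (hf : Integrable f (stdGauss ι)) :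
    Integrable (fun w => postMean C p s (s • c + w) i * f w) (stdGauss ι) :=
  hf.bdd_mul (c := 1) ((measurable_postMean C p s i).comp
    (measurable_const_add (s • c))).aestronglyMeasurable
    (ae_of_all _ fun w => by simpa using abs_postMean_le hC h0 s (s • c + w) i)

lemma integrable_shift_eval (s : ℝ) (c : ι → ℝ) (i : ι) :
    Integrable (fun w : ι → ℝ => (s • c + w) i) (stdGauss ι) :=
  (integrable_const (s * c i)).add (integrable_eval_stdGauss i)

/-- The derivative of the conditional entropy with respect to the amplitude. -/
lemma sum_integral_infoLossDeriv (hC : ∀ c ∈ C, ∀ i, c i = 1 ∨ c i = -1) (h0 : ∀ c ∈ C, 0 ≤ p c)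
    (h1 : ∑ c ∈ C, p c = 1) (s : ℝ) :
    ∑ c ∈ C, p c * ∫ w, infoLossDeriv C p c s w ∂stdGauss ι = - (s * totalMMSE C p s) := by
  have i0 : ∀ c ∈ C, ∀ i, Integrable (fun w => postMean C p s (s • c + w) i) (stdGauss ι) := by
    intro c hc i
    simpa using integrable_postMean_mul hC h0 s c i (integrable_const (1 : ℝ))
  have i2 : ∀ c ∈ C, ∀ i, Integrable (fun w => postMean C p s (s • c + w) i ^ 2) (stdGauss ι) := by
    intro c hc i
    simpa [sq] using integrable_postMean_mul hC h0 s c i (i0 c hc i)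
  have i3 : ∀ c ∈ C, ∀ i, Integrable
      (fun w => postMean C p s (s • c + w) i * (s • c + w) i) (stdGauss ι) :=
    fun c hc i => integrable_postMean_mul hC h0 s c i (integrable_shift_eval s c i)
  have e1 : ∀ c ∈ C, ∫ w, infoLossDeriv C p c s w ∂stdGauss ι =
      ∑ i, (s * ∫ w, c i * postMean C p s (s • c + w) i ∂stdGauss ι +
        ∫ w, postMean C p s (s • c + w) i * (s • c + w) i ∂stdGauss ι - 2 * s) := by
    intro c hc
    simp_rw [infoLossDeriv_eq hC h0 h1 hc]
    rw [integral_finsetSum]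
    · refine Finset.sum_congr rfl fun i _ => ?_
      have a1 := ((i0 c hc i).const_mul (c i)).const_mul s
      have a2 := i3 c hc i
      have a4 := (integrable_eval_stdGauss i).const_mul (c i)
      have a12 := a1.fun_add a2
      have a123 : Integrable (fun w => s * (c i * postMean C p s (s • c + w) i) +
          postMean C p s (s • c + w) i * (s • c + w) i - 2 * s) (stdGauss ι) :=
        a12.sub (integrable_const _)
      rw [integral_sub a123 a4, integral_sub a12 (integrable_const _), integral_add a1 a2,
        integral_const_mul,
        integral_const_mul (c i) (fun w : ι → ℝ => w i), integral_eval_stdGauss]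
      simp
    · intro i _
      exact (((((i0 c hc i).const_mul (c i)).const_mul s).add (i3 c hc i)).sub
        (integrable_const _)).sub ((integrable_eval_stdGauss i).const_mul (c i))
  -- The tower property is used twice, in place of Gaussian integration by parts. Tested against the
  -- posterior mean `m i`, it gives `E[c i * m i] = E[m i ^ 2]`. Tested against `y i` (see `e3`), it
  -- gives `E[m i * y i] = E[c i * y i] = s`. Each coordinate then contributes `s E[m i ^ 2] + s - 2
  -- s`, which is `-s` times its error.
  have e2 : ∀ i, ∑ c ∈ C, p c * ∫ w, c i * postMean C p s (s • c + w) i ∂stdGauss ι =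
      ∑ c ∈ C, p c * ∫ w, postMean C p s (s • c + w) i ^ 2 ∂stdGauss ι := by
    intro i
    rw [← sum_integral_postMean_mul hC h0 h1 s i (g := fun y => postMean C p s y i)
      (fun c hc => i0 c hc i)]
    simp_rw [sq]
  have e3 : ∀ i, ∑ c ∈ C, p c * ∫ w, postMean C p s (s • c + w) i * (s • c + w) i ∂stdGauss ι =
      s := by
    intro i
    rw [sum_integral_postMean_mul hC h0 h1 s i (g := fun y => y i)
      (fun c hc => integrable_shift_eval s c i)]
    have : ∀ c ∈ C, p c * ∫ w, c i * (s • c + w) i ∂stdGauss ι = p c * s := by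
      intro c hc
      congr 1
      rw [integral_const_mul]
      have : ∫ w, (s • c + w) i ∂stdGauss ι = s * c i := by
        simp only [Pi.add_apply]
        rw [integral_add (integrable_const _) (integrable_eval_stdGauss i), integral_eval_stdGauss]
        simp
      rw [this]
      rcases hC c hc i with h | h <;> simp [h]
    rw [Finset.sum_congr rfl this, ← Finset.sum_mul, h1, one_mul]
  have e4 : totalMMSE C p s =
      ∑ i, (1 - ∑ c ∈ C, p c * ∫ w, postMean C p s (s • c + w) i ^ 2 ∂stdGauss ι) := by
    rw [totalMMSE]
    have : ∀ c ∈ C, p c * ∫ w, ∑ i, (1 - postMean C p s (s • c + w) i ^ 2) ∂stdGauss ι =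
        ∑ i, (p c - p c * ∫ w, postMean C p s (s • c + w) i ^ 2 ∂stdGauss ι) := by
      intro c hc
      have i4 : ∀ i, Integrable (fun w => 1 - postMean C p s (s • c + w) i ^ 2) (stdGauss ι) :=
        fun i => (integrable_const _).sub (i2 c hc i)
      rw [integral_finsetSum _ fun i _ => i4 i, Finset.mul_sum]
      refine Finset.sum_congr rfl fun i _ => ?_
      rw [integral_sub (integrable_const _) (i2 c hc i)]
      simp [mul_sub]
    rw [Finset.sum_congr rfl this, Finset.sum_comm]
    refine Finset.sum_congr rfl fun i _ => ?_
    rw [Finset.sum_sub_distrib, h1]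
  have e5 : ∀ c ∈ C, p c * ∫ w, infoLossDeriv C p c s w ∂stdGauss ι =
      ∑ i, (s * (p c * ∫ w, c i * postMean C p s (s • c + w) i ∂stdGauss ι) +
        p c * ∫ w, postMean C p s (s • c + w) i * (s • c + w) i ∂stdGauss ι - p c * (2 * s)) := by
    intro c hc
    rw [e1 c hc, Finset.mul_sum]
    exact Finset.sum_congr rfl fun i _ => by ring
  rw [Finset.sum_congr rfl e5, Finset.sum_comm, e4, Finset.mul_sum, ← Finset.sum_neg_distrib]
  refine Finset.sum_congr rfl fun i _ => ?_
  rw [Finset.sum_sub_distrib, Finset.sum_add_distrib, ← Finset.mul_sum, e2, e3, ← Finset.sum_mul, h1]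
  ring

lemma totalMMSE_nonneg (hC : ∀ c ∈ C, ∀ i, c i = 1 ∨ c i = -1) (h0 : ∀ c ∈ C, 0 ≤ p c) (s : ℝ) :
    0 ≤ totalMMSE C p s :=
  Finset.sum_nonneg fun c hc => mul_nonneg (h0 c hc) (integral_nonneg fun _ =>
    Finset.sum_nonneg fun i _ => sub_nonneg.2 (postMean_sq_le hC h0 s _ i))

/-- Conditional entropy given the observation, minus the prior entropy, in nats. -/
def meanInfoLoss (C : Finset (ι → ℝ)) (p : (ι → ℝ) → ℝ) (s : ℝ) : ℝ :=
  ∑ c ∈ C, p c * ∫ w, infoLoss C p c s w ∂stdGauss ι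

lemma hasDerivAt_meanInfoLoss (hC : ∀ c ∈ C, ∀ i, c i = 1 ∨ c i = -1) (h0 : ∀ c ∈ C, 0 ≤ p c)
    (h1 : ∑ c ∈ C, p c = 1) (s : ℝ) :
    HasDerivAt (meanInfoLoss C p) (- (s * totalMMSE C p s)) s := by
  rw [← sum_integral_infoLossDeriv hC h0 h1]
  refine HasDerivAt.fun_sum fun c hc => ?_
  rcases (h0 c hc).eq_or_lt with h | h
  · simpa [← h] using hasDerivAt_const s (0 : ℝ)
  · exact (hasDerivAt_integral_infoLoss hC h0 h1 hc h s).const_mul _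

lemma meanInfoLoss_zero (h1 : ∑ c ∈ C, p c = 1) : meanInfoLoss C p 0 = 0 := by
  simp [meanInfoLoss, infoLoss, relExponent, h1]

lemma dotProduct_lt_of_ne (hC : ∀ c ∈ C, ∀ i, c i = 1 ∨ c i = -1) {c d : ι → ℝ} (hc : c ∈ C)
    (hd : d ∈ C) (h : d ≠ c) : c ⬝ᵥ d - c ⬝ᵥ c < 0 := by
  have h2 : 0 < (d - c) ⬝ᵥ (d - c) := by
    obtain ⟨i, hi⟩ := Function.ne_iff.1 h
    refine Finset.sum_pos' (fun i _ => mul_self_nonneg _) ⟨i, Finset.mem_univ i, ?_⟩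
    exact mul_self_pos.2 (sub_ne_zero.2 hi)
  have hcc := dotProduct_self_of_mem hC hc
  have hdd := dotProduct_self_of_mem hC hd
  simp only [sub_dotProduct, dotProduct_sub, dotProduct_comm d c] at h2
  linarith

/-- For `d ≠ c` the relative exponent is quadratic in `s` with negative leading coefficient, by
strict Cauchy-Schwarz for vectors of equal norm. Only the transmitted word survives. -/
lemma tendsto_infoLoss (hC : ∀ c ∈ C, ∀ i, c i = 1 ∨ c i = -1) {c : ι → ℝ} (hc : c ∈ C)
    (hpc : 0 < p c) (w : ι → ℝ) :
    Tendsto (fun s => infoLoss C p c s w) atTop (𝓝 (Real.log (p c))) := by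
  classical
  unfold infoLoss
  refine Tendsto.log ?_ hpc.ne'
  have : p c = ∑ d ∈ C, if d = c then p d else 0 := by simp [hc]
  rw [this]
  refine tendsto_finsetSum _ fun d hd => ?_
  split_ifs with h
  · subst h
    simp [relExponent_self]
  · rw [← mul_zero (p d)]
    refine Tendsto.const_mul _ (Real.tendsto_exp_atBot.comp ?_)
    have h3 := dotProduct_lt_of_ne hC hc hd h
    have : relExponent c w d =
        fun s => s * (s * (c ⬝ᵥ d - c ⬝ᵥ c) + (d - c) ⬝ᵥ w) := by
      ext s; simp only [relExponent]; ring
    rw [this]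
    refine tendsto_id.atTop_mul_atBot₀ ?_
    exact tendsto_atBot_add_const_right _ _ (tendsto_id.atTop_mul_const_of_neg h3)

lemma tendsto_meanInfoLoss (hC : ∀ c ∈ C, ∀ i, c i = 1 ∨ c i = -1) (h0 : ∀ c ∈ C, 0 ≤ p c)
    (h1 : ∑ c ∈ C, p c = 1) :
    Tendsto (meanInfoLoss C p) atTop (𝓝 (- ∑ c ∈ C, Real.negMulLog (p c))) := by
  rw [← Finset.sum_neg_distrib]
  refine tendsto_finsetSum _ fun c hc => ?_
  rcases (h0 c hc).eq_or_lt with h | h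
  · simp [← h]
  · have : - Real.negMulLog (p c) = p c * ∫ _, Real.log (p c) ∂stdGauss ι := by
      simp [Real.negMulLog]
    rw [this]
    refine Tendsto.const_mul _ ?_
    exact tendsto_integral_filter_of_dominated_convergence (infoBound p c)
      (Eventually.of_forall fun s => (measurable_infoLoss C p c s).aestronglyMeasurable)
      (Eventually.of_forall fun s => ae_of_all _ fun w => abs_infoLoss_le hC h0 h1 hc h s w)
      (integrable_infoBound p c) (ae_of_all _ fun w => tendsto_infoLoss hC hc h w)

/-- The relation between mutual information and minimum mean squared error, integrated over all
signal to noise ratios. -/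
lemma lintegral_totalMMSE (hC : ∀ c ∈ C, ∀ i, c i = 1 ∨ c i = -1) (h0 : ∀ c ∈ C, 0 ≤ p c)
    (h1 : ∑ c ∈ C, p c = 1) :
    ∫⁻ γ in Ioi (0 : ℝ), ENNReal.ofReal (totalMMSE C p √γ) =
      ENNReal.ofReal (2 * ∑ c ∈ C, Real.negMulLog (p c)) := by
  -- The square root is not differentiable at `0`, so the fundamental theorem of calculus is applied
  -- on the open half line with continuity at its endpoint.
  have hcont : ContinuousWithinAt (fun γ => meanInfoLoss C p √γ) (Ici 0) 0 := by
    have := (hasDerivAt_meanInfoLoss hC h0 h1 √0).continuousAt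
    exact (ContinuousAt.comp (f := Real.sqrt) this Real.continuous_sqrt.continuousAt).continuousWithinAt
  -- Passing from amplitude to signal to noise ratio, the factor `1 / (2 √γ)` absorbs the amplitude
  -- and leaves the constant one half.
  have hder : ∀ γ ∈ Ioi (0 : ℝ), HasDerivAt (fun γ => meanInfoLoss C p √γ)
      (- (2⁻¹ * totalMMSE C p √γ)) γ := by
    intro γ hγ
    have := (hasDerivAt_meanInfoLoss hC h0 h1 √γ).comp γ (Real.hasDerivAt_sqrt (ne_of_gt hγ))
    have h2 : - (2⁻¹ * totalMMSE C p √γ) = -(√γ * totalMMSE C p √γ) * (1 / (2 * √γ)) := by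
      have : √γ ≠ 0 := (Real.sqrt_pos.2 hγ).ne'
      field_simp
    rw [h2]
    exact this
  have hneg : ∀ γ ∈ Ioi (0 : ℝ), - (2⁻¹ * totalMMSE C p √γ) ≤ 0 := fun γ _ =>
    neg_nonpos.2 (mul_nonneg (by norm_num) (totalMMSE_nonneg hC h0 _))
  have hlim := (tendsto_meanInfoLoss hC h0 h1).comp Real.tendsto_sqrt_atTop
  have hint := integrableOn_Ioi_deriv_of_nonpos hcont hder hneg hlim
  have heq := integral_Ioi_of_hasDerivAt_of_nonpos hcont hder hneg hlim
  have hint2 : IntegrableOn (fun γ => totalMMSE C p √γ) (Ioi 0) := by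
    have := hint.const_mul (-2)
    exact this.congr (ae_of_all _ fun γ => by simp only []; ring)
  rw [← ofReal_integral_eq_lintegral_ofReal hint2
    (ae_of_all _ fun γ => totalMMSE_nonneg hC h0 _)]
  congr 1
  rw [integral_neg, integral_const_mul] at heq
  simp only [Real.sqrt_zero, meanInfoLoss_zero h1] at heq
  linarith

end InfoMMSEIntegral

/-! ### Areas on the two sides of a monotone curve -/

section TransferCurve

/-- The integrals depend only on the distributions of `T₁` and `T₂`, and the hypothesis says that
their distribution functions add up to that of Lebesgue measure on the half line. The mass at `⊤`
may be discarded since `f` vanishes there. -/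
lemma lintegral_add_eq_of_distribution {T₁ T₂ : ℝ → ℝ≥0∞}
    (h₁ : AEMeasurable T₁ (volume.restrict (Ioi 0))) (h₂ : AEMeasurable T₂ (volume.restrict (Ioi 0)))
    (h : ∀ u : ℝ, 0 < u → volume ({a | T₁ a < ENNReal.ofReal u} ∩ Ioi 0) +
      volume ({a | T₂ a < ENNReal.ofReal u} ∩ Ioi 0) = ENNReal.ofReal u)
    {f : ℝ≥0∞ → ℝ≥0∞} (hf : Measurable f) (hf0 : f ⊤ = 0) :
    (∫⁻ a in Ioi (0 : ℝ), f (T₁ a)) + ∫⁻ a in Ioi (0 : ℝ), f (T₂ a) =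
      ∫⁻ u in Ioi (0 : ℝ), f (ENNReal.ofReal u) := by
  set ν : (ℝ → ℝ≥0∞) → Measure ℝ := fun T =>
    (((volume.restrict (Ioi 0)).map T).restrict {⊤}ᶜ).map ENNReal.toReal with hν
  have hInt : ∀ T, AEMeasurable T (volume.restrict (Ioi 0)) →
      ∫⁻ a in Ioi (0 : ℝ), f (T a) = ∫⁻ x, f (ENNReal.ofReal x) ∂ν T := by
    intro T hT
    rw [hν, lintegral_map (by fun_prop) ENNReal.measurable_toReal, ← lintegral_map' hf.aemeasurable hT]
    rw [← lintegral_indicator (measurableSet_singleton _).compl]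
    refine lintegral_congr fun x => ?_
    by_cases hx : x = ⊤
    · simp [hx, hf0]
    · rw [indicator_of_mem (by simpa using hx), ENNReal.ofReal_toReal hx]
  have hIio : ∀ T, AEMeasurable T (volume.restrict (Ioi 0)) → ∀ u : ℝ,
      ν T (Iio u) = volume ({a | T a < ENNReal.ofReal u} ∩ Ioi 0) := by
    intro T hT u
    rw [hν]
    simp only []
    rw [Measure.map_apply ENNReal.measurable_toReal measurableSet_Iio, Measure.restrict_apply
      (ENNReal.measurable_toReal measurableSet_Iio)]
    have : ENNReal.toReal ⁻¹' Iio u ∩ {⊤}ᶜ = Iio (ENNReal.ofReal u) := by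
      ext x
      simp only [mem_inter_iff, mem_preimage, mem_Iio, mem_compl_iff, mem_singleton_iff]
      constructor
      · rintro ⟨hx, hx'⟩
        rwa [ENNReal.lt_ofReal_iff_toReal_lt hx']
      · intro hx
        have hx' := (hx.trans_le le_top).ne
        exact ⟨(ENNReal.lt_ofReal_iff_toReal_lt hx').1 hx, hx'⟩
    rw [this, Measure.map_apply_of_aemeasurable hT measurableSet_Iio,
      Measure.restrict_apply' measurableSet_Ioi]
    rfl
  have hIio2 : ∀ u : ℝ, (ν T₁ + ν T₂) (Iio u) = ENNReal.ofReal u := by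
    intro u
    rw [Measure.add_apply, hIio _ h₁, hIio _ h₂]
    rcases le_or_gt u 0 with hu | hu
    · simp [ENNReal.ofReal_of_nonpos hu]
    · exact h u hu
  have hIco : ∀ a b : ℝ, a < b → (ν T₁ + ν T₂) (Ico a b) = ENNReal.ofReal b - ENNReal.ofReal a := by
    intro a b hab
    have : Ico a b = Iio b \ Iio a := by ext; simp
    rw [this, measure_sdiff (Iio_subset_Iio hab.le) measurableSet_Iio.nullMeasurableSet
      (by rw [hIio2]; simp), hIio2, hIio2]
  have hIco' : ∀ a b : ℝ, a < b →
      (volume.restrict (Ioi (0 : ℝ))) (Ico a b) = ENNReal.ofReal b - ENNReal.ofReal a := by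
    intro a b hab
    have hI : ∀ u : ℝ, (volume.restrict (Ioi (0 : ℝ))) (Iio u) = ENNReal.ofReal u := by
      intro u
      rw [Measure.restrict_apply measurableSet_Iio, inter_comm, Ioi_inter_Iio, Real.volume_Ioo]
      simp
    have : Ico a b = Iio b \ Iio a := by ext; simp
    rw [this, measure_sdiff (Iio_subset_Iio hab.le) measurableSet_Iio.nullMeasurableSet
      (by rw [hI]; simp), hI, hI]
  have hmain : ν T₁ + ν T₂ = volume.restrict (Ioi (0 : ℝ)) :=
    Measure.ext_of_Ico' _ _ (fun a b hab => by rw [hIco a b hab]; simp)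
      (fun a b hab => by rw [hIco a b hab, hIco' a b hab])
  rw [hInt _ h₁, hInt _ h₂, ← lintegral_add_measure, hmain]

lemma volume_eq_of_Ioo_subset {E : Set ℝ} {x : ℝ} (h1 : Ioo 0 x ⊆ E) (h2 : E ⊆ Ioc 0 x) :
    volume E = ENNReal.ofReal x := by
  refine le_antisymm ((measure_mono h2).trans ?_) (le_trans ?_ (measure_mono h1)) <;> simp

variable {γext : ℝ≥0 → ℝ≥0∞}

/-- The generalized inverse of `γext` works: the supremum of the points where `γext` is at most `t`.
-/
lemma exists_isAprioriSNR (hm : Monotone γext) : ∃ γap : ℝ → ℝ≥0∞, IsAprioriSNR γext γap := by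
  refine ⟨fun t => sSup {a | ∃ a' : ℝ≥0, a = a' ∧ γext a' ≤ ENNReal.ofReal t}, fun t _ => ⟨?_, ?_⟩⟩
  · intro a' ha'
    obtain ⟨b, ⟨b', rfl, hb'⟩, hab⟩ := lt_sSup_iff.1 ha'
    exact (hm (ENNReal.coe_lt_coe.1 hab).le).trans hb'
  · intro a' ha'
    by_contra! hlt
    have hmem : (a' : ℝ≥0∞) ∈ {a : ℝ≥0∞ | ∃ a' : ℝ≥0, a = a' ∧ γext a' ≤ ENNReal.ofReal t} :=
      ⟨a', rfl, hlt.le⟩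
    exact absurd (le_sSup hmem) (not_le.2 ha')

variable {γap : ℝ → ℝ≥0∞}

/-- If `γap` decreased from `t` to a larger `t'`, a point `a` strictly between the two values would
give `t' ≤ γext a ≤ t`. Monotonicity serves for measurability. -/
lemma IsAprioriSNR.monotoneOn (h : IsAprioriSNR γext γap) : MonotoneOn γap (Ici 0) := by
  intro t ht t' ht' htt
  rcases htt.eq_or_lt with rfl | hlt
  · rfl
  by_contra! hcon
  obtain ⟨a, ha1, ha2⟩ := ENNReal.lt_iff_exists_nnreal_btwn.1 hcon
  have h1 := (h t ht).1 a ha2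
  have h2 := (h t' ht').2 a ha1
  have := h2.trans h1
  rw [ENNReal.ofReal_le_ofReal_iff ht] at this
  linarith

lemma IsAprioriSNR.aemeasurable (h : IsAprioriSNR γext γap) :
    AEMeasurable γap (volume.restrict (Ioi 0)) :=
  aemeasurable_restrict_of_monotoneOn measurableSet_Ioi (h.monotoneOn.mono Ioi_subset_Ici_self)

/-- The antidiagonal of level `u` crosses the curve at a point `(x, u - x)`. The first set is an
initial interval of length `x`, the second one of length `u - x`, whatever happens at the endpoints.
-/
lemma IsAprioriSNR.volume_add (hm : Monotone γext) (h : IsAprioriSNR γext γap) {u : ℝ}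
    (hu : 0 < u) :
    volume ({a : ℝ | ENNReal.ofReal a + γext a.toNNReal < ENNReal.ofReal u} ∩ Ioi 0) +
      volume ({t | γap t + ENNReal.ofReal t < ENNReal.ofReal u} ∩ Ioi 0) = ENNReal.ofReal u := by
  set E := {a : ℝ | ENNReal.ofReal a + γext a.toNNReal < ENNReal.ofReal u} ∩ Ioi 0 with hE
  have hEu : ∀ a ∈ E, a < u := fun a ha =>
    (ENNReal.ofReal_lt_ofReal_iff hu).1 (lt_of_le_of_lt le_self_add ha.1)
  have hbdd : BddAbove (insert 0 E) := by
    refine ⟨u, ?_⟩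
    rintro x (rfl | hx)
    · exact hu.le
    · exact (hEu x hx).le
  -- Inserting `0` makes the supremum meaningful, with value `0`, when `E` is empty.
  set x := sSup (insert 0 E) with hx
  have hx0 : 0 ≤ x := le_csSup hbdd (mem_insert _ _)
  have hxu : x ≤ u := csSup_le ⟨0, mem_insert _ _⟩ (by
    rintro y (rfl | hy)
    · exact hu.le
    · exact (hEu y hy).le)
  have hE1 : Ioo 0 x ⊆ E := by
    rintro a ⟨ha0, hax⟩
    obtain ⟨b, hb, hab⟩ := exists_lt_of_lt_csSup ⟨0, mem_insert _ _⟩ hax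
    rcases hb with rfl | hb
    · exact absurd hab (not_lt.2 ha0.le)
    · have hb1 : ENNReal.ofReal b + γext b.toNNReal < ENNReal.ofReal u := hb.1
      have : ENNReal.ofReal a + γext a.toNNReal < ENNReal.ofReal u := lt_of_le_of_lt ?_ hb1
      · exact ⟨this, ha0⟩
      exact add_le_add (ENNReal.ofReal_le_ofReal hab.le) (hm (Real.toNNReal_le_toNNReal hab.le))
  have hE2 : E ⊆ Ioc 0 x := fun a ha => ⟨ha.2, le_csSup hbdd (mem_insert_of_mem _ ha)⟩
  have hF1 : Ioo 0 (u - x) ⊆ {t | γap t + ENNReal.ofReal t < ENNReal.ofReal u} ∩ Ioi 0 := by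
    rintro t ⟨ht0, htx⟩
    refine ⟨?_, ht0⟩
    by_contra hcon
    simp only [mem_ofPred_eq, not_lt] at hcon
    have h1 : ENNReal.ofReal (u - t) ≤ γap t := by
      rw [ENNReal.ofReal_sub _ ht0.le]
      exact tsub_le_iff_right.2 hcon
    -- Such an `a` lies to the left of the curve at height `t`, so `γext a ≤ t` and `a + γext a <
    -- u`. Thus `a ∈ E`, although `a` exceeds `x`.
    obtain ⟨a, ha1, ha2⟩ := exists_between (show x < u - t by linarith)
    have h2 := (h t ht0.le).1 a.toNNReal (lt_of_lt_of_le
      ((ENNReal.ofReal_lt_ofReal_iff (by linarith)).2 ha2) h1)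
    have h3 : a ∈ E := by
      refine ⟨?_, lt_of_le_of_lt hx0 ha1⟩
      refine lt_of_le_of_lt (add_le_add le_rfl h2) ?_
      rw [← ENNReal.ofReal_add (by linarith) ht0.le, ENNReal.ofReal_lt_ofReal_iff hu]
      linarith
    exact absurd (hE2 h3).2 (not_le.2 ha1)
  have hF2 : {t | γap t + ENNReal.ofReal t < ENNReal.ofReal u} ∩ Ioi 0 ⊆ Ioc 0 (u - x) := by
    rintro t ⟨ht, ht0⟩
    refine ⟨ht0, ?_⟩
    have ht0' : (0 : ℝ) < t := ht0
    simp only [mem_ofPred_eq] at ht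
    by_contra! hcon
    have htu : t < u := (ENNReal.ofReal_lt_ofReal_iff hu).1 (lt_of_le_of_lt le_add_self ht)
    have h1 : γap t < ENNReal.ofReal (u - t) := by
      rw [ENNReal.ofReal_sub _ ht0'.le]
      exact lt_tsub_iff_right.2 ht
    -- The mirror argument: `a ∈ E` lies to the right of the curve at height `t`, so `t ≤ γext a`
    -- and `a + γext a > u`.
    obtain ⟨a, ha1, ha2⟩ := exists_between (show u - t < x by linarith)
    have h3 : a ∈ E := hE1 ⟨by linarith, ha2⟩
    have h2 := (h t ht0'.le).2 a.toNNReal (h1.trans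
      ((ENNReal.ofReal_lt_ofReal_iff (by linarith)).2 ha1))
    have h4 := lt_of_le_of_lt (add_le_add le_rfl h2) h3.1
    rw [← ENNReal.ofReal_add (by linarith) ht0'.le, ENNReal.ofReal_lt_ofReal_iff hu] at h4
    linarith
  rw [volume_eq_of_Ioo_subset hE1 hE2, volume_eq_of_Ioo_subset hF1 hF2,
    ← ENNReal.ofReal_add hx0 (by linarith)]
  congr 1
  ring

/-- Areas on both sides of the transfer curve. -/
lemma IsAprioriSNR.lintegral_add (hm : Monotone γext) (h : IsAprioriSNR γext γap)
    {f : ℝ≥0∞ → ℝ≥0∞} (hf : Measurable f) (hf0 : f ⊤ = 0) :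
    (∫⁻ a in Ioi (0 : ℝ), f (ENNReal.ofReal a + γext a.toNNReal)) +
      ∫⁻ t in Ioi (0 : ℝ), f (γap t + ENNReal.ofReal t) =
      ∫⁻ u in Ioi (0 : ℝ), f (ENNReal.ofReal u) := by
  refine lintegral_add_eq_of_distribution ?_ ?_ (fun u hu => h.volume_add hm hu) hf hf0
  · have : Measurable (fun a : ℝ => γext a.toNNReal) :=
      hm.measurable.comp measurable_real_toNNReal
    exact (ENNReal.measurable_ofReal.add this).aemeasurable
  · exact h.aemeasurable.add ENNReal.measurable_ofReal.aemeasurable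

end TransferCurve

/-! ### Bayes' rule for a finite alphabet -/

section Bayes

variable {Ω α β G : Type*} [MeasurableSpace Ω] [MeasurableSpace β] [MeasurableSpace G]

/-- `X` takes values in `C`, has prior weights `q c z` given `Z = z`, and `W` is the output of a
memoryless channel with input `X`, with transition density `ℓ c` with respect to `ρ`. -/
def HasChannelLaw (μ : Measure Ω) (C : Finset α) (q : α → β → ℝ) (ℓ : α → G → ℝ) (ρ : Measure G)
    (X : Ω → α) (Z : Ω → β) (W : Ω → G) : Prop :=
  ∀ F : α → β → G → ℝ≥0∞, (∀ c, Measurable (fun p : β × G => F c p.1 p.2)) →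
    ∫⁻ ω, F (X ω) (Z ω) (W ω) ∂μ =
      ∫⁻ z, ∫⁻ w, ∑ c ∈ C, ENNReal.ofReal (q c z * ℓ c w) * F c z w ∂ρ ∂(μ.map Z)

/-- `q c z` is the probability of `X = c` given `Z = z`. -/
def IsPrior (μ : Measure Ω) (C : Finset α) (q : α → β → ℝ) (X : Ω → α) (Z : Ω → β) : Prop :=
  ∀ c ∈ C, ∀ H : β → ℝ≥0∞, Measurable H →
    ∫⁻ ω, (X ⁻¹' {c}).indicator (fun ω => H (Z ω)) ω ∂μ =
      ∫⁻ z, ENNReal.ofReal (q c z) * H z ∂(μ.map Z)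

variable {μ : Measure Ω} [IsProbabilityMeasure μ] {C : Finset α} {q : α → β → ℝ} {ℓ : α → G → ℝ}
  {ρ : Measure G} {X : Ω → α} {Z : Ω → β} {W : Ω → G}

/-- Posterior probability of `X ∈ A` given `Z = z` and `W = w`. -/
def bayesPosterior (C : Finset α) (q : α → β → ℝ) (ℓ : α → G → ℝ) (A : Set α) (z : β) (w : G) : ℝ :=
  (∑ c ∈ C, A.indicator (fun c => q c z * ℓ c w) c) / ∑ c ∈ C, q c z * ℓ c w

omit [MeasurableSpace β] [MeasurableSpace G] in
lemma bayesPosterior_nonneg (hq : ∀ c z, 0 ≤ q c z) (hℓ : ∀ c w, 0 ≤ ℓ c w) (A : Set α) (z : β) (w : G) :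
    0 ≤ bayesPosterior C q ℓ A z w :=
  div_nonneg (Finset.sum_nonneg fun c _ => indicator_nonneg
    (fun c _ => mul_nonneg (hq c z) (hℓ c w)) c)
    (Finset.sum_nonneg fun c _ => mul_nonneg (hq c z) (hℓ c w))

-- Vanishing of the denominator causes no exception: a zero sum of nonnegative weights makes the
-- numerator vanish as well.
omit [MeasurableSpace β] [MeasurableSpace G] in
lemma bayesPosterior_mul_sum (hq : ∀ c z, 0 ≤ q c z) (hℓ : ∀ c w, 0 ≤ ℓ c w) (A : Set α) (z : β) (w : G) :
    bayesPosterior C q ℓ A z w * ∑ c ∈ C, q c z * ℓ c w =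
      ∑ c ∈ C, A.indicator (fun c => q c z * ℓ c w) c := by
  have hn : ∀ c ∈ C, 0 ≤ q c z * ℓ c w := fun c _ => mul_nonneg (hq c z) (hℓ c w)
  by_cases h : ∑ c ∈ C, q c z * ℓ c w = 0
  · rw [h, mul_zero]
    rw [Finset.sum_eq_zero_iff_of_nonneg hn] at h
    refine (Finset.sum_eq_zero fun c hc => ?_).symm
    simp only [indicator_apply_eq_zero]
    exact fun _ => h c hc
  · exact div_mul_cancel₀ _ h

omit [MeasurableSpace β] [MeasurableSpace G] in
lemma bayesPosterior_le_one (hq : ∀ c z, 0 ≤ q c z) (hℓ : ∀ c w, 0 ≤ ℓ c w) (A : Set α) (z : β) (w : G) :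
    bayesPosterior C q ℓ A z w ≤ 1 := by
  refine div_le_one_of_le₀ (Finset.sum_le_sum fun c _ => ?_)
    (Finset.sum_nonneg fun c _ => mul_nonneg (hq c z) (hℓ c w))
  exact indicator_le_self' (fun _ _ => mul_nonneg (hq c z) (hℓ c w)) c

lemma measurable_sum_indicator (hqm : ∀ c, Measurable (q c)) (hℓm : ∀ c, Measurable (ℓ c))
    (A : Set α) : Measurable (fun p : β × G =>
      ∑ c ∈ C, A.indicator (fun c => q c p.1 * ℓ c p.2) c) := by
  classical
  refine Finset.measurable_sum _ fun c _ => ?_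
  by_cases h : c ∈ A
  · simp only [indicator_of_mem h]
    exact ((hqm c).comp measurable_fst).mul ((hℓm c).comp measurable_snd)
  · simp only [indicator_of_notMem h]
    exact measurable_const

lemma measurable_bayesPosterior (hqm : ∀ c, Measurable (q c)) (hℓm : ∀ c, Measurable (ℓ c))
    (A : Set α) : Measurable (fun p : β × G => bayesPosterior C q ℓ A p.1 p.2) := by
  refine (measurable_sum_indicator hqm hℓm A).div (Finset.measurable_sum _ fun c _ => ?_)
  exact ((hqm c).comp measurable_fst).mul ((hℓm c).comp measurable_snd)

/-- Bayes' rule. -/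
lemma HasChannelLaw.condExp_eq [MeasurableSpace α] (h : HasChannelLaw μ C q ℓ ρ X Z W)
    (hX : Measurable X) (hZ : Measurable Z) (hW : Measurable W)
    (hqm : ∀ c, Measurable (q c)) (hℓm : ∀ c, Measurable (ℓ c)) (hq : ∀ c z, 0 ≤ q c z)
    (hℓ : ∀ c w, 0 ≤ ℓ c w) {A : Set α} (hA : MeasurableSet A) :
    μ⟦X ⁻¹' A | MeasurableSpace.comap (fun ω => (Z ω, W ω)) inferInstance⟧ =ᵐ[μ]
      fun ω => bayesPosterior C q ℓ A (Z ω) (W ω) := by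
  classical
  have hV : Measurable (fun ω => (Z ω, W ω)) := hZ.prodMk hW
  have hpm := measurable_bayesPosterior (C := C) hqm hℓm A
  have hpi : Integrable (fun ω => bayesPosterior C q ℓ A (Z ω) (W ω)) μ :=
    Integrable.of_bound (C := 1) (hpm.comp hV).aestronglyMeasurable (ae_of_all _ fun ω => by
      rw [Real.norm_eq_abs, abs_of_nonneg (bayesPosterior_nonneg hq hℓ _ _ _)]
      exact bayesPosterior_le_one hq hℓ _ _ _)
  refine (ae_eq_condExp_of_forall_setIntegral_eq hV.comap_le
    ((integrable_const _).indicator (hX hA)) (fun _ _ _ => hpi.integrableOn) ?_ ?_).symm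
  · rintro _ ⟨D, hD, rfl⟩ -
    have hVD := hV hD
    rw [setIntegral_indicator (hX hA), setIntegral_const, smul_eq_mul, mul_one,
      integral_eq_lintegral_of_nonneg_ae (ae_of_all _ fun ω => bayesPosterior_nonneg hq hℓ _ _ _)
        (hpm.comp hV).aestronglyMeasurable, Measure.real]
    congr 1
    -- Both sides of the defining property of conditional expectation are written as integrals of
    -- functions of `(X, Z, W)`. After `HasChannelLaw` is applied, the integrands agree by
    -- `bayesPosterior_mul_sum`.
    have e1 : ∫⁻ ω in (fun ω => (Z ω, W ω)) ⁻¹' D, ENNReal.ofReal (bayesPosterior C q ℓ A (Z ω) (W ω)) ∂μ =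
        ∫⁻ ω, (fun (_ : α) (z : β) (w : G) => D.indicator
          (fun p : β × G => ENNReal.ofReal (bayesPosterior C q ℓ A p.1 p.2)) (z, w)) (X ω) (Z ω) (W ω) ∂μ := by
      rw [← lintegral_indicator hVD]
      rfl
    have e2 : μ ((fun ω => (Z ω, W ω)) ⁻¹' D ∩ X ⁻¹' A) =
        ∫⁻ ω, (fun (c : α) (z : β) (w : G) => D.indicator
          (fun _ : β × G => A.indicator (fun _ => (1 : ℝ≥0∞)) c) (z, w)) (X ω) (Z ω) (W ω) ∂μ := by
      rw [← lintegral_indicator_one (hVD.inter (hX hA))]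
      refine lintegral_congr fun ω => ?_
      by_cases h1 : (Z ω, W ω) ∈ D <;> by_cases h2 : X ω ∈ A <;> simp [indicator, h1, h2]
    rw [e1, e2, h (fun (_ : α) (z : β) (w : G) => D.indicator
          (fun p : β × G => ENNReal.ofReal (bayesPosterior C q ℓ A p.1 p.2)) (z, w))
        fun _ => hpm.ennreal_ofReal.indicator hD,
      h (fun (c : α) (z : β) (w : G) => D.indicator
          (fun _ : β × G => A.indicator (fun _ => (1 : ℝ≥0∞)) c) (z, w))
        fun _ => measurable_const.indicator hD]
    refine lintegral_congr fun z => lintegral_congr fun w => ?_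
    by_cases hzw : (z, w) ∈ D
    · simp only [indicator_of_mem hzw]
      have hn : ∀ c ∈ C, 0 ≤ q c z * ℓ c w := fun c _ => mul_nonneg (hq c z) (hℓ c w)
      rw [← Finset.sum_mul, ← ENNReal.ofReal_sum_of_nonneg hn,
        ← ENNReal.ofReal_mul (Finset.sum_nonneg hn), mul_comm, bayesPosterior_mul_sum hq hℓ,
        ENNReal.ofReal_sum_of_nonneg (fun c hc => indicator_nonneg
          (fun c _ => mul_nonneg (hq c z) (hℓ c w)) c)]
      refine Finset.sum_congr rfl fun c _ => ?_
      by_cases hc : c ∈ A <;> simp [indicator, hc]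
    · simp only [indicator_of_notMem hzw, mul_zero]
  · exact (hpm.comp (comap_measurable _)).aestronglyMeasurable

/-- The channel law of a Gaussian channel with input `a X`. -/
lemma IsPrior.hasChannelLaw [MeasurableSpace α] [MeasurableSingletonClass α]
    {ι : Type*} [Fintype ι]
    {N : Ω → ι → ℝ} {a : α → ι → ℝ} (hX : Measurable X) (hZ : Measurable Z) (hN : Measurable N)
    (hXC : ∀ᵐ ω ∂μ, X ω ∈ C) (hq : ∀ c z, 0 ≤ q c z) (hqm : ∀ c, Measurable (q c))
    (hp : IsPrior μ C q X Z) (hNlaw : μ.map N = stdGauss ι)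
    (hind : IndepFun N (fun ω => (X ω, Z ω)) μ) :
    HasChannelLaw μ C q (fun c => shiftDensity (a c)) (stdGauss ι) X Z
      (fun ω => a (X ω) + N ω) := by
  classical
  intro F hF
  have e1 : ∫⁻ ω, F (X ω) (Z ω) (a (X ω) + N ω) ∂μ =
      ∫⁻ ω, ∑ c ∈ C, (X ⁻¹' {c}).indicator (fun ω => F c (Z ω) (a c + N ω)) ω ∂μ := by
    refine lintegral_congr_ae ?_
    filter_upwards [hXC] with ω hω
    rw [Finset.sum_eq_single_of_mem _ hω]
    · simp
    · intro c _ hc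
      simp [indicator, hc.symm]
  have hFm : ∀ c, Measurable (fun p : β × (ι → ℝ) => F c p.1 (a c + p.2)) := fun c =>
    (hF c).comp (measurable_fst.prodMk ((measurable_const_add (a c)).comp measurable_snd))
  have hXc : ∀ c, MeasurableSet (X ⁻¹' {c}) := fun c => hX (measurableSet_singleton c)
  have e2 : ∀ c ∈ C, ∫⁻ ω, (X ⁻¹' {c}).indicator (fun ω => F c (Z ω) (a c + N ω)) ω ∂μ =
      ∫⁻ z, ∫⁻ w, ENNReal.ofReal (q c z * shiftDensity (a c) w) * F c z w ∂stdGauss ι ∂(μ.map Z) := by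
    intro c hc
    set Φ : (ι → ℝ) × (α × β) → ℝ≥0∞ := fun p =>
      (Prod.fst ⁻¹' {c} : Set (α × β)).indicator (fun q => F c q.2 (a c + p.1)) p.2 with hΦ
    have hΦm : Measurable Φ := by
      have : Φ = (Prod.snd ⁻¹' (Prod.fst ⁻¹' {c}) : Set ((ι → ℝ) × (α × β))).indicator
          (fun p => F c p.2.2 (a c + p.1)) := by
        ext p; simp only [hΦ, indicator, mem_preimage]
      rw [this]
      refine Measurable.indicator ?_ (measurable_snd (measurable_fst (measurableSet_singleton c)))
      exact (hFm c).comp ((measurable_snd.comp measurable_snd).prodMk measurable_fst)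
    have h1 : ∫⁻ ω, (X ⁻¹' {c}).indicator (fun ω => F c (Z ω) (a c + N ω)) ω ∂μ =
        ∫⁻ ω, Φ (N ω, (X ω, Z ω)) ∂μ := by
      refine lintegral_congr fun ω => ?_
      simp only [hΦ, indicator, mem_preimage]
    -- Independence separates the noise from `(X, Z)`. The prior then handles `X = c`, and
    -- translating the noise by `a c` produces the transition density.
    have h2 := (indepFun_iff_map_prod_eq_prod_map_map hN.aemeasurable
      (hX.prodMk hZ).aemeasurable).1 hind
    rw [h1, ← lintegral_map (f := Φ) hΦm (hN.prodMk (hX.prodMk hZ)), h2, lintegral_prod _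
      hΦm.aemeasurable, hNlaw]
    have h3 : ∀ w, ∫⁻ y, Φ (w, y) ∂(μ.map (fun ω => (X ω, Z ω))) =
        ∫⁻ z, ENNReal.ofReal (q c z) * F c z (a c + w) ∂(μ.map Z) := by
      intro w
      have hΦw : Measurable (fun y => Φ (w, y)) := hΦm.comp measurable_prodMk_left
      rw [lintegral_map hΦw (hX.prodMk hZ),
        ← hp c hc (fun z => F c z (a c + w)) ((hFm c).comp measurable_prodMk_right)]
      refine lintegral_congr fun ω => ?_
      simp only [hΦ, indicator, mem_preimage]
    simp_rw [h3]
    rw [lintegral_lintegral_swap]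
    · refine lintegral_congr fun z => ?_
      have hFz : Measurable (F c z) := (hF c).comp measurable_prodMk_left
      have hFa : Measurable (fun w => F c z (a c + w)) := hFz.comp (measurable_const_add (a c))
      have hdm : Measurable (fun w => ENNReal.ofReal (shiftDensity (a c) w) * F c z w) :=
        (measurable_shiftDensity _).ennreal_ofReal.mul hFz
      rw [lintegral_const_mul _ hFa,
        lintegral_stdGauss_add (a c) hFz, ← lintegral_const_mul _ hdm]
      refine lintegral_congr fun w => ?_
      rw [ENNReal.ofReal_mul (hq c z), mul_assoc]
    · exact (((hqm c).comp measurable_snd).ennreal_ofReal.mul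
        ((hFm c).comp (measurable_snd.prodMk measurable_fst))).aemeasurable
  have hm : ∀ c, Measurable (fun p : β × (ι → ℝ) =>
      ENNReal.ofReal (q c p.1 * shiftDensity (a c) p.2) * F c p.1 p.2) := fun c =>
    (((hqm c).comp measurable_fst).mul ((measurable_shiftDensity _).comp
      measurable_snd)).ennreal_ofReal.mul (hF c)
  have hFω : ∀ c, Measurable (fun ω => F c (Z ω) (a c + N ω)) := fun c =>
    (hFm c).comp (hZ.prodMk hN)
  rw [e1, lintegral_finsetSum _ fun c _ => (hFω c).indicator (hXc c), Finset.sum_congr rfl e2,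
    ← lintegral_finsetSum _ fun c _ => (hm c).lintegral_prod_right']
  refine lintegral_congr fun z => ?_
  have hmz : ∀ c, Measurable (fun w : ι → ℝ =>
      ENNReal.ofReal (q c z * shiftDensity (a c) w) * F c z w) := fun c =>
    (hm c).comp measurable_prodMk_left
  rw [lintegral_finsetSum _ fun c _ => hmz c]

end Bayes

/-! ### Errors of single bits and the one-bit code -/

section BitChannel

/-- The squared estimation error of a bit, as a function of the likelihood ratio. -/
def softError (R : ℝ≥0∞) : ℝ≥0∞ := 4 / (R + 2 + R⁻¹)

lemma measurable_softError : Measurable softError := by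
  unfold softError; fun_prop

/-- With likelihood ratio `R = P e² / Q` the posterior mean is `(R - 1) / (R + 1)`, and one minus
its square is `4 R / (R + 1)²`. Written as `4 / (R + 2 + R⁻¹)`, the formula remains valid at `R = 0`
and `R = ⊤`, the cases of a known bit. -/
lemma ofReal_one_sub_sq_eq_softError {P Q e : ℝ} (hP : 0 ≤ P) (hQ : 0 ≤ Q) (hPQ : 0 < P + Q)
    (he : 0 < e) :
    ENNReal.ofReal (1 - ((P * e - Q * e⁻¹) / (P * e + Q * e⁻¹)) ^ 2) =
      softError (ENNReal.ofReal P / ENNReal.ofReal Q * ENNReal.ofReal (e * e)) := by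
  rcases hP.eq_or_lt with rfl | hP
  · have hQ' : 0 < Q := by simpa using hPQ
    have : (0 * e - Q * e⁻¹) / (0 * e + Q * e⁻¹) = -1 := by
      field_simp
      simp
    rw [this]
    simp [softError]
  rcases hQ.eq_or_lt with rfl | hQ
  · have : (P * e - 0 * e⁻¹) / (P * e + 0 * e⁻¹) = 1 := by
      field_simp
      simp
    rw [this]
    have h1 : ENNReal.ofReal P / ENNReal.ofReal 0 = ⊤ := by
      rw [ENNReal.ofReal_zero, ENNReal.div_zero (by simpa using hP)]
    rw [h1, ENNReal.top_mul (by simp [he])]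
    simp [softError]
  · rw [← ENNReal.ofReal_div_of_pos hQ, ← ENNReal.ofReal_mul (by positivity), softError,
      ← ENNReal.ofReal_inv_of_pos (by positivity)]
    have h2 : (2 : ℝ≥0∞) = ENNReal.ofReal 2 := by simp
    have h4 : (4 : ℝ≥0∞) = ENNReal.ofReal 4 := by simp
    rw [h2, h4, ← ENNReal.ofReal_add (by positivity) (by positivity),
      ← ENNReal.ofReal_add (by positivity) (by positivity),
      ← ENNReal.ofReal_div_of_pos (by positivity)]
    congr 1
    have : P * e + Q * e⁻¹ ≠ 0 := by positivity
    field_simp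
    ring

variable {ι : Type*} [Fintype ι]

lemma measurable_postMean_shift {T : Type*} [MeasurableSpace T] (C : Finset (ι → ℝ))
    {q : (ι → ℝ) → T → ℝ} (hq : ∀ c, Measurable (q c)) {s : T → ℝ} (hs : Measurable s) (c : ι → ℝ)
    (i : ι) : Measurable (fun x : T × (ι → ℝ) =>
      postMean C (fun c => q c x.1) (s x.1) (s x.1 • c + x.2) i) := by
  unfold postMean partFn
  have h1 : ∀ d : ι → ℝ, Measurable (fun x : T × (ι → ℝ) => d ⬝ᵥ (s x.1 • c + x.2)) := fun d =>
    (measurable_dotProduct_left d).comp (by fun_prop)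
  have h2 : ∀ d, Measurable (fun x : T × (ι → ℝ) => q d x.1) := fun d => (hq d).comp measurable_fst
  fun_prop

lemma measurable_totalMMSE {T : Type*} [MeasurableSpace T] (C : Finset (ι → ℝ))
    {q : (ι → ℝ) → T → ℝ} (hq : ∀ c, Measurable (q c)) {s : T → ℝ} (hs : Measurable s) :
    Measurable (fun t => totalMMSE C (fun c => q c t) (s t)) := by
  unfold totalMMSE
  refine Finset.measurable_sum _ fun c _ => (hq c).mul ?_
  have : Measurable (fun x : T × (ι → ℝ) =>
      ∑ i, (1 - postMean C (fun c => q c x.1) (s x.1) (s x.1 • c + x.2) i ^ 2)) :=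
    Finset.measurable_sum _ fun i _ =>
      measurable_const.sub ((measurable_postMean_shift C hq hs c i).pow_const 2)
  exact this.stronglyMeasurable.integral_prod_right'.measurable

variable {C : Finset (ι → ℝ)} {p : (ι → ℝ) → ℝ}

lemma integrable_postMean (hC : ∀ c ∈ C, ∀ i, c i = 1 ∨ c i = -1) (h0 : ∀ c ∈ C, 0 ≤ p c)
    (s : ℝ) (c : ι → ℝ) (i : ι) :
    Integrable (fun w => postMean C p s (s • c + w) i) (stdGauss ι) := by
  simpa using integrable_postMean_mul hC h0 s c i (integrable_const (1 : ℝ))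

/-- Pythagoras for the conditional expectation: the cross term equals the second moment of the
posterior mean by the tower property, and `c i ^ 2 = 1`. -/
lemma sum_integral_sub_postMean_sq (hC : ∀ c ∈ C, ∀ i, c i = 1 ∨ c i = -1) (h0 : ∀ c ∈ C, 0 ≤ p c)
    (h1 : ∑ c ∈ C, p c = 1) (s : ℝ) (i : ι) :
    ∑ c ∈ C, p c * ∫ w, (c i - postMean C p s (s • c + w) i) ^ 2 ∂stdGauss ι =
      ∑ c ∈ C, p c * ∫ w, (1 - postMean C p s (s • c + w) i ^ 2) ∂stdGauss ι := by
  have h := sum_integral_postMean_mul hC h0 h1 s i (g := fun y => postMean C p s y i)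
    fun c _ => integrable_postMean hC h0 s c i
  have i1 : ∀ c, Integrable (fun w => postMean C p s (s • c + w) i) (stdGauss ι) :=
    fun c => integrable_postMean hC h0 s c i
  have i2 : ∀ c, Integrable (fun w => postMean C p s (s • c + w) i * postMean C p s (s • c + w) i)
      (stdGauss ι) := fun c => integrable_postMean_mul hC h0 s c i (i1 c)
  have e : ∀ c ∈ C, p c * ∫ w, (c i - postMean C p s (s • c + w) i) ^ 2 ∂stdGauss ι =
      p c * ∫ w, (1 - postMean C p s (s • c + w) i ^ 2) ∂stdGauss ι +
        2 * (p c * ∫ w, postMean C p s (s • c + w) i * postMean C p s (s • c + w) i ∂stdGauss ι -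
        p c * ∫ w, c i * postMean C p s (s • c + w) i ∂stdGauss ι) := by
    intro c hc
    have i3 := (i1 c).const_mul (c i)
    have i4 : Integrable (fun w => 1 - postMean C p s (s • c + w) i ^ 2) (stdGauss ι) := by
      have := (integrable_const (1 : ℝ)).sub (i2 c)
      refine this.congr (ae_of_all _ fun w => ?_)
      simp [sq]
    have i5 : Integrable (fun w => 2 * (postMean C p s (s • c + w) i *
        postMean C p s (s • c + w) i - c i * postMean C p s (s • c + w) i)) (stdGauss ι) :=
      ((i2 c).sub i3).const_mul 2
    rw [← mul_sub, ← integral_sub (i2 c) i3, mul_left_comm, ← mul_add, ← integral_const_mul (2 : ℝ),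
      ← integral_add i4 i5]
    congr 1
    refine integral_congr_ae (ae_of_all _ fun w => ?_)
    simp only []
    rcases hC c hc i with h | h <;> rw [h] <;> ring
  rw [Finset.sum_congr rfl e, Finset.sum_add_distrib, ← Finset.mul_sum, Finset.sum_sub_distrib, h]
  simp

open Classical in
/-- The code consisting of a single free bit. -/
def bitCode : Finset (Unit → ℝ) := {fun _ => 1, fun _ => -1}

lemma bitCode_sum {M : Type*} [AddCommMonoid M] (f : (Unit → ℝ) → M) :
    ∑ c ∈ bitCode, f c = f (fun _ => 1) + f (fun _ => -1) := by
  rw [bitCode, Finset.sum_pair]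
  intro h
  have := congrFun h ()
  norm_num at this

lemma mem_bitCode {c : Unit → ℝ} : c ∈ bitCode ↔ c = (fun _ => 1) ∨ c = (fun _ => -1) := by
  simp [bitCode]

lemma bitCode_pm : ∀ c ∈ bitCode, ∀ i, c i = 1 ∨ c i = -1 := by
  intro c hc i
  rcases mem_bitCode.1 hc with rfl | rfl <;> simp

/-- The uniform prior on a bit. -/
def bitPrior : (Unit → ℝ) → ℝ := fun _ => 2⁻¹

lemma bitPrior_nonneg : ∀ c ∈ bitCode, 0 ≤ bitPrior c := fun _ _ => by norm_num [bitPrior]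

lemma bitPrior_sum : ∑ c ∈ bitCode, bitPrior c = 1 := by
  rw [bitCode_sum]; norm_num [bitPrior]

instance : IsProbabilityMeasure bitLaw := by
  constructor
  simp [bitLaw, ENNReal.inv_two_add_inv_two]

lemma gaussianReal_map_const_fun :
    (gaussianReal 0 1).map (fun (x : ℝ) (_ : Unit) => x) = stdGauss Unit :=
  (measurePreserving_funUnique (gaussianReal 0 1) Unit).symm.map_eq

lemma postMean_bitCode (s : ℝ) (y : Unit → ℝ) :
    postMean bitCode bitPrior s y () =
      (Real.exp (s * y ()) - (Real.exp (s * y ()))⁻¹) /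
        (Real.exp (s * y ()) + (Real.exp (s * y ()))⁻¹) := by
  rw [postMean, partFn, bitCode_sum, bitCode_sum, ← Real.exp_neg]
  simp only [bitPrior, dotProduct, Finset.univ_unique, Finset.sum_singleton, PUnit.default_eq_unit]
  rw [show 2⁻¹ * Real.exp (s * (1 * y ())) * 1 + 2⁻¹ * Real.exp (s * (-1 * y ())) * -1 =
    2⁻¹ * (Real.exp (s * y ()) - Real.exp (-(s * y ()))) by ring_nf,
    show 2⁻¹ * Real.exp (s * (1 * y ())) + 2⁻¹ * Real.exp (s * (-1 * y ())) =
    2⁻¹ * (Real.exp (s * y ()) + Real.exp (-(s * y ()))) by ring_nf,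
    mul_div_mul_left _ _ (by norm_num)]

/-- Bayes' rule for a code with one free bit and a trivial channel observation. -/
lemma condExp_bit (s : ℝ) :
    (bitLaw.prod (gaussianReal 0 1))[fun p : ℝ × ℝ => p.1 |
      MeasurableSpace.comap (fun p : ℝ × ℝ => s * p.1 + p.2) inferInstance]
      =ᵐ[bitLaw.prod (gaussianReal 0 1)]
    fun p => postMean bitCode bitPrior s (s • (fun _ => p.1) + fun _ => p.2) () := by
  classical
  set μ := bitLaw.prod (gaussianReal 0 1) with hμ
  set X : ℝ × ℝ → (Unit → ℝ) := fun p _ => p.1 with hXdef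
  set N : ℝ × ℝ → (Unit → ℝ) := fun p _ => p.2 with hNdef
  set Z : ℝ × ℝ → Unit := fun _ => () with hZdef
  have hX : Measurable X := by fun_prop
  have hN : Measurable N := by fun_prop
  have hZ : Measurable Z := by fun_prop
  have hXne : ∀ c : Unit → ℝ, X ⁻¹' {c} = Prod.fst ⁻¹' {c ()} := by
    intro c; ext p
    simp only [hXdef, mem_preimage, mem_singleton_iff]
    exact ⟨fun h => congrFun h (), fun h => funext fun _ => h⟩
  have hfst : μ.map Prod.fst = bitLaw := by rw [hμ]; simp
  have hXm : ∀ c ∈ bitCode, μ (X ⁻¹' {c}) = 2⁻¹ := by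
    intro c hc
    rw [hXne, ← Measure.map_apply measurable_fst (measurableSet_singleton _), hfst, bitLaw]
    rcases mem_bitCode.1 hc with rfl | rfl <;> norm_num [indicator]
  have hXC : ∀ᵐ ω ∂μ, X ω ∈ bitCode := by
    have : ∀ᵐ x ∂(μ.map Prod.fst), x = 1 ∨ x = -1 := by
      rw [hfst, bitLaw, ae_add_measure_iff]
      constructor <;> refine Measure.ae_smul_measure ?_ _ <;> rw [ae_dirac_eq] <;> simp
    filter_upwards [ae_of_ae_map measurable_fst.aemeasurable this] with p hp
    rw [mem_bitCode]
    rcases hp with h | h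
    · left; ext; exact h
    · right; ext; exact h
  have hprior : IsPrior μ bitCode (fun c _ => bitPrior c) X Z := by
    intro c hc H hH
    rw [lintegral_map (hH.const_mul _) hZ, lintegral_indicator (hX (measurableSet_singleton c))]
    simp [hZdef, hXm c hc, bitPrior, ENNReal.ofReal_inv_of_pos, mul_comm]
  have hNlaw : μ.map N = stdGauss Unit := by
    rw [← gaussianReal_map_const_fun]
    have : μ.map Prod.snd = gaussianReal 0 1 := by rw [hμ]; simp
    rw [← this, Measure.map_map (by fun_prop) measurable_snd]
    rfl
  have hind : IndepFun N (fun ω => (X ω, Z ω)) μ :=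
    (indepFun_prod (X := fun x : ℝ => ((fun _ => x : Unit → ℝ), ()))
      (Y := fun x : ℝ => (fun _ => x : Unit → ℝ)) (by fun_prop) (by fun_prop)).symm
  have hlaw := hprior.hasChannelLaw (a := fun c => s • c) hX hZ hN hXC
    (fun _ _ => by norm_num [bitPrior]) (fun _ => measurable_const) hNlaw hind
  have hpost := fun A (hA : MeasurableSet A) => hlaw.condExp_eq hX hZ (by fun_prop)
    (fun _ => measurable_const) (fun c => measurable_shiftDensity (s • c))
    (fun _ _ => by norm_num [bitPrior]) (fun _ _ => (shiftDensity_pos _ _).le) (A := A) hA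
  have hcomap : MeasurableSpace.comap (fun p : ℝ × ℝ => s * p.1 + p.2) inferInstance =
      MeasurableSpace.comap (fun ω => (Z ω, s • X ω + N ω)) inferInstance := by
    refine le_antisymm ?_ ?_
    · have hg : Measurable (fun v : Unit × (Unit → ℝ) => v.2 ()) := by fun_prop
      exact (hg.comp (comap_measurable (fun ω => (Z ω, s • X ω + N ω)))).comap_le
    · have hg : Measurable (fun x : ℝ => ((), (fun _ => x : Unit → ℝ))) := by fun_prop
      exact (hg.comp (comap_measurable (fun p : ℝ × ℝ => s * p.1 + p.2))).comap_le
  rw [hcomap]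
  have hp1 := hpost {fun _ => 1} (measurableSet_singleton _)
  have hm1 := hpost {fun _ => -1} (measurableSet_singleton _)
  -- A sign is the difference of the indicators of its two values, so its conditional mean is a
  -- difference of posterior probabilities.
  have hdiff : (fun p : ℝ × ℝ => p.1) =ᵐ[μ]
      (X ⁻¹' {fun _ => 1}).indicator (fun _ => (1 : ℝ)) -
        (X ⁻¹' {fun _ => -1}).indicator (fun _ => (1 : ℝ)) := by
    filter_upwards [hXC] with p hp
    rw [mem_bitCode] at hp
    rw [hXne, hXne]
    rcases hp with h | h
    · have : p.1 = 1 := congrFun h ()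
      simp [indicator, this]
      norm_num
    · have : p.1 = -1 := congrFun h ()
      simp [indicator, this]
      norm_num
  refine (condExp_congr_ae hdiff).trans ((condExp_sub
    ((integrable_const _).indicator (hX (measurableSet_singleton _)))
    ((integrable_const _).indicator (hX (measurableSet_singleton _))) _).trans ?_)
  filter_upwards [hp1, hm1] with p h1 h2
  rw [Pi.sub_apply, h1, h2, bayesPosterior, bayesPosterior, ← sub_div, postMean, partFn]
  simp only [bitCode_sum]
  have hne : (fun _ : Unit => (1 : ℝ)) ≠ fun _ => -1 := fun h => by
    have := congrFun h (); norm_num at this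
  have hd : ∀ c ∈ bitCode, ∀ w, shiftDensity (s • c) w = _ :=
    fun c hc w => shiftDensity_smul_of_mem bitCode_pm hc s w
  simp only [indicator, mem_singleton_iff, hne, hne.symm, if_true, if_false, add_zero, zero_add]
  rw [hd _ (mem_bitCode.2 (Or.inl rfl)), hd _ (mem_bitCode.2 (Or.inr rfl))]
  rw [show ∀ a b c d e : ℝ, (a * (e * b) - c * (e * d)) / (a * (e * b) + c * (e * d)) =
    (e * (a * b - c * d)) / (e * (a * b + c * d)) by intros; ring_nf,
    mul_div_mul_left _ _ (Real.exp_pos _).ne']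
  simp only [hXdef, hNdef]
  ring_nf

end BitChannel

/-! ### The error function `phi` and its total area -/

section Phi

lemma measurable_postMean_bit (s x : ℝ) :
    Measurable (fun w : Unit → ℝ => postMean bitCode bitPrior s (s • (fun _ => x) + w) ()) :=
  (measurable_postMean bitCode bitPrior s ()).comp (measurable_const_add _)

lemma phi_eq_totalMMSE {γ : ℝ≥0∞} (hγ : γ ≠ ⊤) :
    phi γ = totalMMSE bitCode bitPrior √γ.toReal := by
  set s := √γ.toReal with hs
  rw [phi, if_neg hγ, mmse]
  have h1 : ∫ p : ℝ × ℝ, (p.1 - ((bitLaw.prod (gaussianReal 0 1))[fun p : ℝ × ℝ => p.1 |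
      MeasurableSpace.comap (fun p : ℝ × ℝ => s * p.1 + p.2) inferInstance]) p) ^ 2
        ∂(bitLaw.prod (gaussianReal 0 1)) =
      ∫ p : ℝ × ℝ, (p.1 - postMean bitCode bitPrior s (s • (fun _ => p.1) + fun _ => p.2) ()) ^ 2
        ∂(bitLaw.prod (gaussianReal 0 1)) := by
    refine integral_congr_ae ?_
    filter_upwards [condExp_bit s] with p hp
    rw [hp]
  have hF : Measurable (fun p : ℝ × ℝ =>
      (p.1 - postMean bitCode bitPrior s (s • (fun _ => p.1) + fun _ => p.2) ()) ^ 2) := by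
    have : Measurable (fun p : ℝ × ℝ =>
      postMean bitCode bitPrior s (s • (fun _ => p.1) + fun _ => p.2) ()) :=
      (measurable_postMean bitCode bitPrior s ()).comp (by fun_prop)
    fun_prop
  have hnn : 0 ≤ᵐ[bitLaw.prod (gaussianReal 0 1)] (fun p : ℝ × ℝ =>
      (p.1 - postMean bitCode bitPrior s (s • (fun _ => p.1) + fun _ => p.2) ()) ^ 2) :=
    ae_of_all _ fun p => sq_nonneg _
  have hG : ∀ x : ℝ, ∫⁻ n, ENNReal.ofReal
      ((x - postMean bitCode bitPrior s (s • (fun _ => x) + fun _ => n) ()) ^ 2) ∂gaussianReal 0 1 =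
      ENNReal.ofReal (∫ w, (x - postMean bitCode bitPrior s (s • (fun _ => x) + w) ()) ^ 2
        ∂stdGauss Unit) := by
    intro x
    have hm : Measurable (fun w : Unit → ℝ =>
        (x - postMean bitCode bitPrior s (s • (fun _ => x) + w) ()) ^ 2) :=
      (measurable_const.sub (measurable_postMean_bit s x)).pow_const 2
    rw [ofReal_integral_eq_lintegral_ofReal _ (ae_of_all _ fun w => sq_nonneg _),
      ← gaussianReal_map_const_fun, lintegral_map hm.ennreal_ofReal (by fun_prop)]
    refine Integrable.of_bound (C := (|x| + 1) ^ 2) hm.aestronglyMeasurable (ae_of_all _ fun w => ?_)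
    rw [Real.norm_eq_abs, abs_pow]
    have := abs_postMean_le bitCode_pm bitPrior_nonneg s (s • (fun _ => x) + w) ()
    gcongr
    exact (abs_sub _ _).trans (by gcongr)
  have e := sum_integral_sub_postMean_sq bitCode_pm bitPrior_nonneg bitPrior_sum s ()
  rw [h1, integral_eq_lintegral_of_nonneg_ae hnn hF.aestronglyMeasurable,
    lintegral_prod _ hF.ennreal_ofReal.aemeasurable]
  simp only [hG, totalMMSE, Finset.univ_unique, Finset.sum_singleton, PUnit.default_eq_unit]
  rw [← e, bitCode_sum, bitLaw, lintegral_add_measure, lintegral_smul_measure,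
    lintegral_smul_measure, lintegral_dirac, lintegral_dirac, bitPrior]
  have hi : ∀ x : ℝ, 0 ≤ ∫ w, (x - postMean bitCode bitPrior s (s • (fun _ => x) + w) ()) ^ 2
        ∂stdGauss Unit := fun x => integral_nonneg fun w => sq_nonneg _
  rw [ENNReal.toReal_add (by simp [ENNReal.mul_eq_top]) (by simp [ENNReal.mul_eq_top])]
  simp only [smul_eq_mul, ENNReal.toReal_mul, ENNReal.toReal_ofReal (hi _), ENNReal.toReal_inv,
    ENNReal.toReal_ofNat]
  rfl

lemma phi_top : phi ⊤ = 0 := by simp [phi]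

lemma phi_nonneg (γ : ℝ≥0∞) : 0 ≤ phi γ := by
  by_cases h : γ = ⊤
  · rw [h, phi_top]
  · rw [phi_eq_totalMMSE h]
    exact totalMMSE_nonneg bitCode_pm bitPrior_nonneg _

lemma measurable_phi : Measurable phi := by
  have : phi = fun γ => if γ = ⊤ then 0 else totalMMSE bitCode bitPrior √γ.toReal := by
    ext γ
    split_ifs with h
    · rw [h, phi_top]
    · exact phi_eq_totalMMSE h
  rw [this]
  refine Measurable.ite (measurableSet_singleton ⊤) measurable_const ?_
  exact measurable_totalMMSE (q := fun c _ => bitPrior c) bitCode (fun c => measurable_const)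
    (ENNReal.measurable_toReal.sqrt)

/-- A free bit has entropy `log 2` nats, and the area is twice the entropy. -/
lemma lintegral_phi :
    ∫⁻ u in Ioi (0 : ℝ), ENNReal.ofReal (phi (ENNReal.ofReal u)) = ENNReal.ofReal (Real.log 4) := by
  have h := lintegral_totalMMSE bitCode_pm bitPrior_nonneg bitPrior_sum
  have h2 : 2 * ∑ c ∈ bitCode, Real.negMulLog (bitPrior c) = Real.log 4 := by
    rw [bitCode_sum, show (4 : ℝ) = 2 ^ 2 by norm_num, Real.log_pow]
    simp only [bitPrior, Real.negMulLog, Real.log_inv]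
    push_cast
    ring
  rw [h2] at h
  rw [← h]
  refine setLIntegral_congr_fun measurableSet_Ioi fun u hu => ?_
  rw [phi_eq_totalMMSE ENNReal.ofReal_ne_top, ENNReal.toReal_ofReal (le_of_lt hu)]

/-- Expressed through the likelihood ratio separately for each bit value, the form in which `phi` is
compared with the extrinsic channel. -/
lemma ofReal_phi {γ : ℝ≥0∞} (hγ : γ ≠ ⊤) :
    ENNReal.ofReal (phi γ) =
      2⁻¹ * ∫⁻ n, softError (ENNReal.ofReal
        (Real.exp (2 * (√γ.toReal * (√γ.toReal * 1 + n))))) ∂gaussianReal 0 1 +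
      2⁻¹ * ∫⁻ n, softError (ENNReal.ofReal
        (Real.exp (2 * (√γ.toReal * (√γ.toReal * (-1) + n))))) ∂gaussianReal 0 1 := by
  set s := √γ.toReal with hs
  have hc : ∀ x : ℝ, ENNReal.ofReal
      (∫ w, (1 - postMean bitCode bitPrior s (s • (fun _ => x) + w) () ^ 2) ∂stdGauss Unit) =
      ∫⁻ n, softError (ENNReal.ofReal (Real.exp (2 * (s * (s * x + n))))) ∂gaussianReal 0 1 := by
    intro x
    have hm : Measurable (fun w : Unit → ℝ =>
        1 - postMean bitCode bitPrior s (s • (fun _ => x) + w) () ^ 2) :=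
      measurable_const.sub ((measurable_postMean_bit s x).pow_const 2)
    have hnn : ∀ w : Unit → ℝ,
        0 ≤ 1 - postMean bitCode bitPrior s (s • (fun _ => x) + w) () ^ 2 := fun w =>
      sub_nonneg.2 (postMean_sq_le bitCode_pm bitPrior_nonneg s _ ())
    rw [ofReal_integral_eq_lintegral_ofReal _ (ae_of_all _ hnn), ← gaussianReal_map_const_fun,
      lintegral_map hm.ennreal_ofReal (by fun_prop)]
    · refine lintegral_congr fun n => ?_
      have := ofReal_one_sub_sq_eq_softError (P := 1) (Q := 1) zero_le_one zero_le_one (by norm_num)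
        (Real.exp_pos (s * (s * x + n)))
      rw [postMean_bitCode]
      simp only [one_mul, ENNReal.ofReal_one, div_one, ← Real.exp_add] at this
      simp only [Pi.add_apply, Pi.smul_apply, smul_eq_mul]
      rw [this]
      congr 3
      ring
    · refine Integrable.of_bound (C := 1) hm.aestronglyMeasurable (ae_of_all _ fun w => ?_)
      rw [Real.norm_eq_abs, abs_of_nonneg (hnn w)]
      linarith [sq_nonneg (postMean bitCode bitPrior s (s • (fun _ => x) + w) ())]
  have hi : ∀ x : ℝ, 0 ≤ ∫ w, (1 - postMean bitCode bitPrior s (s • (fun _ => x) + w) () ^ 2)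
      ∂stdGauss Unit := fun x => integral_nonneg fun w =>
    sub_nonneg.2 (postMean_sq_le bitCode_pm bitPrior_nonneg s _ ())
  rw [← hc, ← hc, phi_eq_totalMMSE hγ, totalMMSE, bitCode_sum]
  simp only [Finset.univ_unique, Finset.sum_singleton, PUnit.default_eq_unit]
  rw [ENNReal.ofReal_add (mul_nonneg (by norm_num [bitPrior]) (hi _))
    (mul_nonneg (by norm_num [bitPrior]) (hi _)), ENNReal.ofReal_mul (by norm_num [bitPrior]),
    ENNReal.ofReal_mul (by norm_num [bitPrior])]
  have : ENNReal.ofReal 2⁻¹ = 2⁻¹ := by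
    rw [ENNReal.ofReal_inv_of_pos (by norm_num)]; simp
  simp only [bitPrior, this]

end Phi

/-! ### The code model and its extrinsic likelihood ratios -/

section CodeModel

variable {Ω β : Type*} [MeasurableSpace Ω] [MeasurableSpace β] {n : ℕ}

/-- A codeword `X` of the code `C` with equiprobable bits, a channel observation `Z`, and an
independent standard Gaussian noise `N`. -/
structure IsCodeModel (μ : Measure Ω) (C : Finset (Fin n → ℝ)) (X N : Ω → Fin n → ℝ) (Z : Ω → β) :
    Prop where
  pm : ∀ c ∈ C, ∀ i, c i = 1 ∨ c i = -1
  measurable_X : Measurable X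
  measurable_N : Measurable N
  measurable_Z : Measurable Z
  mem : ∀ᵐ ω ∂μ, X ω ∈ C
  bit : ∀ k x, x = 1 ∨ x = -1 → μ {ω | X ω k = x} = 2⁻¹
  law_N : μ.map N = stdGauss (Fin n)
  indep : IndepFun N (fun ω => (X ω, Z ω)) μ

/-- Conditional probability of the codeword `c` given the channel observation. -/
def codePrior (μ : Measure Ω) [IsFiniteMeasure μ] (X : Ω → Fin n → ℝ) (Z : Ω → β)
    (c : Fin n → ℝ) (z : β) : ℝ :=
  (condDistrib X Z μ z).real {c}

variable {μ : Measure Ω} [IsProbabilityMeasure μ] {C : Finset (Fin n → ℝ)}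
  {X N : Ω → Fin n → ℝ} {Z : Ω → β}

lemma codePrior_nonneg (c : Fin n → ℝ) (z : β) : 0 ≤ codePrior μ X Z c z := measureReal_nonneg

lemma measurable_codePrior (c : Fin n → ℝ) : Measurable (codePrior μ X Z c) :=
  (Kernel.measurable_coe _ (measurableSet_singleton c)).ennreal_toReal

lemma isPrior_codePrior (hX : Measurable X) (hZ : Measurable Z) :
    IsPrior μ C (codePrior μ X Z) X Z := by
  intro c _ H hH
  set F : β × (Fin n → ℝ) → ℝ≥0∞ := fun p => (Prod.snd ⁻¹' {c}).indicator (fun p => H p.1) p with hF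
  have hFm : Measurable F := (hH.comp measurable_fst).indicator
    (measurable_snd (measurableSet_singleton c))
  have h1 : ∫⁻ ω, (X ⁻¹' {c}).indicator (fun ω => H (Z ω)) ω ∂μ = ∫⁻ ω, F (Z ω, X ω) ∂μ := by
    refine lintegral_congr fun ω => ?_
    simp only [hF, indicator, mem_preimage]
  rw [h1, ← lintegral_map hFm (hZ.prodMk hX), ← compProd_map_condDistrib hX.aemeasurable,
    Measure.lintegral_compProd hFm]
  refine lintegral_congr fun z => ?_
  have h2 : ∀ x, F (z, x) = ({c} : Set (Fin n → ℝ)).indicator (fun _ => H z) x := by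
    intro x; simp only [hF, indicator, mem_preimage]
  simp_rw [h2]
  rw [lintegral_indicator_const (measurableSet_singleton c), mul_comm, codePrior,
    ofReal_measureReal]

lemma IsCodeModel.sum_codePrior (h : IsCodeModel μ C X N Z) :
    ∀ᵐ z ∂(μ.map Z), ∑ c ∈ C, codePrior μ X Z c z = 1 := by
  have hCm : MeasurableSet ((C : Set (Fin n → ℝ))ᶜ) := C.measurableSet.compl
  have h1 : ∫⁻ z, condDistrib X Z μ z (C : Set (Fin n → ℝ))ᶜ ∂(μ.map Z) = 0 := by
    rw [lintegral_map (Kernel.measurable_coe _ hCm) h.measurable_Z]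
    have := setLIntegral_preimage_condDistrib (μ := μ) h.measurable_Z h.measurable_X.aemeasurable hCm
      (t := univ) MeasurableSet.univ
    simp only [preimage_univ, Measure.restrict_univ, univ_inter] at this
    rw [this]
    exact h.mem
  rw [lintegral_eq_zero_iff (Kernel.measurable_coe _ hCm)] at h1
  filter_upwards [h1] with z hz
  have h2 : (condDistrib X Z μ z).real (C : Set (Fin n → ℝ)) = 1 := by
    have h3 : condDistrib X Z μ z (C : Set (Fin n → ℝ)) = 1 := by
      rw [← prob_compl_eq_zero_iff C.measurableSet]; exact hz
    simp [Measure.real, h3]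
  rw [← h2]
  simp only [codePrior, Measure.real]
  rw [← ENNReal.toReal_sum (by simp), sum_measure_singleton]

lemma IsCodeModel.condEntropyBits_eq (h : IsCodeModel μ C X N Z) :
    condEntropyBits μ C X Z =
      (∫ z, ∑ c ∈ C, Real.negMulLog (codePrior μ X Z c z) ∂(μ.map Z)) / Real.log 2 := by
  rw [condEntropyBits]
  congr 1
  have hm : Measurable (fun z => ∑ c ∈ C, Real.negMulLog (codePrior μ X Z c z)) :=
    Finset.measurable_sum _ fun c _ =>
      Real.continuous_negMulLog.measurable.comp (measurable_codePrior c)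
  rw [integral_map h.measurable_Z.aemeasurable hm.aestronglyMeasurable]
  refine integral_congr_ae ?_
  have : ∀ᵐ ω ∂μ, ∀ c ∈ C, codePrior μ X Z c (Z ω) =
      (μ⟦X ⁻¹' {c} | MeasurableSpace.comap Z inferInstance⟧) ω := by
    rw [Filter.eventually_all_finset]
    intro c _
    exact condDistrib_ae_eq_condExp h.measurable_Z h.measurable_X (measurableSet_singleton c)
  filter_upwards [this] with ω hω
  exact Finset.sum_congr rfl fun c hc => by rw [hω c hc]

/-- Restriction of a vector to the coordinates other than `k`. -/
def dropCoord (k : Fin n) (c : Fin n → ℝ) : {j : Fin n // j ≠ k} → ℝ := fun j => c j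

lemma measurable_dropCoord (k : Fin n) : Measurable (dropCoord k) := by
  unfold dropCoord; fun_prop

/-- The noise on bit `k` is independent of the noise on the others. This separates the bit's own
observation from the extrinsic ones. -/
lemma lintegral_stdGauss_split (k : Fin n) {F : ℝ → ({j : Fin n // j ≠ k} → ℝ) → ℝ≥0∞}
    (hF : Measurable (fun p : ℝ × ({j : Fin n // j ≠ k} → ℝ) => F p.1 p.2)) :
    ∫⁻ w, F (w k) (dropCoord k w) ∂stdGauss (Fin n) =
      ∫⁻ x, ∫⁻ v, F x v ∂stdGauss {j : Fin n // j ≠ k} ∂gaussianReal 0 1 := by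
  have hA := measurePreserving_piEquivPiSubtypeProd (fun _ : Fin n => gaussianReal 0 1) (· ≠ k)
  have hk : ¬ (k ≠ k) := by simp
  have hB := measurePreserving_eval
    (fun _ : {i : Fin n // ¬ i ≠ k} => gaussianReal 0 1) ⟨k, hk⟩
  have hm : Measurable (fun p : ({j : Fin n // j ≠ k} → ℝ) × ({i : Fin n // ¬ i ≠ k} → ℝ) =>
      F (p.2 ⟨k, hk⟩) p.1) :=
    hF.comp (g := fun p : ℝ × ({j : Fin n // j ≠ k} → ℝ) => F p.1 p.2)
      (f := fun p : ({j : Fin n // j ≠ k} → ℝ) × ({i : Fin n // ¬ i ≠ k} → ℝ) =>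
        (p.2 ⟨k, hk⟩, p.1)) (by fun_prop)
  have h1 := hA.lintegral_comp hm
  have h2 : ∫⁻ w, F (w k) (dropCoord k w) ∂stdGauss (Fin n) = _ := h1
  rw [h2, lintegral_prod_symm' _ hm]
  exact hB.lintegral_comp (f := fun x => ∫⁻ v, F x v ∂stdGauss {j : Fin n // j ≠ k})
    hF.lintegral_prod_right'

lemma map_dropCoord_stdGauss (k : Fin n) :
    (stdGauss (Fin n)).map (dropCoord k) = stdGauss {j : Fin n // j ≠ k} := by
  refine Measure.ext_of_lintegral _ fun f hf => ?_
  rw [lintegral_map hf (measurable_dropCoord k),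
    lintegral_stdGauss_split k (F := fun _ v => f v) (hf.comp measurable_snd)]
  simp

/-- Unnormalized extrinsic probability of the value `x` of bit `k`. -/
def extWeight (C : Finset (Fin n → ℝ)) (q : (Fin n → ℝ) → β → ℝ) (k : Fin n) (s x : ℝ) (z : β)
    (w : {j : Fin n // j ≠ k} → ℝ) : ℝ :=
  ∑ c ∈ C, {c : Fin n → ℝ | c k = x}.indicator
    (fun c => q c z * shiftDensity (s • dropCoord k c) w) c

/-- The likelihood ratio of bit `k` given the extrinsic observations. -/
def extRatio (C : Finset (Fin n → ℝ)) (q : (Fin n → ℝ) → β → ℝ) (k : Fin n) (s : ℝ) (z : β)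
    (w : {j : Fin n // j ≠ k} → ℝ) : ℝ≥0∞ :=
  ENNReal.ofReal (extWeight C q k s 1 z w) / ENNReal.ofReal (extWeight C q k s (-1) z w)

omit [MeasurableSpace β] in
lemma extWeight_nonneg {q : (Fin n → ℝ) → β → ℝ} (hq : ∀ c z, 0 ≤ q c z) (k : Fin n) (s x : ℝ)
    (z : β) (w : {j : Fin n // j ≠ k} → ℝ) : 0 ≤ extWeight C q k s x z w :=
  Finset.sum_nonneg fun c _ => indicator_nonneg
    (fun c _ => mul_nonneg (hq c z) (shiftDensity_pos _ _).le) c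

lemma measurable_extWeight {q : (Fin n → ℝ) → β → ℝ} (hq : ∀ c, Measurable (q c)) (k : Fin n)
    (s x : ℝ) : Measurable (fun p : β × ({j : Fin n // j ≠ k} → ℝ) =>
      extWeight C q k s x p.1 p.2) :=
  measurable_sum_indicator hq (fun c => measurable_shiftDensity (s • dropCoord k c)) _

lemma measurable_extRatio {q : (Fin n → ℝ) → β → ℝ} (hq : ∀ c, Measurable (q c)) (k : Fin n)
    (s : ℝ) : Measurable (fun p : β × ({j : Fin n // j ≠ k} → ℝ) => extRatio C q k s p.1 p.2) :=
  (measurable_extWeight hq k s 1).ennreal_ofReal.div (measurable_extWeight hq k s (-1)).ennreal_ofReal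

omit [MeasurableSpace β] in
lemma extWeight_add {q : (Fin n → ℝ) → β → ℝ} (hC : ∀ c ∈ C, ∀ i, c i = 1 ∨ c i = -1) (k : Fin n)
    (s : ℝ) (z : β) (w : {j : Fin n // j ≠ k} → ℝ) :
    extWeight C q k s 1 z w + extWeight C q k s (-1) z w =
      ∑ c ∈ C, q c z * shiftDensity (s • dropCoord k c) w := by
  rw [extWeight, extWeight, ← Finset.sum_add_distrib]
  refine Finset.sum_congr rfl fun c hc => ?_
  rcases hC c hc k with h | h <;> simp only [indicator, mem_ofPred_eq, h] <;> norm_num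

omit [MeasurableSpace β] in
lemma extWeight_add_pos {q : (Fin n → ℝ) → β → ℝ} (hC : ∀ c ∈ C, ∀ i, c i = 1 ∨ c i = -1)
    (hq : ∀ c z, 0 ≤ q c z) (k : Fin n) (s : ℝ) {z : β} (hz : ∑ c ∈ C, q c z = 1)
    (w : {j : Fin n // j ≠ k} → ℝ) :
    0 < extWeight C q k s 1 z w + extWeight C q k s (-1) z w := by
  rw [extWeight_add hC]
  exact sum_mul_exp_pos (fun c _ => hq c z) hz _

/-- The observation of the bits other than `k` through the a priori channel. -/
def extObs (X N : Ω → Fin n → ℝ) (s : ℝ) (k : Fin n) (ω : Ω) : {j : Fin n // j ≠ k} → ℝ :=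
  s • dropCoord k (X ω) + dropCoord k (N ω)

omit [IsProbabilityMeasure μ] in
lemma IsCodeModel.measurable_extObs (h : IsCodeModel μ C X N Z) (s : ℝ)
    (k : Fin n) : Measurable (extObs X N s k) :=
  (((measurable_dropCoord k).comp h.measurable_X).const_smul s).add
    ((measurable_dropCoord k).comp h.measurable_N)

lemma IsCodeModel.hasChannelLaw (h : IsCodeModel μ C X N Z) (s : ℝ) (k : Fin n) :
    HasChannelLaw μ C (codePrior μ X Z) (fun c => shiftDensity (s • dropCoord k c))
      (stdGauss {j : Fin n // j ≠ k}) X Z (extObs X N s k) := by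
  refine (isPrior_codePrior h.measurable_X h.measurable_Z).hasChannelLaw
    (a := fun c => s • dropCoord k c) (N := fun ω => dropCoord k (N ω)) h.measurable_X
    h.measurable_Z ((measurable_dropCoord k).comp h.measurable_N) h.mem codePrior_nonneg
    measurable_codePrior ?_ ?_
  · rw [← map_dropCoord_stdGauss, ← h.law_N, Measure.map_map (measurable_dropCoord k) h.measurable_N]
    rfl
  · exact h.indep.comp (measurable_dropCoord k) measurable_id

/-- By Bayes' rule both posterior probabilities have the same denominator, positive almost surely,
which cancels. Exponentiating keeps the infinite values of the log likelihood ratio harmless. -/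
lemma IsCodeModel.extrinsicLLR_ae_eq (h : IsCodeModel μ C X N Z) (γ : ℝ≥0) (k : Fin n) :
    ∀ᵐ ω ∂μ, EReal.exp (extrinsicLLR μ X (awgn X N γ) Z k ω) =
      extRatio C (codePrior μ X Z) k √γ (Z ω) (extObs X N √γ k ω) := by
  have hA : ∀ x : ℝ, MeasurableSet {c : Fin n → ℝ | c k = x} := fun x =>
    measurableSet_eq_fun (measurable_pi_apply k) measurable_const
  have hb := fun x => (h.hasChannelLaw √γ k).condExp_eq h.measurable_X h.measurable_Z
    (h.measurable_extObs _ k) measurable_codePrior (fun c => measurable_shiftDensity _)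
    codePrior_nonneg (fun c w => (shiftDensity_pos _ w).le) (hA x)
  have hsum := ae_of_ae_map h.measurable_Z.aemeasurable h.sum_codePrior
  filter_upwards [hb 1, hb (-1), hsum] with ω h1 h2 h3
  have e : ∀ x : ℝ, (fun ω => X ω k) ⁻¹' {x} = X ⁻¹' {c : Fin n → ℝ | c k = x} := fun x => rfl
  have e' : (fun ω => (Z ω, fun j : {j : Fin n // j ≠ k} => awgn X N γ ω j)) =
      fun ω => (Z ω, extObs X N √γ k ω) := rfl
  rw [extrinsicLLR, _root_.llr, ENNReal.exp_log, e, e, e', h1, h2]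
  have hpos := extWeight_add_pos h.pm codePrior_nonneg k √γ h3 (extObs X N √γ k ω)
  rw [extWeight_add h.pm] at hpos
  rw [bayesPosterior, bayesPosterior, ENNReal.ofReal_div_of_pos hpos, ENNReal.ofReal_div_of_pos hpos]
  exact ENNReal.mul_div_mul_right _ _ (by simp) (by simpa using hpos)

omit [IsProbabilityMeasure μ] in
lemma measurable_extrinsicLLR (hZ : Measurable Z) {Y : Ω → Fin n → ℝ}
    (hY : Measurable Y) (k : Fin n) : Measurable (extrinsicLLR μ X Y Z k) := by
  unfold extrinsicLLR _root_.llr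
  have hV : Measurable (fun ω => (Z ω, fun j : {j : Fin n // j ≠ k} => Y ω j)) := by fun_prop
  have : ∀ f : Ω → ℝ, Measurable (μ[f | MeasurableSpace.comap
      (fun ω => (Z ω, fun j : {j : Fin n // j ≠ k} => Y ω j)) inferInstance]) := fun f =>
    (stronglyMeasurable_condExp.mono hV.comap_le).measurable
  exact ENNReal.measurable_log.comp
    ((this _).ennreal_ofReal.div (this _).ennreal_ofReal)

-- The Gaussian hypothesis as it is used: only the sum over the positions is known. The factor `2⁻¹`
-- is the probability of the conditioning event.
omit [IsProbabilityMeasure μ] in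
lemma IsCodeModel.sum_lintegral_extrinsicLLR (h : IsCodeModel μ C X N Z) (hn : 0 < n)
    {γext : ℝ≥0 → ℝ≥0∞} (hext : GaussianExtrinsic μ X N Z γext) (γ : ℝ≥0) {x : ℝ}
    (hx : x = 1 ∨ x = -1) {f : EReal → ℝ≥0∞} (hf : Measurable f) :
    ∑ k, ∫⁻ ω in {ω | X ω k = x}, f (extrinsicLLR μ X (awgn X N γ) Z k ω) ∂μ =
      n * (2⁻¹ * ∫⁻ l, f l ∂awgnLLRLaw (γext γ) x) := by
  have hY : Measurable (awgn X N γ) := by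
    have := h.measurable_X
    have := h.measurable_N
    unfold awgn; fun_prop
  have hn' : (n : ℝ≥0∞) * (n : ℝ≥0∞)⁻¹ = 1 :=
    ENNReal.mul_inv_cancel (by simpa using hn.ne') (by simp)
  have h2 : (2⁻¹ : ℝ≥0∞) * 2 = 1 := ENNReal.inv_mul_cancel (by simp) (by simp)
  have hk : ∀ k, ∫⁻ l, f l ∂((ProbabilityTheory.cond μ {ω | X ω k = x}).map
      (extrinsicLLR μ X (awgn X N γ) Z k)) =
      2 * ∫⁻ ω in {ω | X ω k = x}, f (extrinsicLLR μ X (awgn X N γ) Z k ω) ∂μ := by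
    intro k
    rw [lintegral_map hf (measurable_extrinsicLLR h.measurable_Z hY k),
      ProbabilityTheory.cond, lintegral_smul_measure, h.bit k x hx, inv_inv, smul_eq_mul]
  rw [← hext γ x hx, extrinsicLLRLaw, lintegral_smul_measure, lintegral_finsetSum_measure,
    Finset.sum_congr rfl fun k _ => hk k, ← Finset.mul_sum, smul_eq_mul]
  calc _ = ((n : ℝ≥0∞) * (n : ℝ≥0∞)⁻¹) * (2⁻¹ * 2) * ∑ k, ∫⁻ ω in {ω | X ω k = x},
        f (extrinsicLLR μ X (awgn X N γ) Z k ω) ∂μ := by rw [hn', h2, one_mul, one_mul]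
    _ = _ := by ring

end CodeModel

/-! ### Monotonicity of the extrinsic signal to noise ratio -/

section Monotone

/-- Averaging out part of the noise degrades the channel: the likelihood becomes that of the
amplitude reduced by the factor `r`. The quadratic terms combine because `r ^ 2 + t ^ 2 = 1`. -/
lemma lintegral_shiftDensity_rotate {ι : Type*} [Fintype ι] {r t : ℝ} (hrt : r ^ 2 + t ^ 2 = 1)
    (a w : ι → ℝ) :
    ∫⁻ v, ENNReal.ofReal (shiftDensity a (r • w + t • v)) ∂stdGauss ι =
      ENNReal.ofReal (shiftDensity (r • a) w) := by
  have h : ∀ v, ENNReal.ofReal (shiftDensity a (r • w + t • v)) =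
      ENNReal.ofReal (shiftDensity (r • a) w) * ENNReal.ofReal (shiftDensity (t • a) v) := by
    intro v
    rw [← ENNReal.ofReal_mul (shiftDensity_pos _ _).le, shiftDensity, shiftDensity, shiftDensity,
      ← Real.exp_add]
    congr 2
    simp only [dotProduct_add, dotProduct_smul, smul_dotProduct, smul_eq_mul]
    linear_combination (a ⬝ᵥ a / 2) * hrt
  simp_rw [h]
  rw [lintegral_const_mul _ (measurable_shiftDensity _).ennreal_ofReal, lintegral_shiftDensity,
    mul_one]

variable {Ω β : Type*} [MeasurableSpace Ω] [MeasurableSpace β] {n : ℕ} {C : Finset (Fin n → ℝ)}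

omit [MeasurableSpace β] in
lemma ofReal_extWeight {q : (Fin n → ℝ) → β → ℝ} (hq : ∀ c z, 0 ≤ q c z) (k : Fin n) (s x : ℝ)
    (z : β) (w : {j : Fin n // j ≠ k} → ℝ) : ENNReal.ofReal (extWeight C q k s x z w) =
      ∑ c ∈ C, {c : Fin n → ℝ | c k = x}.indicator (fun c => ENNReal.ofReal (q c z) *
        ENNReal.ofReal (shiftDensity (s • dropCoord k c) w)) c := by
  rw [extWeight, ENNReal.ofReal_sum_of_nonneg (fun c _ => indicator_nonneg
    (fun c _ => mul_nonneg (hq c z) (shiftDensity_pos _ _).le) c)]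
  refine Finset.sum_congr rfl fun c _ => ?_
  by_cases hc : c ∈ {c : Fin n → ℝ | c k = x}
  · rw [indicator_of_mem hc, indicator_of_mem hc, ENNReal.ofReal_mul (hq c z)]
  · rw [indicator_of_notMem hc, indicator_of_notMem hc, ENNReal.ofReal_zero]

omit [MeasurableSpace β] in
lemma lintegral_extWeight_rotate {q : (Fin n → ℝ) → β → ℝ} (hq : ∀ c z, 0 ≤ q c z) (k : Fin n)
    {r t : ℝ} (hrt : r ^ 2 + t ^ 2 = 1) (s x : ℝ) (z : β) (w : {j : Fin n // j ≠ k} → ℝ) :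
    ∫⁻ v, ENNReal.ofReal (extWeight C q k s x z (r • w + t • v)) ∂stdGauss {j : Fin n // j ≠ k} =
      ENNReal.ofReal (extWeight C q k (r * s) x z w) := by
  simp_rw [ofReal_extWeight hq]
  have hm : ∀ c : Fin n → ℝ, Measurable (fun v : {j : Fin n // j ≠ k} → ℝ =>
      ENNReal.ofReal (shiftDensity (s • dropCoord k c) (r • w + t • v))) := fun c =>
    ((measurable_shiftDensity (s • dropCoord k c)).comp
      (show Measurable fun v : {j : Fin n // j ≠ k} → ℝ => r • w + t • v by fun_prop)).ennreal_ofReal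
  rw [lintegral_finsetSum]
  · refine Finset.sum_congr rfl fun c _ => ?_
    by_cases hc : c ∈ {c : Fin n → ℝ | c k = x}
    · simp only [indicator_of_mem hc]
      rw [lintegral_const_mul _ (hm c), lintegral_shiftDensity_rotate hrt, smul_smul]
    · simp only [indicator_of_notMem hc, lintegral_zero]
  · intro c _
    by_cases hc : c ∈ {c : Fin n → ℝ | c k = x}
    · simp only [indicator_of_mem hc]
      exact (hm c).const_mul _
    · simp only [indicator_of_notMem hc]
      exact measurable_const

/-- The Bhattacharyya coefficient of the extrinsic observation of bit `k`. -/
def bhattacharyya (C : Finset (Fin n → ℝ)) (q : (Fin n → ℝ) → β → ℝ) (k : Fin n) (s : ℝ)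
    (z : β) : ℝ≥0∞ :=
  ∫⁻ w, ENNReal.ofReal (extWeight C q k s 1 z w) ^ (1 / 2 : ℝ) *
    ENNReal.ofReal (extWeight C q k s (-1) z w) ^ (1 / 2 : ℝ) ∂stdGauss {j : Fin n // j ≠ k}

/-- The observation of amplitude `s'` is decomposed by a rotation with ratio `r = s / s'`.
Cauchy-Schwarz in the averaged variable bounds the integral of the product of square roots by the
product of square roots of the integrals, which are the weights at amplitude `s`. -/
lemma bhattacharyya_le {q : (Fin n → ℝ) → β → ℝ} (hq : ∀ c z, 0 ≤ q c z)
    (hqm : ∀ c, Measurable (q c)) (k : Fin n) {s s' : ℝ} (hs : 0 ≤ s) (hss : s ≤ s') (z : β) :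
    bhattacharyya C q k s' z ≤ bhattacharyya C q k s z := by
  rcases hss.eq_or_lt with rfl | hlt
  · rfl
  have hs' : 0 < s' := hs.trans_lt hlt
  set r := s / s' with hr
  have hr1 : r ^ 2 ≤ 1 := by
    rw [sq_le_one_iff_abs_le_one, abs_of_nonneg (by positivity)]
    exact div_le_one_of_le₀ hss hs'.le
  set t := √(1 - r ^ 2) with ht
  have hrt : r ^ 2 + t ^ 2 = 1 := by
    rw [ht, Real.sq_sqrt (by linarith)]; ring
  have hrs : r * s' = s := div_mul_cancel₀ _ hs'.ne'
  have hm : ∀ x, Measurable (fun w : {j : Fin n // j ≠ k} → ℝ =>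
      ENNReal.ofReal (extWeight C q k s' x z w)) := fun x =>
    ((measurable_extWeight hqm k s' x).comp measurable_prodMk_left).ennreal_ofReal
  have hm2 : ∀ x, Measurable (fun w : {j : Fin n // j ≠ k} → ℝ =>
      ENNReal.ofReal (extWeight C q k s' x z w) ^ (1 / 2 : ℝ)) := fun x => (hm x).pow_const _
  have hmm : Measurable (fun w : {j : Fin n // j ≠ k} → ℝ =>
      ENNReal.ofReal (extWeight C q k s' 1 z w) ^ (1 / 2 : ℝ) *
      ENNReal.ofReal (extWeight C q k s' (-1) z w) ^ (1 / 2 : ℝ)) := (hm2 1).mul (hm2 (-1))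
  rw [bhattacharyya, ← lintegral_stdGauss_rotate hrt hmm, bhattacharyya]
  refine lintegral_mono fun w => ?_
  have hrot : Measurable (fun v : {j : Fin n // j ≠ k} → ℝ => r • w + t • v) := by fun_prop
  have hcs := ENNReal.lintegral_mul_le_Lp_mul_Lq (stdGauss {j : Fin n // j ≠ k})
    Real.HolderConjugate.two_two ((hm2 1).comp hrot).aemeasurable
    ((hm2 (-1)).comp hrot).aemeasurable
  have hsq : ∀ y : ℝ≥0∞, (y ^ (1 / 2 : ℝ)) ^ (2 : ℝ) = y := fun y => by
    rw [← ENNReal.rpow_mul]; norm_num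
  simp only [Function.comp_apply, hsq, lintegral_extWeight_rotate hq k hrt, hrs] at hcs
  exact hcs

lemma mul_rpow_neg_half_div {P Q : ℝ≥0∞} (hP : P ≠ ⊤) (hQ : Q ≠ ⊤) :
    P * (P / Q) ^ (-(1 / 2) : ℝ) = P ^ (1 / 2 : ℝ) * Q ^ (1 / 2 : ℝ) := by
  rcases eq_or_ne P 0 with rfl | hP0
  · simp
  rcases eq_or_ne Q 0 with rfl | hQ0
  · simp [ENNReal.div_zero hP0]
  rw [ENNReal.div_eq_inv_mul, ENNReal.mul_rpow_of_ne_top (by simpa using hQ0) hP,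
    ENNReal.inv_rpow, ENNReal.rpow_neg, inv_inv, mul_left_comm, mul_comm]
  congr 1
  have : P = P ^ (1 / 2 : ℝ) * P ^ (1 / 2 : ℝ) := by
    rw [← ENNReal.rpow_add _ _ hP0 hP]; norm_num
  conv_lhs => rw [ENNReal.rpow_neg]
  nth_rewrite 1 [this]
  rw [mul_assoc, ENNReal.mul_inv_cancel, mul_one]
  · simp [hP0, hP]
  · simp [hP]

variable {μ : Measure Ω} [IsProbabilityMeasure μ] {X N : Ω → Fin n → ℝ} {Z : Ω → β}

/-- On the event that the bit is `1` the observation has density `P`, the likelihood ratio is `P /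
Q`, and `P (P / Q) ^ (-1/2) = √P √Q`. The coefficient is thus a moment of the log likelihood ratio,
to which the Gaussian hypothesis applies. -/
lemma IsCodeModel.lintegral_exp_extrinsicLLR (h : IsCodeModel μ C X N Z) (γ : ℝ≥0) (k : Fin n) :
    ∫⁻ ω in {ω | X ω k = 1}, EReal.exp (extrinsicLLR μ X (awgn X N γ) Z k ω) ^ (-(1 / 2) : ℝ) ∂μ =
      ∫⁻ z, bhattacharyya C (codePrior μ X Z) k √γ z ∂(μ.map Z) := by
  have hset : MeasurableSet {ω | X ω k = 1} :=
    measurableSet_eq_fun ((measurable_pi_apply k).comp h.measurable_X) measurable_const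
  set F : (Fin n → ℝ) → β → ({j : Fin n // j ≠ k} → ℝ) → ℝ≥0∞ := fun c z w =>
    {c : Fin n → ℝ | c k = 1}.indicator (fun _ => extRatio C (codePrior μ X Z) k √γ z w ^
      (-(1 / 2) : ℝ)) c with hF
  have hFm : ∀ c, Measurable (fun p : β × ({j : Fin n // j ≠ k} → ℝ) => F c p.1 p.2) := by
    intro c
    by_cases hc : c ∈ {c : Fin n → ℝ | c k = 1}
    · simp only [hF, indicator_of_mem hc]
      exact (measurable_extRatio measurable_codePrior k _).pow_const _
    · simp only [hF, indicator_of_notMem hc]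
      exact measurable_const
  have h1 : ∫⁻ ω in {ω | X ω k = 1},
      EReal.exp (extrinsicLLR μ X (awgn X N γ) Z k ω) ^ (-(1 / 2) : ℝ) ∂μ =
      ∫⁻ ω, F (X ω) (Z ω) (extObs X N √γ k ω) ∂μ := by
    rw [← lintegral_indicator hset]
    refine lintegral_congr_ae ?_
    filter_upwards [h.extrinsicLLR_ae_eq γ k] with ω hω
    simp only [hF, indicator, mem_ofPred_eq, hω]
  rw [h1, h.hasChannelLaw √γ k F hFm]
  refine lintegral_congr fun z => lintegral_congr fun w => ?_
  have h2 : ∀ c ∈ C, ENNReal.ofReal (codePrior μ X Z c z *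
      shiftDensity ((√γ : ℝ) • dropCoord k c) w) * F c z w =
      {c : Fin n → ℝ | c k = 1}.indicator (fun c => ENNReal.ofReal (codePrior μ X Z c z) *
        ENNReal.ofReal (shiftDensity ((√γ : ℝ) • dropCoord k c) w)) c *
        extRatio C (codePrior μ X Z) k √γ z w ^ (-(1 / 2) : ℝ) := by
    intro c _
    rw [ENNReal.ofReal_mul (codePrior_nonneg c z)]
    by_cases hc : c ∈ {c : Fin n → ℝ | c k = 1}
    · simp only [hF, indicator_of_mem hc]
    · simp only [hF, indicator_of_notMem hc, mul_zero, zero_mul]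
  rw [Finset.sum_congr rfl h2, ← Finset.sum_mul, ← ofReal_extWeight codePrior_nonneg, extRatio,
    mul_rpow_neg_half_div (by simp) (by simp)]

/-- The Bhattacharyya coefficient of the Gaussian channel. -/
lemma lintegral_awgnLLRLaw_exp (g : ℝ≥0∞) :
    ∫⁻ l, EReal.exp l ^ (-(1 / 2) : ℝ) ∂awgnLLRLaw g 1 =
      if g = ⊤ then 0 else ENNReal.ofReal (Real.exp (-(g.toReal / 2))) := by
  have hm : Measurable (fun l : EReal => EReal.exp l ^ (-(1 / 2) : ℝ)) :=
    EReal.measurable_exp.pow_const _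
  rw [awgnLLRLaw, if_pos rfl]
  split_ifs with hg
  · rw [lintegral_dirac' _ hm]
    simp
  · rw [lintegral_map hm measurable_coe_real_ereal]
    have h1 : ∀ x : ℝ, EReal.exp (x : EReal) ^ (-(1 / 2) : ℝ) =
        ENNReal.ofReal (Real.exp ((-(1 / 2)) * x)) := by
      intro x
      rw [EReal.exp_coe, ENNReal.ofReal_rpow_of_pos (Real.exp_pos _), ← Real.exp_mul, mul_comm]
    simp_rw [h1]
    rw [← ofReal_integral_eq_lintegral_ofReal (integrable_exp_mul_gaussianReal _)
      (ae_of_all _ fun x => (Real.exp_pos _).le)]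
    -- With mean `2 g` and variance `4 g`, the exponent at `-1/2` is `-g + g / 2 = -g / 2`.
    have h2 := congrFun (mgf_id_gaussianReal (μ := 2 * g.toReal * 1) (v := 4 * g.toNNReal))
      (-(1 / 2))
    simp only [mgf, id] at h2
    rw [h2]
    congr 2
    push_cast
    ring

lemma le_of_bhattacharyya_le {g g' : ℝ≥0∞}
    (h : (if g' = ⊤ then 0 else ENNReal.ofReal (Real.exp (-(g'.toReal / 2)))) ≤
      if g = ⊤ then 0 else ENNReal.ofReal (Real.exp (-(g.toReal / 2)))) : g ≤ g' := by
  by_cases hg' : g' = ⊤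
  · simp [hg']
  by_cases hg : g = ⊤
  · rw [if_neg hg', if_pos hg] at h
    have := Real.exp_pos (-(g'.toReal / 2))
    simp at h
    linarith
  · rw [if_neg hg', if_neg hg, ENNReal.ofReal_le_ofReal_iff (Real.exp_pos _).le,
      Real.exp_le_exp] at h
    rw [← ENNReal.toReal_le_toReal hg hg']
    linarith

/-- The extrinsic signal to noise ratio increases with the a priori signal to noise ratio. -/
lemma IsCodeModel.monotone_of_gaussianExtrinsic (h : IsCodeModel μ C X N Z) (hn : 0 < n)
    {γext : ℝ≥0 → ℝ≥0∞} (hext : GaussianExtrinsic μ X N Z γext) : Monotone γext := by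
  intro γ γ' hγ
  refine le_of_bhattacharyya_le ?_
  rw [← lintegral_awgnLLRLaw_exp, ← lintegral_awgnLLRLaw_exp]
  have hm : Measurable (fun l : EReal => EReal.exp l ^ (-(1 / 2) : ℝ)) :=
    EReal.measurable_exp.pow_const _
  have e := fun γ => h.sum_lintegral_extrinsicLLR hn hext γ (Or.inl rfl) hm
  simp_rw [h.lintegral_exp_extrinsicLLR] at e
  have hle : ∑ k, ∫⁻ z, bhattacharyya C (codePrior μ X Z) k √γ' z ∂(μ.map Z) ≤
      ∑ k, ∫⁻ z, bhattacharyya C (codePrior μ X Z) k √γ z ∂(μ.map Z) :=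
    Finset.sum_le_sum fun k _ => lintegral_mono fun z => bhattacharyya_le codePrior_nonneg
      measurable_codePrior k (Real.sqrt_nonneg _) (Real.sqrt_le_sqrt hγ) z
  rw [e, e] at hle
  rw [ENNReal.mul_le_mul_iff_right (by simpa using hn.ne') (by simp),
    ENNReal.mul_le_mul_iff_right (by simp) (by simp)] at hle
  exact hle

end Monotone

/-! ### The mean squared error through the extrinsic channel -/

section ExtrinsicMMSE

lemma lintegral_gaussianReal_rotate {r t : ℝ} (hrt : r ^ 2 + t ^ 2 = 1) {F : ℝ → ℝ≥0∞}
    (hF : Measurable F) :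
    ∫⁻ w, ∫⁻ v, F (r * w + t * v) ∂gaussianReal 0 1 ∂gaussianReal 0 1 =
      ∫⁻ w, F w ∂gaussianReal 0 1 := by
  conv_rhs => rw [← gaussianReal_map_rotate hrt, lintegral_map hF (by fun_prop)]
  rw [lintegral_prod _ (by fun_prop)]

/-- Signal to noise ratios of independent Gaussian observations add. The log likelihood ratios sum
to `2 ((γ + g) x + √γ m + √g v)`, and by rotation the noise `√γ m + √g v` is distributed as `√(γ +
g)` times a standard Gaussian. -/
lemma lintegral_softError_awgnLLRLaw (γ : ℝ≥0) {g : ℝ≥0∞} (hg : g ≠ ⊤) {x : ℝ} :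
    ∫⁻ m, ∫⁻ l, softError (EReal.exp l * ENNReal.ofReal (Real.exp (2 * (√γ * (√γ * x + m)))))
      ∂awgnLLRLaw g x ∂gaussianReal 0 1 =
    ∫⁻ m, softError (ENNReal.ofReal (Real.exp (2 * (√(γ + g).toReal * (√(γ + g).toReal * x + m)))))
      ∂gaussianReal 0 1 := by
  set a := g.toReal with ha
  have ha0 : 0 ≤ a := ENNReal.toReal_nonneg
  set t := √((γ : ℝ≥0∞) + g).toReal with ht
  have htsq : t ^ 2 = γ + a := by
    rw [ht, Real.sq_sqrt ENNReal.toReal_nonneg, ENNReal.toReal_add (by simp) hg, ha]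
    simp
  have hγsq : (√(γ : ℝ)) ^ 2 = γ := Real.sq_sqrt γ.2
  have hasq : (√a) ^ 2 = a := Real.sq_sqrt ha0
  have hmap : awgnLLRLaw g x =
      (gaussianReal 0 1).map (fun v : ℝ => ((2 * a * x + 2 * √a * v : ℝ) : EReal)) := by
    rw [awgnLLRLaw, if_neg hg]
    have h1 : gaussianReal (2 * a * x) (4 * g.toNNReal) =
        (gaussianReal 0 1).map (fun v => 2 * a * x + 2 * √a * v) := by
      have h2 := gaussianReal_map_const_mul (μ := 0) (v := 1) (2 * √a)
      have h3 := gaussianReal_map_const_add (μ := 2 * √a * 0)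
        (v := .mk ((2 * √a) ^ 2) (sq_nonneg _) * 1) (2 * a * x)
      rw [← h2, Measure.map_map (by fun_prop) (by fun_prop)] at h3
      rw [show (fun v => 2 * a * x + 2 * √a * v) =
        (fun v => 2 * a * x + v) ∘ (fun v => 2 * √a * v) from rfl, h3]
      congr 1
      · ring
      · ext
        push_cast
        rw [mul_pow, hasq]
        simp [ha]
        norm_num
    rw [h1, Measure.map_map measurable_coe_real_ereal (by fun_prop)]
    rfl
  have hin : ∀ m : ℝ, ∫⁻ l, softError (EReal.exp l *
      ENNReal.ofReal (Real.exp (2 * (√γ * (√γ * x + m))))) ∂awgnLLRLaw g x =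
      ∫⁻ v, softError (ENNReal.ofReal (Real.exp (2 * (t ^ 2 * x + (√γ * m + √a * v)))))
        ∂gaussianReal 0 1 := by
    intro m
    have hm : Measurable (fun l : EReal => softError (EReal.exp l *
      ENNReal.ofReal (Real.exp (2 * (√γ * (√γ * x + m)))))) :=
      measurable_softError.comp (EReal.measurable_exp.mul_const _)
    have hc : Measurable (fun v : ℝ => ((2 * a * x + 2 * √a * v : ℝ) : EReal)) :=
      measurable_coe_real_ereal.comp (show Measurable fun v : ℝ => 2 * a * x + 2 * √a * v by fun_prop)
    rw [hmap, lintegral_map hm hc]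
    refine lintegral_congr fun v => ?_
    rw [EReal.exp_coe, ← ENNReal.ofReal_mul (Real.exp_pos _).le, ← Real.exp_add]
    congr 3
    rw [htsq]
    linear_combination 2 * x * hγsq
  simp_rw [hin]
  -- The rotation has entries `√γ / t` and `√a / t`, so the case without any signal is separate.
  rcases eq_or_ne t 0 with h0 | h0
  · have h1 : (γ : ℝ) + a = 0 := by rw [← htsq, h0]; ring
    have h2 : (γ : ℝ) = 0 := by have := γ.2; simp only [NNReal.val_eq_coe] at this; linarith
    have h3 : a = 0 := by linarith
    simp [h0, h2, h3]
  · have hrt : (√γ / t) ^ 2 + (√a / t) ^ 2 = 1 := by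
      rw [div_pow, div_pow, hγsq, hasq, ← add_div, ← htsq, div_self (pow_ne_zero 2 h0)]
    have hF : Measurable (fun m : ℝ =>
        softError (ENNReal.ofReal (Real.exp (2 * (t * (t * x + m)))))) :=
      measurable_softError.comp (by fun_prop)
    rw [← lintegral_gaussianReal_rotate hrt hF]
    refine lintegral_congr fun m => lintegral_congr fun v => ?_
    congr 4
    field_simp

lemma lintegral_softError_eq_phi (γ : ℝ≥0) (g : ℝ≥0∞) :
    2⁻¹ * ∫⁻ m, ∫⁻ l, softError (EReal.exp l * ENNReal.ofReal (Real.exp (2 * (√γ * (√γ * 1 + m)))))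
      ∂awgnLLRLaw g 1 ∂gaussianReal 0 1 +
    2⁻¹ * ∫⁻ m, ∫⁻ l, softError (EReal.exp l *
      ENNReal.ofReal (Real.exp (2 * (√γ * (√γ * (-1) + m))))) ∂awgnLLRLaw g (-1) ∂gaussianReal 0 1 =
    ENNReal.ofReal (phi (γ + g)) := by
  by_cases hg : g = ⊤
  · have hz : ∀ x : ℝ, ∀ m : ℝ, ∫⁻ l, softError (EReal.exp l *
        ENNReal.ofReal (Real.exp (2 * (√γ * (√γ * x + m))))) ∂awgnLLRLaw g x = 0 := by
      intro x m
      have hm : Measurable (fun l : EReal => softError (EReal.exp l *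
          ENNReal.ofReal (Real.exp (2 * (√γ * (√γ * x + m)))))) :=
        measurable_softError.comp (EReal.measurable_exp.mul_const _)
      rw [awgnLLRLaw, if_pos hg, lintegral_dirac' _ hm]
      split_ifs
      · rw [EReal.exp_top, ENNReal.top_mul (by simp [Real.exp_pos])]
        simp [softError]
      · simp [softError]
    simp only [hz, lintegral_zero, mul_zero, add_zero]
    rw [hg, add_top, phi_top, ENNReal.ofReal_zero]
  · rw [lintegral_softError_awgnLLRLaw γ hg, lintegral_softError_awgnLLRLaw γ hg,
      ofReal_phi (by simp [hg])]

variable {Ω β : Type*} [MeasurableSpace Ω] [MeasurableSpace β] {n : ℕ} {C : Finset (Fin n → ℝ)}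

lemma dotProduct_eq_dropCoord (k : Fin n) (c y : Fin n → ℝ) :
    c ⬝ᵥ y = c k * y k + dropCoord k c ⬝ᵥ dropCoord k y := by
  simp only [dotProduct, dropCoord]
  rw [← Finset.add_sum_erase _ _ (Finset.mem_univ k)]
  congr 1
  rw [← Finset.sum_coe_sort]
  refine Fintype.sum_equiv (Equiv.subtypeEquivRight (by simp)) _ _ (fun _ => rfl)

omit [MeasurableSpace β] in
/-- The estimation error of a bit in terms of its extrinsic likelihood ratio. -/
lemma one_sub_postMean_sq_eq {q : (Fin n → ℝ) → β → ℝ} (hC : ∀ c ∈ C, ∀ i, c i = 1 ∨ c i = -1)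
    (hq : ∀ c z, 0 ≤ q c z) (k : Fin n) (s : ℝ) {z : β} (hz : ∑ c ∈ C, q c z = 1)
    (y : Fin n → ℝ) :
    ENNReal.ofReal (1 - postMean C (fun c => q c z) s y k ^ 2) =
      softError (extRatio C q k s z (dropCoord k y) *
        ENNReal.ofReal (Real.exp (2 * (s * y k)))) := by
  classical
  set K := Real.exp (-(s ^ 2 * Fintype.card {j : Fin n // j ≠ k} / 2)) with hK
  have hK0 : K ≠ 0 := (Real.exp_pos _).ne'
  have hd : ∀ c ∈ C, shiftDensity (s • dropCoord k c) (dropCoord k y) =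
      K * Real.exp (s * (dropCoord k c ⬝ᵥ dropCoord k y)) := fun c hc =>
    shiftDensity_smul_of_mem (C := C.image (dropCoord k)) (by
      intro d hd i
      obtain ⟨c, hc, rfl⟩ := Finset.mem_image.1 hd
      exact hC c hc i) (Finset.mem_image_of_mem _ hc) s _
  set P := extWeight C q k s 1 z (dropCoord k y) with hP
  set Q := extWeight C q k s (-1) z (dropCoord k y) with hQ
  set e := Real.exp (s * y k) with he
  -- The parameter treats numerator and denominator of the posterior mean together: `σ = 1` gives
  -- the partition function, `σ = -1` the sum weighted by the bit.
  have hterm : ∀ c ∈ C, ∀ σ : ℝ, q c z * Real.exp (s * (c ⬝ᵥ y)) * (if c k = 1 then 1 else σ) * K =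
      {c : Fin n → ℝ | c k = 1}.indicator
        (fun c => q c z * shiftDensity (s • dropCoord k c) (dropCoord k y)) c * e +
      σ * ({c : Fin n → ℝ | c k = -1}.indicator
        (fun c => q c z * shiftDensity (s • dropCoord k c) (dropCoord k y)) c * e⁻¹) := by
    intro c hc σ
    rw [dotProduct_eq_dropCoord k, mul_add, Real.exp_add, he, ← Real.exp_neg]
    simp only [indicator, mem_ofPred_eq, hd c hc]
    rcases hC c hc k with h | h <;> rw [h] <;> norm_num <;> ring
  have hsum : ∀ σ : ℝ, (∑ c ∈ C, q c z * Real.exp (s * (c ⬝ᵥ y)) * (if c k = 1 then 1 else σ)) * K =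
      P * e + σ * (Q * e⁻¹) := by
    intro σ
    rw [Finset.sum_mul, Finset.sum_congr rfl fun c hc => hterm c hc σ, Finset.sum_add_distrib,
      ← Finset.mul_sum, ← Finset.sum_mul, ← Finset.sum_mul]
    rfl
  have hden : partFn C (fun c => q c z) s y * K = P * e + Q * e⁻¹ := by
    have := hsum 1
    simpa [partFn] using this
  have hnum : (∑ c ∈ C, q c z * Real.exp (s * (c ⬝ᵥ y)) * c k) * K = P * e - Q * e⁻¹ := by
    have h1 : ∀ c ∈ C, q c z * Real.exp (s * (c ⬝ᵥ y)) * c k =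
        q c z * Real.exp (s * (c ⬝ᵥ y)) * (if c k = 1 then 1 else -1) := by
      intro c hc
      rcases hC c hc k with h | h <;> rw [h] <;> norm_num
    rw [Finset.sum_congr rfl h1, hsum]
    ring
  have hpm : postMean C (fun c => q c z) s y k = (P * e - Q * e⁻¹) / (P * e + Q * e⁻¹) := by
    rw [postMean, ← hnum, ← hden, mul_div_mul_right _ _ hK0]
  rw [hpm, ofReal_one_sub_sq_eq_softError (extWeight_nonneg hq k s 1 z _)
    (extWeight_nonneg hq k s (-1) z _) (extWeight_add_pos hC hq k s hz _) (Real.exp_pos _), extRatio,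
    ← Real.exp_add, ← two_mul]

/-- Density of the estimation error of bit `k` for the codeword `c`. -/
def errorDensity (C : Finset (Fin n → ℝ)) (q : (Fin n → ℝ) → β → ℝ) (k : Fin n) (s : ℝ)
    (c : Fin n → ℝ) (m : ℝ) (z : β) (w : {j : Fin n // j ≠ k} → ℝ) : ℝ≥0∞ :=
  ENNReal.ofReal (q c z * shiftDensity (s • dropCoord k c) w) *
    softError (extRatio C q k s z w * ENNReal.ofReal (Real.exp (2 * (s * (s * c k + m)))))

lemma measurable_softError_mul {α : Type*} [MeasurableSpace α] {f g : α → ℝ≥0∞}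
    (hf : Measurable f) (hg : Measurable g) : Measurable fun a => softError (f a * g a) :=
  measurable_softError.comp (hf.mul hg)

lemma measurable_errorDensity {q : (Fin n → ℝ) → β → ℝ} (hq : ∀ c, Measurable (q c)) (k : Fin n)
    (s : ℝ) (c : Fin n → ℝ) : Measurable (fun p : (ℝ × β) × ({j : Fin n // j ≠ k} → ℝ) =>
      errorDensity C q k s c p.1.1 p.1.2 p.2) := by
  unfold errorDensity
  have h1 : Measurable (fun p : (ℝ × β) × ({j : Fin n // j ≠ k} → ℝ) => q c p.1.2) :=
    (hq c).comp (measurable_snd.comp measurable_fst)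
  have h2 : Measurable (fun p : (ℝ × β) × ({j : Fin n // j ≠ k} → ℝ) =>
      shiftDensity (s • dropCoord k c) p.2) := (measurable_shiftDensity _).comp measurable_snd
  have h3 : Measurable (fun p : (ℝ × β) × ({j : Fin n // j ≠ k} → ℝ) =>
      extRatio C q k s p.1.2 p.2) := by
    have h4 : Measurable (fun p : (ℝ × β) × ({j : Fin n // j ≠ k} → ℝ) => (p.1.2, p.2)) := by
      fun_prop
    have h5 := (measurable_extRatio (C := C) (q := q) hq k s).comp h4
    exact h5
  have h4 : Measurable (fun p : (ℝ × β) × ({j : Fin n // j ≠ k} → ℝ) =>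
      ENNReal.ofReal (Real.exp (2 * (s * (s * c k + p.1.1))))) := by fun_prop
  have h5 := (h1.fun_mul h2).ennreal_ofReal
  have h6 := measurable_softError_mul h3 h4
  exact h5.fun_mul h6

lemma lintegral_one_sub_postMean_sq {q : (Fin n → ℝ) → β → ℝ}
    (hC : ∀ c ∈ C, ∀ i, c i = 1 ∨ c i = -1) (hq : ∀ c z, 0 ≤ q c z) (hqm : ∀ c, Measurable (q c))
    (k : Fin n) (s : ℝ) {z : β} (hz : ∑ c ∈ C, q c z = 1) (c : Fin n → ℝ) :
    ENNReal.ofReal (q c z) *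
      ∫⁻ w, ENNReal.ofReal (1 - postMean C (fun c => q c z) s (s • c + w) k ^ 2) ∂stdGauss (Fin n) =
    ∫⁻ m, ∫⁻ w, errorDensity C q k s c m z w ∂stdGauss {j : Fin n // j ≠ k} ∂gaussianReal 0 1 := by
  simp_rw [one_sub_postMean_sq_eq hC hq k s hz]
  have hR : Measurable (fun w : {j : Fin n // j ≠ k} → ℝ => extRatio C q k s z w) := by
    have := (measurable_extRatio (C := C) (q := q) hqm k s).comp (measurable_prodMk_left (x := z))
    exact this
  set F : ℝ → ({j : Fin n // j ≠ k} → ℝ) → ℝ≥0∞ := fun m v =>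
    softError (extRatio C q k s z (s • dropCoord k c + v) *
      ENNReal.ofReal (Real.exp (2 * (s * (s * c k + m))))) with hF
  have hFm : Measurable (fun p : ℝ × ({j : Fin n // j ≠ k} → ℝ) => F p.1 p.2) := by
    have : Measurable (fun p : ℝ × ({j : Fin n // j ≠ k} → ℝ) =>
        extRatio C q k s z (s • dropCoord k c + p.2)) := by
      have h5 : Measurable (fun p : ℝ × ({j : Fin n // j ≠ k} → ℝ) => s • dropCoord k c + p.2) :=
        measurable_snd.const_add _
      have h6 := hR.comp h5
      exact h6
    have h4 : Measurable (fun p : ℝ × ({j : Fin n // j ≠ k} → ℝ) =>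
      ENNReal.ofReal (Real.exp (2 * (s * (s * c k + p.1))))) := by fun_prop
    exact measurable_softError_mul this h4
  have h1 := lintegral_stdGauss_split k hFm
  have h2 : ∀ w : Fin n → ℝ, softError (extRatio C q k s z (dropCoord k (s • c + w)) *
      ENNReal.ofReal (Real.exp (2 * (s * (s • c + w) k)))) = F (w k) (dropCoord k w) :=
    fun w => rfl
  simp_rw [h2]
  rw [h1, ← lintegral_const_mul _ hFm.lintegral_prod_right']
  refine lintegral_congr fun m => ?_
  have h3 : Measurable (fun w : {j : Fin n // j ≠ k} → ℝ => softError (extRatio C q k s z w *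
      ENNReal.ofReal (Real.exp (2 * (s * (s * c k + m)))))) :=
    measurable_softError.comp (hR.mul_const _)
  have h4 := lintegral_stdGauss_add (s • dropCoord k c) h3
  have h5 : ∫⁻ v, F m v ∂stdGauss {j : Fin n // j ≠ k} = _ := h4
  have h6 : Measurable (fun w : {j : Fin n // j ≠ k} → ℝ =>
      ENNReal.ofReal (shiftDensity (s • dropCoord k c) w) * softError (extRatio C q k s z w *
      ENNReal.ofReal (Real.exp (2 * (s * (s * c k + m)))))) :=
    (measurable_shiftDensity _).ennreal_ofReal.mul h3
  rw [h5, ← lintegral_const_mul _ h6]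
  refine lintegral_congr fun w => ?_
  rw [errorDensity, ENNReal.ofReal_mul (hq c z), mul_assoc]

lemma ofReal_totalMMSE {p : (Fin n → ℝ) → ℝ} (hC : ∀ c ∈ C, ∀ i, c i = 1 ∨ c i = -1)
    (h0 : ∀ c ∈ C, 0 ≤ p c) (s : ℝ) :
    ENNReal.ofReal (totalMMSE C p s) = ∑ k, ∑ c ∈ C, ENNReal.ofReal (p c) *
      ∫⁻ w, ENNReal.ofReal (1 - postMean C p s (s • c + w) k ^ 2) ∂stdGauss (Fin n) := by
  have hnn : ∀ k y, 0 ≤ 1 - postMean C p s y k ^ 2 := fun k y =>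
    sub_nonneg.2 (postMean_sq_le hC h0 s y k)
  have hm : ∀ c k, Measurable (fun w => 1 - postMean C p s (s • c + w) k ^ 2) := fun c k =>
    measurable_const.sub (((measurable_postMean C p s k).comp (measurable_const_add _)).pow_const 2)
  have hint : ∀ c k, Integrable (fun w => 1 - postMean C p s (s • c + w) k ^ 2)
      (stdGauss (Fin n)) := fun c k =>
    Integrable.of_bound (C := 1) (hm c k).aestronglyMeasurable (ae_of_all _ fun w => by
      rw [Real.norm_eq_abs, abs_of_nonneg (hnn k _)]
      linarith [sq_nonneg (postMean C p s (s • c + w) k)])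
  rw [totalMMSE, ENNReal.ofReal_sum_of_nonneg (fun c hc => mul_nonneg (h0 c hc)
    (integral_nonneg fun w => Finset.sum_nonneg fun k _ => hnn k _)), Finset.sum_comm]
  refine Finset.sum_congr rfl fun c hc => ?_
  rw [ENNReal.ofReal_mul (h0 c hc), ← Finset.mul_sum, integral_finsetSum _ fun k _ => hint c k,
    ENNReal.ofReal_sum_of_nonneg fun k _ => integral_nonneg fun w => hnn k _]
  congr 1
  exact Finset.sum_congr rfl fun k _ =>
    ofReal_integral_eq_lintegral_ofReal (hint c k) (ae_of_all _ fun w => hnn k _)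

variable {μ : Measure Ω} [IsProbabilityMeasure μ] {X N : Ω → Fin n → ℝ} {Z : Ω → β}

/-- The two events exhaust the values of bit `k`, so the left side is one integral over `Ω` of the
error evaluated at `X k`; the channel law rewrites it. The bit's own noise is frozen at `m`, leaving
an expectation involving only the bit and its extrinsic value. -/
lemma IsCodeModel.setLIntegral_softError_add (h : IsCodeModel μ C X N Z) (γ : ℝ≥0) (k : Fin n)
    (m : ℝ) :
    ∫⁻ ω in {ω | X ω k = 1}, softError (EReal.exp (extrinsicLLR μ X (awgn X N γ) Z k ω) *
      ENNReal.ofReal (Real.exp (2 * (√γ * (√γ * 1 + m))))) ∂μ +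
    ∫⁻ ω in {ω | X ω k = -1}, softError (EReal.exp (extrinsicLLR μ X (awgn X N γ) Z k ω) *
      ENNReal.ofReal (Real.exp (2 * (√γ * (√γ * (-1) + m))))) ∂μ =
    ∫⁻ z, ∫⁻ w, ∑ c ∈ C, errorDensity C (codePrior μ X Z) k √γ c m z w
      ∂stdGauss {j : Fin n // j ≠ k} ∂(μ.map Z) := by
  have hset : ∀ x : ℝ, MeasurableSet {ω | X ω k = x} := fun x =>
    measurableSet_eq_fun ((measurable_pi_apply k).comp h.measurable_X) measurable_const
  have hFm : ∀ c : Fin n → ℝ, Measurable (fun p : β × ({j : Fin n // j ≠ k} → ℝ) =>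
      softError (extRatio C (codePrior μ X Z) k √γ p.1 p.2 *
      ENNReal.ofReal (Real.exp (2 * (√γ * (√γ * c k + m)))))) := fun c =>
    measurable_softError.comp ((measurable_extRatio (C := C) (q := codePrior μ X Z)
      measurable_codePrior k √γ).mul_const _)
  have h1 := h.hasChannelLaw √γ k (fun c z w => softError (extRatio C (codePrior μ X Z) k √γ z w *
      ENNReal.ofReal (Real.exp (2 * (√γ * (√γ * c k + m)))))) hFm
  unfold errorDensity
  rw [← h1, ← lintegral_indicator (hset 1), ← lintegral_indicator (hset (-1)),
    ← lintegral_add_left]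
  · refine lintegral_congr_ae ?_
    filter_upwards [h.extrinsicLLR_ae_eq γ k, h.mem] with ω hω hmem
    simp only [indicator, mem_ofPred_eq, hω]
    rcases h.pm _ hmem k with h2 | h2 <;> rw [h2] <;> norm_num
  · have hY : Measurable (awgn X N γ) := by
      have := h.measurable_X
      have := h.measurable_N
      unfold awgn; fun_prop
    refine Measurable.indicator (measurable_softError.comp (Measurable.mul_const ?_ _)) (hset 1)
    exact EReal.measurable_exp.comp (measurable_extrinsicLLR h.measurable_Z hY k)

/-- The average minimum mean squared error, expressed through the extrinsic channel. -/
lemma IsCodeModel.lintegral_totalMMSE_eq (h : IsCodeModel μ C X N Z) (hn : 0 < n)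
    {γext : ℝ≥0 → ℝ≥0∞} (hext : GaussianExtrinsic μ X N Z γext) (γ : ℝ≥0) :
    ∫⁻ z, ENNReal.ofReal (totalMMSE C (fun c => codePrior μ X Z c z) √γ) ∂(μ.map Z) =
      n * ENNReal.ofReal (phi (γ + γext γ)) := by
  have hY : Measurable (awgn X N γ) := by
    have := h.measurable_X
    have := h.measurable_N
    unfold awgn; fun_prop
  have hmE := fun k c => measurable_errorDensity (C := C) (q := codePrior μ X Z)
    measurable_codePrior k √γ c
  have hmS : ∀ k, Measurable (fun p : (ℝ × β) × ({j : Fin n // j ≠ k} → ℝ) =>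
      ∑ c ∈ C, errorDensity C (codePrior μ X Z) k √γ c p.1.1 p.1.2 p.2) := fun k =>
    Finset.measurable_sum _ fun c _ => hmE k c
  have hmS' : ∀ k, Measurable (fun p : ℝ × β =>
      ∫⁻ w, ∑ c ∈ C, errorDensity C (codePrior μ X Z) k √γ c p.1 p.2 w
        ∂stdGauss {j : Fin n // j ≠ k}) := fun k => (hmS k).lintegral_prod_right'
  have h1 : ∫⁻ z, ENNReal.ofReal (totalMMSE C (fun c => codePrior μ X Z c z) √γ) ∂(μ.map Z) =
      ∫⁻ z, ∑ k, ∫⁻ m, ∫⁻ w, ∑ c ∈ C, errorDensity C (codePrior μ X Z) k √γ c m z w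
        ∂stdGauss {j : Fin n // j ≠ k} ∂gaussianReal 0 1 ∂(μ.map Z) := by
    refine lintegral_congr_ae ?_
    filter_upwards [h.sum_codePrior] with z hz
    rw [ofReal_totalMMSE h.pm fun c _ => codePrior_nonneg c z]
    refine Finset.sum_congr rfl fun k _ => ?_
    have hk1 : ∀ m c, Measurable (fun w => errorDensity C (codePrior μ X Z) k √γ c m z w) :=
      fun m c => by
        have := (hmE k c).comp (measurable_prodMk_left (x := (m, z)))
        exact this
    have hk2 : ∀ c, Measurable (fun m => ∫⁻ w, errorDensity C (codePrior μ X Z) k √γ c m z w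
        ∂stdGauss {j : Fin n // j ≠ k}) := fun c => by
      have hI : Measurable (fun p : ℝ × β =>
          ∫⁻ w, errorDensity C (codePrior μ X Z) k √γ c p.1 p.2 w
            ∂stdGauss {j : Fin n // j ≠ k}) := (hmE k c).lintegral_prod_right'
      have := hI.comp (measurable_prodMk_right (y := z))
      exact this
    simp_rw [lintegral_finsetSum _ fun c _ => hk1 _ c]
    rw [lintegral_finsetSum _ fun c _ => hk2 c]
    exact Finset.sum_congr rfl fun c _ => lintegral_one_sub_postMean_sq h.pm codePrior_nonneg
      measurable_codePrior k √γ hz c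
  have hmx : ∀ (k : Fin n) (x : ℝ), Measurable (fun p : ℝ × Ω =>
      softError (EReal.exp (extrinsicLLR μ X (awgn X N γ) Z k p.2) *
      ENNReal.ofReal (Real.exp (2 * (√γ * (√γ * x + p.1)))))) := fun k x => by
    have : Measurable (fun p : ℝ × Ω => EReal.exp (extrinsicLLR μ X (awgn X N γ) Z k p.2)) :=
      EReal.measurable_exp.comp ((measurable_extrinsicLLR h.measurable_Z hY k).comp measurable_snd)
    have h4 : Measurable (fun p : ℝ × Ω =>
      ENNReal.ofReal (Real.exp (2 * (√γ * (√γ * x + p.1))))) := by fun_prop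
    exact measurable_softError_mul this h4
  have hmx' : ∀ (k : Fin n) (x : ℝ), Measurable (fun m : ℝ => ∫⁻ ω in {ω | X ω k = x},
      softError (EReal.exp (extrinsicLLR μ X (awgn X N γ) Z k ω) *
      ENNReal.ofReal (Real.exp (2 * (√γ * (√γ * x + m))))) ∂μ) := fun k x =>
    (hmx k x).lintegral_prod_right'
  -- For fixed `m` the integrand is the same function of the extrinsic log likelihood ratio for
  -- every `k`, so a hypothesis on the law averaged over `k` is enough.
  have hlaw : ∀ x : ℝ, x = 1 ∨ x = -1 → ∑ k, ∫⁻ m, ∫⁻ ω in {ω | X ω k = x},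
      softError (EReal.exp (extrinsicLLR μ X (awgn X N γ) Z k ω) *
      ENNReal.ofReal (Real.exp (2 * (√γ * (√γ * x + m))))) ∂μ ∂gaussianReal 0 1 =
      n * (2⁻¹ * ∫⁻ m, ∫⁻ l, softError (EReal.exp l *
        ENNReal.ofReal (Real.exp (2 * (√γ * (√γ * x + m))))) ∂awgnLLRLaw (γext γ) x
          ∂gaussianReal 0 1) := by
    intro x hx
    have hsum := fun m : ℝ => h.sum_lintegral_extrinsicLLR hn hext γ hx
      (f := fun l => softError (EReal.exp l *
        ENNReal.ofReal (Real.exp (2 * (√γ * (√γ * x + m))))))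
      (measurable_softError.comp (EReal.measurable_exp.mul_const _))
    rw [← lintegral_finsetSum _ fun k _ => hmx' k x]
    simp_rw [hsum]
    rw [lintegral_const_mul' _ _ (by simp), lintegral_const_mul' _ _ (by simp)]
  rw [h1, lintegral_finsetSum]
  · have hswap : ∀ k, ∫⁻ z, ∫⁻ m, ∫⁻ w, ∑ c ∈ C, errorDensity C (codePrior μ X Z) k √γ c m z w
        ∂stdGauss {j : Fin n // j ≠ k} ∂gaussianReal 0 1 ∂(μ.map Z) =
        ∫⁻ m, ∫⁻ ω in {ω | X ω k = 1}, softError (EReal.exp (extrinsicLLR μ X (awgn X N γ) Z k ω) *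
          ENNReal.ofReal (Real.exp (2 * (√γ * (√γ * 1 + m))))) ∂μ ∂gaussianReal 0 1 +
        ∫⁻ m, ∫⁻ ω in {ω | X ω k = -1}, softError (EReal.exp (extrinsicLLR μ X (awgn X N γ) Z k ω) *
          ENNReal.ofReal (Real.exp (2 * (√γ * (√γ * (-1) + m))))) ∂μ ∂gaussianReal 0 1 := by
      intro k
      rw [lintegral_lintegral_swap, ← lintegral_add_left (hmx' k 1)]
      · exact lintegral_congr fun m => (h.setLIntegral_softError_add γ k m).symm
      · exact ((hmS' k).comp measurable_swap).aemeasurable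
    rw [Finset.sum_congr rfl fun k _ => hswap k, Finset.sum_add_distrib, hlaw 1 (Or.inl rfl),
      hlaw (-1) (Or.inr rfl), ← mul_add, lintegral_softError_eq_phi]
  · intro k _
    exact ((hmS' k).comp measurable_swap).lintegral_prod_right'

end ExtrinsicMMSE

/-! ### Assembling the two areas -/

section OuterRate

variable {Ω β : Type*} [MeasurableSpace Ω] [MeasurableSpace β] {n : ℕ} {C : Finset (Fin n → ℝ)}
  {μ : Measure Ω} [IsProbabilityMeasure μ] {X N : Ω → Fin n → ℝ} {Z : Ω → β}

lemma isCodeModel_of_uniformOn (hC : ∀ c ∈ C, ∀ i, c i = 1 ∨ c i = -1)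
    (hX : Measurable X) (hN : Measurable N) (hZ : Measurable Z)
    (hXlaw : μ.map X = uniformOn (C : Set (Fin n → ℝ)))
    (hbit : ∀ k, μ {ω | X ω k = 1} = 2⁻¹)
    (hNlaw : μ.map N = Measure.pi (fun _ => gaussianReal 0 1))
    (hindep : IndepFun N (fun ω => (X ω, Z ω)) μ) : IsCodeModel μ C X N Z := by
  have hmem : ∀ᵐ ω ∂μ, X ω ∈ C := by
    have h1 : (μ.map X) (C : Set (Fin n → ℝ))ᶜ = 0 := by
      rw [hXlaw, uniformOn, cond_apply C.measurableSet, inter_compl_self, measure_empty, mul_zero]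
    rw [Measure.map_apply hX C.measurableSet.compl] at h1
    exact measure_eq_zero_iff_ae_notMem.1 h1 |>.mono fun ω hω => by simpa using hω
  refine ⟨hC, hX, hN, hZ, hmem, ?_, hNlaw, hindep⟩
  rintro k x (rfl | rfl)
  · exact hbit k
  · have hm : MeasurableSet {ω | X ω k = 1} :=
      measurableSet_eq_fun ((measurable_pi_apply k).comp hX) measurable_const
    have h2 : ({ω | X ω k = -1} : Set Ω) =ᵐ[μ] {ω | X ω k = 1}ᶜ := by
      filter_upwards [hmem] with ω hω
      apply propext
      change X ω k = -1 ↔ ¬ X ω k = 1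
      rcases hC _ hω k with h | h <;> rw [h] <;> norm_num
    rw [measure_congr (t := ({ω | X ω k = 1} : Set Ω)ᶜ) h2, prob_compl_eq_one_sub hm, hbit, ENNReal.one_sub_inv_two]

/-- Twice the conditional entropy in nats is the area under the error curve. -/
lemma IsCodeModel.lintegral_phi_eq (h : IsCodeModel μ C X N Z) (hn : 0 < n)
    {γext : ℝ≥0 → ℝ≥0∞} (hext : GaussianExtrinsic μ X N Z γext) :
    n * ∫⁻ a in Ioi (0 : ℝ), ENNReal.ofReal (phi (ENNReal.ofReal a + γext a.toNNReal)) =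
      ENNReal.ofReal (2 * (condEntropyBits μ C X Z * Real.log 2)) := by
  have : IsProbabilityMeasure (μ.map Z) := Measure.isProbabilityMeasure_map h.measurable_Z.aemeasurable
  have hle : ∀ c z, codePrior μ X Z c z ≤ 1 := fun c z => measureReal_le_one
  have hnn : ∀ z, 0 ≤ ∑ c ∈ C, Real.negMulLog (codePrior μ X Z c z) := fun z =>
    Finset.sum_nonneg fun c _ => Real.negMulLog_nonneg (codePrior_nonneg c z) (hle c z)
  have hm : Measurable (fun z => ∑ c ∈ C, Real.negMulLog (codePrior μ X Z c z)) :=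
    Finset.measurable_sum _ fun c _ =>
      Real.continuous_negMulLog.measurable.comp (measurable_codePrior c)
  have hint : Integrable (fun z => ∑ c ∈ C, Real.negMulLog (codePrior μ X Z c z)) (μ.map Z) := by
    refine Integrable.of_bound (C := C.card) hm.aestronglyMeasurable (ae_of_all _ fun z => ?_)
    rw [Real.norm_eq_abs, abs_of_nonneg (hnn z), ← nsmul_one, ← Finset.sum_const]
    refine Finset.sum_le_sum fun c _ => ?_
    rcases (codePrior_nonneg (μ := μ) (X := X) (Z := Z) c z).eq_or_lt with h0 | h0
    · rw [← h0]; simp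
    -- This gives `-x log x ≤ 1 - x ≤ 1`, so the number of codewords bounds the entropy sum.
    · have := Real.one_sub_inv_le_log_of_pos h0
      rw [Real.negMulLog]
      have h3 := mul_le_mul_of_nonneg_left this h0.le
      rw [mul_sub, mul_inv_cancel₀ h0.ne', mul_one] at h3
      linarith
  have hs : Measurable (fun p : β × ℝ => √p.2) := measurable_snd.sqrt
  have hjoint : Measurable (fun p : β × ℝ =>
      ENNReal.ofReal (totalMMSE C (fun c => codePrior μ X Z c p.1) √p.2)) :=
    (measurable_totalMMSE (T := β × ℝ) C (fun c => (measurable_codePrior c).comp measurable_fst)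
      hs).ennreal_ofReal
  rw [h.condEntropyBits_eq, div_mul_cancel₀ _ (Real.log_pos one_lt_two).ne',
    ENNReal.ofReal_mul zero_le_two, ofReal_integral_eq_lintegral_ofReal hint (ae_of_all _ hnn),
    ← lintegral_const_mul _ hm.ennreal_ofReal, ← lintegral_const_mul' _ _ (by simp)]
  -- The entropy identity is applied for almost every `z` to the conditional law of the codeword.
  -- Tonelli's theorem then brings the integral over the signal to noise ratio outside.
  have h1 : ∫⁻ z, ENNReal.ofReal 2 *
        ENNReal.ofReal (∑ c ∈ C, Real.negMulLog (codePrior μ X Z c z)) ∂(μ.map Z) =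
      ∫⁻ z, (∫⁻ a in Ioi (0 : ℝ),
        ENNReal.ofReal (totalMMSE C (fun c => codePrior μ X Z c z) √a)) ∂(μ.map Z) := by
    refine lintegral_congr_ae ?_
    filter_upwards [h.sum_codePrior] with z hz
    rw [lintegral_totalMMSE h.pm (fun c _ => codePrior_nonneg c z) hz, ENNReal.ofReal_mul zero_le_two]
  rw [h1, lintegral_lintegral_swap hjoint.aemeasurable]
  refine setLIntegral_congr_fun measurableSet_Ioi fun a ha => ?_
  have h2 := h.lintegral_totalMMSE_eq hn hext a.toNNReal
  rw [Real.coe_toNNReal a (le_of_lt ha)] at h2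
  exact h2.symm

/-- The areas on the two sides of the curve sum to `log 4`, and the first is `2 H(X | Z) / n` in
nats, so the second is `log 4` times the rate. Finiteness of the sum gives integrability. -/
lemma IsCodeModel.integral_phi_eq (h : IsCodeModel μ C X N Z) (hn : 0 < n)
    {γext : ℝ≥0 → ℝ≥0∞} (hext : GaussianExtrinsic μ X N Z γext) {γap : ℝ → ℝ≥0∞}
    (hap : IsAprioriSNR γext γap) :
    IntegrableOn (fun t : ℝ => phi (γap t + ENNReal.ofReal t)) (Ioi 0) ∧
      maxOuterRate μ C X Z =
        (∫ t in Ioi (0 : ℝ), phi (γap t + ENNReal.ofReal t)) / Real.log 4 := by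
  have hlog2 : 0 < Real.log 2 := Real.log_pos one_lt_two
  have hlog4 : Real.log 4 = 2 * Real.log 2 := by
    rw [show (4 : ℝ) = 2 ^ 2 by norm_num, Real.log_pow]; norm_num
  have hn' : (0 : ℝ) < n := Nat.cast_pos.2 hn
  have harea := hap.lintegral_add (h.monotone_of_gaussianExtrinsic hn hext)
    (f := fun g => ENNReal.ofReal (phi g)) measurable_phi.ennreal_ofReal (by simp [phi_top])
  rw [lintegral_phi] at harea
  have hA := h.lintegral_phi_eq hn hext
  set A := ∫⁻ a in Ioi (0 : ℝ), ENNReal.ofReal (phi (ENNReal.ofReal a + γext a.toNNReal)) with hAdef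
  set B := ∫⁻ t in Ioi (0 : ℝ), ENNReal.ofReal (phi (γap t + ENNReal.ofReal t)) with hBdef
  have hAfin : A ≠ ⊤ := fun h0 => by simp [h0] at harea
  have hBfin : B ≠ ⊤ := fun h0 => by simp [h0] at harea
  have hmeas : AEStronglyMeasurable (fun t : ℝ => phi (γap t + ENNReal.ofReal t))
      (volume.restrict (Ioi 0)) := by
    have h1 : AEMeasurable (fun t : ℝ => γap t + ENNReal.ofReal t) (volume.restrict (Ioi 0)) :=
      hap.aemeasurable.add ENNReal.measurable_ofReal.aemeasurable
    exact (measurable_phi.comp_aemeasurable h1).aestronglyMeasurable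
  have hB : ∫ t in Ioi (0 : ℝ), phi (γap t + ENNReal.ofReal t) = B.toReal :=
    integral_eq_lintegral_of_nonneg_ae (ae_of_all _ fun t => phi_nonneg _) hmeas
  refine ⟨⟨hmeas, ?_⟩, ?_⟩
  · rw [hasFiniteIntegral_iff_ofReal (ae_of_all _ fun t => phi_nonneg _)]
    exact hBfin.lt_top
  · have hH : 0 ≤ condEntropyBits μ C X Z := by
      rw [h.condEntropyBits_eq]
      exact div_nonneg (integral_nonneg fun z => Finset.sum_nonneg fun c _ =>
        Real.negMulLog_nonneg (codePrior_nonneg c z) measureReal_le_one) hlog2.le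
    have h1 : n * A.toReal = 2 * (condEntropyBits μ C X Z * Real.log 2) := by
      have := congrArg ENNReal.toReal hA
      rwa [ENNReal.toReal_mul, ENNReal.toReal_natCast, ENNReal.toReal_ofReal (by positivity)] at this
    have h2 : A.toReal + B.toReal = Real.log 4 := by
      have := congrArg ENNReal.toReal harea
      rwa [ENNReal.toReal_add hAfin hBfin, ENNReal.toReal_ofReal (Real.log_nonneg (by norm_num))]
        at this
    rw [hB, maxOuterRate]
    have h3 : B.toReal = Real.log 4 - A.toReal := by linarith
    have h4 : A.toReal = 2 * (condEntropyBits μ C X Z * Real.log 2) / n := by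
      rw [← h1]; field_simp
    rw [h3, h4, hlog4]
    field_simp

end OuterRate

end

theorem lemma3 {Ω β : Type*} [MeasurableSpace Ω] [MeasurableSpace β]
    (μ : Measure Ω) [IsProbabilityMeasure μ]
    (n : ℕ) (hn : 0 < n)
    (C : Finset (Fin n → ℝ)) (hC : ∀ c ∈ C, ∀ i, c i = 1 ∨ c i = -1)
    (X N : Ω → Fin n → ℝ) (Z : Ω → β)
    (hX : Measurable X) (hN : Measurable N) (hZ : Measurable Z)
    -- the codeword is uniform on the code, and its bits are equiprobable
    (hXlaw : μ.map X = uniformOn (C : Set (Fin n → ℝ)))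
    (hbit : ∀ k, μ {ω | X ω k = 1} = 2⁻¹)
    -- the noise of the a priori channel
    (hNlaw : μ.map N = Measure.pi (fun _ => gaussianReal 0 1))
    (hindep : IndepFun N (fun ω => (X ω, Z ω)) μ)
    (γext : ℝ≥0 → ℝ≥0∞) (hext : GaussianExtrinsic μ X N Z γext) :
    (∃ γap : ℝ → ℝ≥0∞, IsAprioriSNR γext γap) ∧
    ∀ γap : ℝ → ℝ≥0∞, IsAprioriSNR γext γap →
      IntegrableOn (fun t : ℝ => phi (γap t + ENNReal.ofReal t)) (Set.Ioi 0) ∧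
      maxOuterRate μ C X Z =
        (∫ t in Set.Ioi (0 : ℝ), phi (γap t + ENNReal.ofReal t)) / Real.log 4 := by
  have h := isCodeModel_of_uniformOn hC hX hN hZ hXlaw hbit hNlaw hindep
  exact ⟨exists_isAprioriSNR (h.monotone_of_gaussianExtrinsic hn hext),
    fun γap hap => h.integral_phi_eq hn hext hap⟩
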